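/- **Theorem (non-vanishing geodesic distance).** Let $n\ge 1$, let $M$ be a compact connected oriented smooth manifold of dimension $n-1$ without boundary, and let $\bar g=\langle\cdot,\cdot\rangle$ be the Euclidean metric on $\mathbb R^n$. Let $\mathrm{Imm}=\mathrm{Imm}(M,\mathbb R^n)$ be the set of smooth immersions $M\to\mathbb R^n$, let $B_i=\mathrm{Imm}/\mathrm{Diff}(M)$ be its quotient by reparametrization, with projection $\pi:\mathrm{Imm}\to B_i$, and let $B_e=\mathrm{Emb}(M,\mathbb R^n)/\mathrm{Diff}(M)\subseteq B_i$ be the set of embedded hypersurfaces of type $M$. For $f\in\mathrm{Imm}$ let $g=f^*\bar g$ be the induced metric, $\mathrm{vol}(g)$ its volume density, $\mathrm{Vol}(f)=\int_M\mathrm{vol}(g)$, $\nu^f$ the unit normal field determined by the orientations, $L^f$ the Weingarten map and $\mathrm{Tr}(L^f)$ the scalar mean curvature. Let $\Phi:(0,\infty)\times\mathbb R\to\mathbb R$ be smooth, and define for vector fields $h,k$ along $f\in\mathrm{Imm}$ $$G^\Phi_f(h,k)=\int_M\Phi\big(\mathrm{Vol}(f),\mathrm{Tr}(L^f)\big)\,\langle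 h,k\rangle\,\mathrm{vol}(g).$$ For $F_0,F_1\in B_i$ let $$\mathrm{dist}^{G^\Phi}_{B_i}(F_0,F_1)=\inf_f\int_0^1\sqrt{G^\Phi_{f}\big(f_t^\perp,f_t^\perp\big)}\,dt\in[0,\infty],\qquad f_t^\perp=\langle f_t,\nu^{f}\rangle\,\nu^{f},$$ where the infimum is over all smooth paths $f:[0,1]\to\mathrm{Imm}$ (that is, smooth maps $[0,1]\times M\to\mathbb R^n$ that are immersions of $M$ at each time $t$) with $\pi(f(0))=F_0$ and $\pi(f(1))=F_1$. Suppose that one of the following two conditions holds for all $f\in\mathrm{Imm}$, at all points of $M$: 1. $\Phi(\mathrm{Vol}(f),\mathrm{Tr}(L^f))\ \ge\ C_1+C_2\,\mathrm{Tr}(L^f)^2$, with constants $C_1,C_2>0$; 2. $\Phi(\mathrm{Vol}(f),\mathrm{Tr}(L^f))\ \ge\ C\,\mathrm{Vol}(f)$, with a constant $C>0$. Then the geodesic distance separates points of $B_e$: if $F_0,F_1\in B_e$ and $F_0\neq F_1$, then $\mathrm{dist}^{G^\Phi}_{B_i}(F_0,F_1)>0$. -/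

import Mathlib

open scoped Manifold ContDiff ENNReal

noncomputable section

namespace ShapeSpace

/-- The model space of the `m`-dimensional manifold `M`. -/
abbrev Model (m : ℕ) : Type := EuclideanSpace ℝ (Fin m)

/-- The ambient Euclidean space, in which `M` is a hypersurface: `ℝⁿ` with `n = m + 1`. -/
abbrev Ambient (m : ℕ) : Type := EuclideanSpace ℝ (Fin (m + 1))

variable {m : ℕ} {M : Type*} [TopologicalSpace M] [ChartedSpace (Model m) M]

/-! ### Orientations -/

variable (m M) in
/-- An orientation of the manifold `M`: the sign `sgn x` says whether the coordinate basis of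
`T_x M` that comes from the preferred chart at `x` is positively (`1`) or negatively (`-1`)
oriented, and the choice depends continuously on `x`: read in the preferred chart at a fixed point
`x₀`, it does not change near `x₀`. -/
structure ManifoldOrientation where
  sgn : M → ℤˣ
  compatible : ∀ x₀ : M, ∀ᶠ x in nhds x₀,
    0 < (((sgn x : ℤˣ) : ℤ) : ℝ) * (((sgn x₀ : ℤˣ) : ℤ) : ℝ) *
      (fderiv ℝ (extChartAt (𝓡 m) x₀ ∘ (extChartAt (𝓡 m) x).symm)
        (extChartAt (𝓡 m) x x)).det

/-! ### Local differential geometry of a map `f : M → ℝᵐ⁺¹`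

Everything is written in the preferred chart around a point `c`, at the coordinates `u`. -/

/-- The coordinate expression of `f` in the preferred chart around `c`. -/
def localRep (f : M → Ambient m) (c : M) : Model m → Ambient m :=
  f ∘ (extChartAt (𝓡 m) c).symm

/-- The coordinate vector field `∂ᵢ f`. -/
def partialD (f : M → Ambient m) (c : M) (i : Fin m) (u : Model m) : Ambient m :=
  fderiv ℝ (localRep f c) u (EuclideanSpace.single i 1)

/-- The second partial derivative `∂ⱼ ∂ᵢ f`. -/
def partialD₂ (f : M → Ambient m) (c : M) (i j : Fin m) (u : Model m) : Ambient m :=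
  fderiv ℝ (partialD f c i) u (EuclideanSpace.single j 1)

/-- The components `g i j = ⟪∂ᵢ f, ∂ⱼ f⟫` of the pullback metric. -/
def gram (f : M → Ambient m) (c : M) (u : Model m) : Matrix (Fin m) (Fin m) ℝ :=
  Matrix.of fun i j => inner ℝ (partialD f c i u) (partialD f c j u)

/-- The coefficient `√(det g)` of the volume density with respect to Lebesgue measure. -/
def volDensity (f : M → Ambient m) (c : M) (u : Model m) : ℝ :=
  Real.sqrt (gram f c u).det

/-- The generalized cross product of `∂₁ f, …, ∂ₘ f`, the vector `N` such that
`⟪v, N⟫ = det (v, ∂₁ f, …, ∂ₘ f)` for all `v`. It is orthogonal to all `∂ᵢ f`, and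
`(N, ∂₁ f, …, ∂ₘ f)` is a positive basis of `ℝᵐ⁺¹` if the `∂ᵢ f` are linearly independent. -/
def crossNormal (f : M → Ambient m) (c : M) (u : Model m) : Ambient m :=
  WithLp.toLp 2 fun k : Fin (m + 1) => Matrix.det
    (Matrix.of (Fin.cons (Pi.single k 1) fun i l => partialD f c i u l) :
      Matrix (Fin (m + 1)) (Fin (m + 1)) ℝ)

/-- The unit normal field `ν` of an immersion `f` of the oriented manifold `M`: the unit vector
orthogonal to `T_x f (T_x M)` such that `(ν x, T_x f X₁, …, T_x f Xₘ)` is positively oriented if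
`(X₁, …, Xₘ)` is. -/
def unitNormal (o : ManifoldOrientation m M) (f : M → Ambient m) (x : M) : Ambient m :=
  ((((o.sgn x : ℤˣ) : ℤ) : ℝ) * ‖crossNormal f x (extChartAt (𝓡 m) x x)‖⁻¹) •
    crossNormal f x (extChartAt (𝓡 m) x x)

/-- The components `s i j = ⟪∂ⱼ ∂ᵢ f, ν⟫` at `x` of the scalar second fundamental form, in the
preferred chart at `x`. -/
def secondFundForm (o : ManifoldOrientation m M) (f : M → Ambient m) (x : M) :
    Matrix (Fin m) (Fin m) ℝ :=
  Matrix.of fun i j => inner ℝ (partialD₂ f x i j (extChartAt (𝓡 m) x x)) (unitNormal o f x)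

/-- The matrix of the Weingarten mapping `L = g⁻¹ s` at `x`, in the preferred chart at `x`. -/
def weingarten (o : ManifoldOrientation m M) (f : M → Ambient m) (x : M) :
    Matrix (Fin m) (Fin m) ℝ :=
  (gram f x (extChartAt (𝓡 m) x x))⁻¹ * secondFundForm o f x

/-- The scalar mean curvature `Tr L`. -/
def meanCurvature (o : ManifoldOrientation m M) (f : M → Ambient m) (x : M) : ℝ :=
  (weingarten o f x).trace

/-- The part `h^⊥ = ⟪h, ν⟫ ν` normal to `f` of a vector field `h` along `f`. -/
def normalPart (o : ManifoldOrientation m M) (f h : M → Ambient m) (x : M) : Ambient m :=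
  (inner ℝ (h x) (unitNormal o f x) : ℝ) • unitNormal o f x

/-! ### Shape space -/

variable (m M) in
/-- The space `Imm(M, ℝᵐ⁺¹)` of smooth maps with injective tangent map at every point. -/
def Imm : Type _ :=
  {f : M → Ambient m // ContMDiff (𝓡 m) 𝓘(ℝ, Ambient m) ∞ f ∧
    ∀ x, Function.Injective (mfderiv (𝓡 m) 𝓘(ℝ, Ambient m) f x)}

variable (m M) in
/-- Two immersions are equivalent if they differ by a smooth diffeomorphism of `M`. -/
instance reparam : Setoid (Imm m M) where
  r f g := ∃ φ : Diffeomorph (𝓡 m) (𝓡 m) M M ∞, g.1 = f.1 ∘ φ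
  iseqv :=
    { refl := fun _ => ⟨Diffeomorph.refl (𝓡 m) M ∞, rfl⟩
      symm := by
        rintro f g ⟨φ, h⟩
        refine ⟨φ.symm, ?_⟩
        rw [h]
        funext x
        simp
      trans := by
        rintro f g k ⟨φ, h⟩ ⟨ψ, h'⟩
        refine ⟨ψ.trans φ, ?_⟩
        rw [h', h]
        rfl }

variable (m M) in
/-- The shape space `B_i = Imm(M, ℝᵐ⁺¹) / Diff(M)` of immersed hypersurfaces of type `M`. -/
def ImmShape : Type _ := Quotient (reparam m M)

/-- The projection `π : Imm → B_i`. -/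
def Imm.shape (f : Imm m M) : ImmShape m M := Quotient.mk (reparam m M) f

variable (m M) in
/-- The space `B_e = Emb(M, ℝᵐ⁺¹) / Diff(M)` of embedded hypersurfaces of type `M`, as a subset
of `B_i`. -/
def embShapes : Set (ImmShape m M) :=
  {F | ∃ f : Imm m M, Topology.IsEmbedding f.1 ∧ f.shape = F}

variable (m M) in
/-- A smooth path `[0,1] → Imm(M, ℝᵐ⁺¹)`, that is, a smooth map on `[0,1] × M` which is an
immersion of `M` at every time. -/
structure ImmPath where
  toFun : ℝ → M → Ambient m
  smooth : ContMDiffOn (𝓘(ℝ, ℝ).prod (𝓡 m)) 𝓘(ℝ, Ambient m) ∞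
    (fun p : ℝ × M => toFun p.1 p.2) (Set.Icc (0 : ℝ) 1 ×ˢ Set.univ)
  immersion : ∀ t ∈ Set.Icc (0 : ℝ) 1, ContMDiff (𝓡 m) 𝓘(ℝ, Ambient m) ∞ (toFun t) ∧
    ∀ x, Function.Injective (mfderiv (𝓡 m) 𝓘(ℝ, Ambient m) (toFun t) x)

namespace ImmPath

/-- The initial immersion of a path. -/
def source (c : ImmPath m M) : Imm m M := ⟨c.toFun 0, c.immersion 0 (by simp)⟩

/-- The final immersion of a path. -/
def target (c : ImmPath m M) : Imm m M := ⟨c.toFun 1, c.immersion 1 (by simp)⟩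

/-- The velocity `f_t` of a path, a vector field along `f (t, ·)` for each time `t ∈ [0,1]`. -/
def velocity (c : ImmPath m M) (t : ℝ) (x : M) : Ambient m :=
  derivWithin (fun s => c.toFun s x) (Set.Icc 0 1) t

end ImmPath

/-! ### The volume of an immersion -/

section Volume

variable [IsManifold (𝓡 m) ∞ M] [T2Space M] [CompactSpace M]

variable (m M) in
/-- A smooth partition of unity on `M`, subordinate to the domains of the preferred charts. -/
def chartPartition : SmoothPartitionOfUnity M (𝓡 m) M Set.univ :=
  Classical.choose (SmoothPartitionOfUnity.exists_isSubordinate_chartAt_source (𝓡 m) M)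

variable [MeasurableSpace M]

/-- The measure `vol(f^* ḡ)` on `M`. Each function of the partition of unity is supported in the
domain of a chart, where it is integrated against `√(det g)` times Lebesgue measure. -/
def volMeasure (f : M → Ambient m) : MeasureTheory.Measure M :=
  MeasureTheory.Measure.sum fun c : M =>
    MeasureTheory.Measure.map (extChartAt (𝓡 m) c).symm
      ((MeasureTheory.volume.restrict (extChartAt (𝓡 m) c).target).withDensity fun u =>
        ENNReal.ofReal (chartPartition m M c ((extChartAt (𝓡 m) c).symm u) * volDensity f c u))

/-- The total volume `Vol(f)`. -/
def totalVol (f : M → Ambient m) : ℝ := (volMeasure f).real Set.univ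

/-! ### The almost local metric and its geodesic distance -/

/-- The almost local metric `G^Φ_f(h, k) = ∫_M Φ(Vol(f), Tr(L^f)) ⟪h, k⟫ vol(f^* ḡ)`. -/
def almostLocal (o : ManifoldOrientation m M) (Φ : ℝ → ℝ → ℝ) (f h k : M → Ambient m) : ℝ :=
  ∫ x, Φ (totalVol f) (meanCurvature o f x) * (inner ℝ (h x) (k x) : ℝ) ∂(volMeasure f)

/-- The length in `B_i` of the image `π ∘ f` of a path `f` in `Imm`. The vectors normal to `f`
are the horizontal ones, and the metric of `B_i` is the metric of `Imm` on horizontal vectors, so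
this is the integral over `[0,1]` of `√(G^Φ_f(f_t^⊥, f_t^⊥))`; for a horizontal path it is the
length of the path in `Imm`. -/
def shapeLength (o : ManifoldOrientation m M) (Φ : ℝ → ℝ → ℝ) (c : ImmPath m M) : ℝ≥0∞ :=
  ∫⁻ t in Set.Icc (0 : ℝ) 1, ENNReal.ofReal (Real.sqrt (almostLocal o Φ (c.toFun t)
    (normalPart o (c.toFun t) (c.velocity t)) (normalPart o (c.toFun t) (c.velocity t))))

/-- The geodesic distance on `B_i`: the infimum of the lengths of the paths from `F₀` to `F₁`,
which is `∞` if there are no such paths. -/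
def geodesicDist (o : ManifoldOrientation m M) (Φ : ℝ → ℝ → ℝ) (F₀ F₁ : ImmShape m M) : ℝ≥0∞ :=
  ⨅ (c : ImmPath m M) (_ : c.source.shape = F₀) (_ : c.target.shape = F₁), shapeLength o Φ c

end Volume

end ShapeSpace

end

noncomputable section

set_option linter.unusedSectionVars false

namespace ShapeSpace

/-! ### The determinant of `m + 1` vectors of `ℝᵐ⁺¹` -/

section LinearAlgebra

variable {m : ℕ}

/-! Fix a vector field X = ψ e on ℝᵐ⁺¹ with e constant and div X = dψ(e) bounded by K, and let F(f)
= ∫ ψ(f) ⟨e, ν⟩ vol be its flux through f. Along a path of immersions, F' = ∫ (div X)(f) ⟨f_t, ν⟩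
vol (`ImmPath.flux_variation`): only the normal velocity counts. With A = ∫ ⟨f_t, ν⟩² vol, the
Cauchy-Schwarz inequality gives |F'| ≤ K √Vol √A, so that moving the flux costs length as soon as
Vol · A is controlled by the metric G.

If Φ ≥ C Vol, then C Vol A ≤ G and |F'| ≤ (K/√C) √G. If Φ ≥ C₁ + C₂ (Tr L)², then C₁ A ≤ G, and the
volume has to be bounded along the path. From Vol' = -∫ Tr L ⟨f_t, ν⟩ vol
(`ImmPath.totalVol_variation`) one gets |(√Vol)'| ≤ √G / (2√C₂). Hence either the length is at least
1, or √Vol stays below √Vol(0) + 1/(2√C₂) and the flux is again Lipschitz. Both cases are collected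
in `exists_le_shapeLength`; the bound depends on the path only through its initial volume and the
change of its flux.

These two quantities are compatible with the quotient by Diff(M). The volume is invariant, and a
diffeomorphism of a connected M changes ν by one global sign, so |F| is invariant
(`IsImm.abs_flux_comp`). It remains to find X with different |F| at the two shapes. Embeddings with
equal image differ by a diffeomorphism (`IsImm.exists_diffeomorph`), so for distinct shapes some
point of one image lies off the other. For a bump ψ at that point and e the normal there, the flux
is positive through one shape and zero through the other (`IsImm.exists_flux_pos`).

Both variation formulas rest on one identity, `IsImm.integral_pairing_comm`: the integral of
`pairing o f Y h` is symmetric in Y and h. It is the divergence theorem for the field on M with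
components det (Y, ∂₁f, …, h, …, ∂ₘf), where the second derivatives of f cancel. It moves the
derivative from f_t to ν or to ψ(f) e, and what remains is pointwise algebra: dν produces the mean
curvature (`IsImm.pairing_unitNormal`), and d(ψ(f) e) has rank one (`volForm_rankOne`). -/

variable (m) in
/-- The determinant of the matrix with the given vectors as rows. -/
def volForm : (Ambient m) [⋀^Fin (m + 1)]→L[ℝ] ℝ :=
  { (Matrix.detRowAlternating (R := ℝ) (n := Fin (m + 1))).compLinearMap
      (EuclideanSpace.equiv (Fin (m + 1)) ℝ).toLinearMap with
    cont := by
      change Continuous fun v : Fin (m + 1) → Ambient m =>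
        Matrix.det (Matrix.of fun i j => v i j)
      refine Continuous.matrix_det ?_
      refine continuous_matrix fun i j => ?_
      simp only [Matrix.of_apply]
      fun_prop }

lemma volForm_apply (v : Fin (m + 1) → Ambient m) :
    volForm m v = Matrix.det (Matrix.of fun i j => v i j) := rfl

lemma volForm_swap (a b : Ambient m) (v : Fin m → Ambient m) (i : Fin m) :
    volForm m (Fin.cons a (Function.update v i b)) =
      -volForm m (Fin.cons b (Function.update v i a)) := by
  have h := (volForm m).toAlternatingMap.map_swap (Fin.cons b (Function.update v i a))
    (i := 0) (j := i.succ) (Fin.succ_ne_zero i).symm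
  have h' : (Fin.cons b (Function.update v i a) : Fin (m + 1) → Ambient m) ∘
      Equiv.swap 0 i.succ = Fin.cons a (Function.update v i b) := by
    funext k
    refine Fin.cases ?_ (fun j => ?_) k
    · simp
    · by_cases hj : j = i
      · subst hj; simp [-Fin.cons_update]
      · simp [Equiv.swap_apply_of_ne_of_ne (Fin.succ_ne_zero j)
          (fun h => hj (Fin.succ_injective _ h)), hj]
  rw [h'] at h
  exact h

lemma volForm_cons_add (a b : Ambient m) (v : Fin m → Ambient m) :
    volForm m (Fin.cons (a + b) v) = volForm m (Fin.cons a v) + volForm m (Fin.cons b v) :=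
  (volForm m).toMultilinearMap.cons_add v a b

lemma volForm_cons_smul (r : ℝ) (a : Ambient m) (v : Fin m → Ambient m) :
    volForm m (Fin.cons (r • a) v) = r * volForm m (Fin.cons a v) :=
  (volForm m).toMultilinearMap.cons_smul v r a

lemma volForm_update_add (a : Ambient m) (v : Fin m → Ambient m) (i : Fin m) (b c : Ambient m) :
    volForm m (Fin.cons a (Function.update v i (b + c))) =
      volForm m (Fin.cons a (Function.update v i b)) +
        volForm m (Fin.cons a (Function.update v i c)) := by
  simp only [Fin.cons_update]
  exact (volForm m).map_update_add _ _ _ _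

lemma volForm_update_smul (a : Ambient m) (v : Fin m → Ambient m) (i : Fin m) (r : ℝ)
    (b : Ambient m) :
    volForm m (Fin.cons a (Function.update v i (r • b))) =
      r * volForm m (Fin.cons a (Function.update v i b)) := by
  simp only [Fin.cons_update]
  exact (volForm m).map_update_smul _ _ _ _

lemma volForm_update_sum {ι : Type*} (s : Finset ι) (a : Ambient m) (v : Fin m → Ambient m)
    (i : Fin m) (r : ι → ℝ) (b : ι → Ambient m) :
    volForm m (Fin.cons a (Function.update v i (∑ k ∈ s, r k • b k))) =
      ∑ k ∈ s, r k * volForm m (Fin.cons a (Function.update v i (b k))) := by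
  classical
  induction s using Finset.induction_on with
  | empty =>
    have := volForm_update_smul a v i 0 0
    rw [zero_smul, zero_mul] at this
    simpa only [Finset.sum_empty] using this
  | insert k s hk ih => rw [Finset.sum_insert hk, Finset.sum_insert hk, volForm_update_add,
      volForm_update_smul, ih]

lemma volForm_update_of_ne (a : Ambient m) (v : Fin m → Ambient m) {i j : Fin m} (h : i ≠ j) :
    volForm m (Fin.cons a (Function.update v i (v j))) = 0 := by
  rw [Fin.cons_update]
  have := (volForm m).toAlternatingMap.map_update_self (Fin.cons a v)
    (i := i.succ) (j := j.succ) (fun h' => h (Fin.succ_injective _ h'))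
  simpa using this

lemma volForm_cons_self (v : Fin m → Ambient m) (i : Fin m) :
    volForm m (Fin.cons (v i) v) = 0 :=
  (volForm m).map_eq_zero_of_eq _ (i := 0) (j := i.succ) (by simp) (Fin.succ_ne_zero i).symm

/-- Cramer's rule. -/
lemma sum_volForm_update_smul (v : Fin (m + 1) → Ambient m) (e : Ambient m) :
    ∑ i, volForm m (Function.update v i e) • v i = volForm m v • e := by
  have h := Matrix.mulVec_cramer (Matrix.of fun i j => v i j : Matrix _ _ ℝ).transpose e.ofLp
  ext k
  have hk := congrFun h k
  rw [Matrix.det_transpose] at hk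
  simp only [PiLp.smul_apply, smul_eq_mul, volForm_apply, WithLp.ofLp_sum, Finset.sum_apply,
    WithLp.ofLp_smul, Pi.smul_apply] at hk ⊢
  rw [← hk, Matrix.mulVec, dotProduct]
  refine Finset.sum_congr rfl fun i _ => ?_
  rw [Matrix.cramer_transpose_apply]
  have : (Matrix.of fun a b => Function.update v i e a b : Matrix _ _ ℝ) =
      (Matrix.of fun i j => v i j : Matrix _ _ ℝ).updateRow i e.ofLp := by
    ext a b
    by_cases ha : a = i
    · subst ha; simp
    · simp [ha]
  rw [this]
  exact mul_comm _ _

/-- The trace of the rank-one map `α ⊗ e` as a sum over the slots of the determinant. -/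
lemma volForm_rankOne (α : Ambient m →L[ℝ] ℝ) (e h : Ambient m) (v : Fin m → Ambient m) :
    α h * volForm m (Fin.cons e v) +
      ∑ i, α (v i) * volForm m (Fin.cons h (Function.update v i e)) =
    α e * volForm m (Fin.cons h v) := by
  -- Apply α to Cramer's rule for e in terms of h, v₁, …, vₘ.
  have := congrArg α (sum_volForm_update_smul (Fin.cons h v) e)
  rw [Fin.sum_univ_succ] at this
  simp only [map_add, map_sum, map_smul, Fin.cons_zero, Fin.cons_succ, Fin.update_cons_zero,
    smul_eq_mul, ← Fin.cons_update] at this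
  rw [mul_comm (α e), ← this, mul_comm]
  congr 1
  exact Finset.sum_congr rfl fun i _ => mul_comm _ _

/-- The algebra of the divergence of the vector field with components
`det (y, v₁, …, h, …, vₘ)`, with `h` in the slot `i`. -/
lemma sum_linearDeriv_volForm (y h : Ambient m) (v dy dh : Fin m → Ambient m)
    (dv : Fin m → Fin m → Ambient m) (hdv : ∀ i j, dv i j = dv j i) :
    ∑ i, (volForm m).linearDeriv (Fin.cons y (Function.update v i h))
      (Fin.cons (dy i) (Function.update (dv i) i (dh i))) =
    ∑ i, volForm m (Fin.cons y (Function.update v i (dh i))) -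
      ∑ i, volForm m (Fin.cons h (Function.update v i (dy i))) := by
  classical
  -- The terms with h in slot i and a second derivative in another slot j. The symmetry of `dv` and
  -- the sign of a transposition make them antisymmetric in i and j, so their double sum vanishes.
  set S : Fin m → Fin m → ℝ := fun i j =>
    if i = j then 0 else
      volForm m (Fin.cons y (Function.update (Function.update v i h) j (dv i j))) with hS
  have hSz : ∑ i, ∑ j, S i j = 0 := by
    have hanti : ∀ i j, S i j = -S j i := by
      intro i j
      by_cases hij : i = j
      · simp [hS, hij]
      · simp only [hS, if_neg hij, if_neg (Ne.symm hij)]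
        rw [hdv j i]
        have hs := (volForm m).toAlternatingMap.map_swap
          (Fin.cons y (Function.update (Function.update v j h) i (dv i j)))
          (i := i.succ) (j := j.succ) (fun h => hij (Fin.succ_injective _ h))
        have hs' : (Fin.cons y (Function.update (Function.update v j h) i (dv i j)) :
            Fin (m + 1) → Ambient m) ∘ Equiv.swap i.succ j.succ =
            Fin.cons y (Function.update (Function.update v i h) j (dv i j)) := by
          funext k
          refine Fin.cases ?_ (fun l => ?_) k
          · simp [-Fin.cons_update, Equiv.swap_apply_of_ne_of_ne (Fin.succ_ne_zero i).symm
              (Fin.succ_ne_zero j).symm]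
          · by_cases hl : l = i
            · subst hl; simp [-Fin.cons_update, Function.update_of_ne hij,
                Function.update_of_ne (Ne.symm hij)]
            · by_cases hl' : l = j
              · subst hl'; simp [-Fin.cons_update]
              · simp [-Fin.cons_update, Equiv.swap_apply_of_ne_of_ne (fun h => hl (Fin.succ_injective _ h))
                  (fun h => hl' (Fin.succ_injective _ h)), hl, hl']
        rw [hs'] at hs
        exact hs
    have h2 : ∑ i, ∑ j, S i j = -∑ i, ∑ j, S i j := by
      conv_lhs => rw [Finset.sum_comm]
      rw [← Finset.sum_neg_distrib]
      refine Finset.sum_congr rfl fun i _ => ?_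
      rw [← Finset.sum_neg_distrib]
      exact Finset.sum_congr rfl fun j _ => hanti j i
    linarith
  -- Differentiating slot 0 gives the term with `dy i`, in which h is swapped to the front at the
  -- cost of a sign; slot i gives the term with `dh i`; the other slots give `S`.
  have key : ∀ i, (volForm m).linearDeriv (Fin.cons y (Function.update v i h))
      (Fin.cons (dy i) (Function.update (dv i) i (dh i))) =
      -volForm m (Fin.cons h (Function.update v i (dy i))) +
        (volForm m (Fin.cons y (Function.update v i (dh i))) + ∑ j, S i j) := by
    intro i
    rw [ContinuousMultilinearMap.linearDeriv_apply, Fin.sum_univ_succ]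
    congr 1
    · rw [Fin.update_cons_zero]
      exact volForm_swap _ _ _ _
    · have : ∀ j : Fin m, (volForm m).toContinuousMultilinearMap
          (Function.update (Fin.cons y (Function.update v i h)) j.succ
            ((Fin.cons (dy i) (Function.update (dv i) i (dh i)) : Fin (m + 1) → Ambient m)
              j.succ)) =
          (if j = i then volForm m (Fin.cons y (Function.update v i (dh i))) else 0) + S i j := by
        intro j
        rw [← Fin.cons_update, Fin.cons_succ]
        by_cases hj : j = i
        · subst hj; simp [hS]
        · simp [hS, hj, Ne.symm hj]
      rw [Finset.sum_congr rfl fun j _ => this j, Finset.sum_add_distrib]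
      simp
  rw [Finset.sum_congr rfl fun i _ => key i]
  simp only [Finset.sum_add_distrib, Finset.sum_neg_distrib, hSz]
  ring

/-! ### Linear maps ℝᵐ → ℝᵐ⁺¹ and their normal vectors -/

/-- The images of the standard basis vectors under a linear map. -/
def frame (L : Model m →L[ℝ] Ambient m) (i : Fin m) : Ambient m := L (EuclideanSpace.single i 1)

/-- The generalized cross product of the frame of `L`. -/
def normalVec (L : Model m →L[ℝ] Ambient m) : Ambient m :=
  WithLp.toLp 2 fun k : Fin (m + 1) => Matrix.det
    (Matrix.of (Fin.cons (Pi.single k 1) fun i l => frame L i l) :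
      Matrix (Fin (m + 1)) (Fin (m + 1)) ℝ)

/-- The derivative of `det (y, L e₁, …, L eₘ)` with respect to `L` in the direction `K`. -/
def varForm (y : Ambient m) (L K : Model m →L[ℝ] Ambient m) : ℝ :=
  ∑ i, volForm m (Fin.cons y (Function.update (frame L) i (frame K i)))

lemma normalVec_apply (L : Model m →L[ℝ] Ambient m) (k : Fin (m + 1)) :
    normalVec L k = volForm m (Fin.cons (EuclideanSpace.single k 1) (frame L)) := by
  rw [volForm_apply]
  change Matrix.det (Matrix.of (Fin.cons (Pi.single k 1) fun i l => frame L i l) :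
      Matrix (Fin (m + 1)) (Fin (m + 1)) ℝ) = _
  congr 1
  ext i j
  refine Fin.cases ?_ (fun i => ?_) i <;> simp [Pi.single_apply]

/-- Linearity in y reduces this to the standard basis, where it is the definition. It turns
statements about normals into multilinear algebra. -/
lemma inner_normalVec (y : Ambient m) (L : Model m →L[ℝ] Ambient m) :
    inner ℝ y (normalVec L) = volForm m (Fin.cons y (frame L)) := by
  let A : Ambient m →ₗ[ℝ] ℝ :=
    { toFun := fun y => volForm m (Fin.cons y (frame L))
      map_add' := fun a b => volForm_cons_add a b _
      map_smul' := fun r a => volForm_cons_smul r a _ }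
  have h : (innerₗ (Ambient m)).flip (normalVec L) = A := by
    refine (EuclideanSpace.basisFun (Fin (m + 1)) ℝ).toBasis.ext fun k => ?_
    have : inner ℝ (EuclideanSpace.single k (1 : ℝ)) (normalVec L) = normalVec L k := by
      simp [EuclideanSpace.inner_single_left]
    simpa [A, ← normalVec_apply, real_inner_comm] using this
  exact LinearMap.congr_fun h y

lemma inner_normalVec_frame (L : Model m →L[ℝ] Ambient m) (i : Fin m) :
    inner ℝ (frame L i) (normalVec L) = (0 : ℝ) := by
  rw [inner_normalVec, volForm_cons_self]

/-- For fixed y this is an alternating form of top degree on ℝᵐ pulled back by L, hence a multiple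
of the determinant. -/
lemma volForm_cons_frame_comp (y : Ambient m) (L : Model m →L[ℝ] Ambient m)
    (T : Model m →L[ℝ] Model m) :
    volForm m (Fin.cons y (frame (L ∘L T))) = T.det * volForm m (Fin.cons y (frame L)) := by
  classical
  let b := (EuclideanSpace.basisFun (Fin m) ℝ).toBasis
  let α : (Model m) [⋀^Fin m]→ₗ[ℝ] ℝ :=
    ((volForm m).toAlternatingMap.curryLeft y).compLinearMap L.toLinearMap
  have hα := α.eq_smul_basis_det b
  have h1 : volForm m (Fin.cons y (frame (L ∘L T))) = α (T ∘ b) := by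
    simp [α, b, Function.comp_def, Matrix.vecCons, AlternatingMap.compLinearMap_apply]
    rfl
  have h2 : volForm m (Fin.cons y (frame L)) = α b := by
    simp [α, b, Matrix.vecCons, AlternatingMap.compLinearMap_apply]; rfl
  have h3 : α (T ∘ b) = α b * b.det (T ∘ b) := by
    conv_lhs => rw [hα]
    simp
  have h4 := b.det_comp T.toLinearMap b
  rw [h1, h2, h3]
  rw [b.det_self, mul_one] at h4
  rw [mul_comm]
  congr 1

lemma normalVec_comp (L : Model m →L[ℝ] Ambient m) (T : Model m →L[ℝ] Model m) :
    normalVec (L ∘L T) = T.det • normalVec L := by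
  ext k
  simp only [PiLp.smul_apply, normalVec_apply, volForm_cons_frame_comp, smul_eq_mul]

lemma hasDerivAt_volForm_frame {y : ℝ → Ambient m} {y' : Ambient m}
    {L : ℝ → Model m →L[ℝ] Ambient m} {L' : Model m →L[ℝ] Ambient m} {t : ℝ}
    (hy : HasDerivAt y y' t) (hL : HasDerivAt L L' t) :
    HasDerivAt (fun s => volForm m (Fin.cons (y s) (frame (L s))))
      (volForm m (Fin.cons y' (frame (L t))) + varForm (y t) (L t) L') t := by
  have hv : HasDerivAt (fun s => (Fin.cons (y s) (frame (L s)) : Fin (m + 1) → Ambient m))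
      (Fin.cons y' (frame L')) t := by
    rw [hasDerivAt_pi]
    refine Fin.cases ?_ fun i => ?_
    · simpa using hy
    · simpa [frame] using hL.clm_apply (hasDerivAt_const t (EuclideanSpace.single i (1 : ℝ)))
  have := ((volForm m).hasFDerivAt (Fin.cons (y t) (frame (L t)))).comp_hasDerivAt t hv
  refine this.congr_deriv ?_
  rw [ContinuousMultilinearMap.linearDeriv_apply, Fin.sum_univ_succ, Fin.update_cons_zero]
  simp only [Fin.cons_zero, Fin.cons_succ, ← Fin.cons_update]
  rfl

lemma hasDerivAt_normalVec {L : ℝ → Model m →L[ℝ] Ambient m} {L' : Model m →L[ℝ] Ambient m}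
    {t : ℝ} (hL : HasDerivAt L L' t) :
    ∃ N' : Ambient m, HasDerivAt (fun s => normalVec (L s)) N' t ∧
      ∀ y, inner ℝ y N' = varForm y (L t) L' := by
  have h : ∀ k : Fin (m + 1), HasDerivAt (fun s => normalVec (L s) k)
      (varForm (EuclideanSpace.single k 1) (L t) L') t := fun k => by
    simp only [normalVec_apply]
    have := hasDerivAt_volForm_frame (hasDerivAt_const t (EuclideanSpace.single k (1 : ℝ))) hL
    refine this.congr_deriv ?_
    have h0 := volForm_cons_smul 0 (0 : Ambient m) (frame (L t))
    rw [zero_smul, zero_mul] at h0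
    rw [h0, zero_add]
  have hN : HasDerivAt (fun s => normalVec (L s))
      (WithLp.toLp 2 fun k => varForm (EuclideanSpace.single k 1) (L t) L') t :=
    ((EuclideanSpace.equiv (Fin (m + 1)) ℝ).symm.toContinuousLinearMap.hasFDerivAt).comp_hasDerivAt
      t (hasDerivAt_pi.2 h)
  refine ⟨_, hN, fun y => ?_⟩
  have h1 := (hasDerivAt_const t y).inner ℝ hN
  have h2 := hasDerivAt_volForm_frame (hasDerivAt_const t y) hL
  simp only [inner_normalVec] at h1
  have h3 := h1.unique h2
  have h0 := volForm_cons_smul 0 (0 : Ambient m) (frame (L t))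
  rw [zero_smul, zero_mul] at h0
  simpa [h0] using h3

/-- This is the derivative at s = 0 of `volForm_cons_frame_comp` along L + sK. -/
lemma varForm_comp (y : Ambient m) (L K : Model m →L[ℝ] Ambient m)
    (T : Model m →L[ℝ] Model m) :
    varForm y (L ∘L T) (K ∘L T) = T.det * varForm y L K := by
  have h0 : volForm m (Fin.cons 0 (frame L)) = 0 := by
    simpa using volForm_cons_smul 0 (0 : Ambient m) (frame L)
  have h0' : volForm m (Fin.cons 0 (frame (L ∘L T))) = 0 := by
    simpa using volForm_cons_smul 0 (0 : Ambient m) (frame (L ∘L T))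
  have hL : ∀ L K : Model m →L[ℝ] Ambient m, HasDerivAt (fun s : ℝ => L + s • K) K 0 := by
    intro L K
    simpa using ((hasDerivAt_id (0 : ℝ)).smul_const K).const_add L
  have h1 := hasDerivAt_volForm_frame (hasDerivAt_const 0 y) (hL L K)
  have h2 := hasDerivAt_volForm_frame (hasDerivAt_const 0 y) (hL (L ∘L T) (K ∘L T))
  have h3 : (fun s : ℝ => volForm m (Fin.cons y (frame (L ∘L T + s • K ∘L T)))) =
      fun s : ℝ => T.det * volForm m (Fin.cons y (frame (L + s • K))) := by
    funext s
    rw [← volForm_cons_frame_comp, ContinuousLinearMap.add_comp, ContinuousLinearMap.smul_comp]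
  rw [h3] at h2
  have := h2.unique (h1.const_mul T.det)
  have e1 : L + (0 : ℝ) • K = L := by ext1 u; simp
  have e2 : L ∘L T + (0 : ℝ) • K ∘L T = L ∘L T := by ext1 u; simp
  rw [e1, e2, h0, h0', zero_add, zero_add] at this
  exact this

lemma varForm_add_right (y : Ambient m) (L K K' : Model m →L[ℝ] Ambient m) :
    varForm y L (K + K') = varForm y L K + varForm y L K' := by
  simp only [varForm, ← Finset.sum_add_distrib]
  exact Finset.sum_congr rfl fun i _ => volForm_update_add _ _ _ _ _

lemma varForm_add_left (y y' : Ambient m) (L K : Model m →L[ℝ] Ambient m) :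
    varForm (y + y') L K = varForm y L K + varForm y' L K := by
  simp only [varForm, ← Finset.sum_add_distrib]
  exact Finset.sum_congr rfl fun i _ => volForm_cons_add _ _ _

lemma varForm_smul_left (y : Ambient m) (L K : Model m →L[ℝ] Ambient m) (r : ℝ) :
    varForm (r • y) L K = r * varForm y L K := by
  simp only [varForm, Finset.mul_sum]
  exact Finset.sum_congr rfl fun i _ => volForm_cons_smul _ _ _

/-- If `K eᵢ = ∑ bᵢⱼ L eⱼ`, then `varForm y L K` is the trace of `b` times
`det (y, L e₁, …, L eₘ)`. -/
lemma varForm_of_frame (y : Ambient m) (L K : Model m →L[ℝ] Ambient m)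
    (b : Matrix (Fin m) (Fin m) ℝ) (hb : ∀ i, frame K i = ∑ j, b i j • frame L j) :
    varForm y L K = b.trace * volForm m (Fin.cons y (frame L)) := by
  rw [varForm, Matrix.trace, Finset.sum_mul]
  refine Finset.sum_congr rfl fun i _ => ?_
  rw [hb, volForm_update_sum, Finset.sum_eq_single i]
  · simp
  · intro j _ hj
    rw [volForm_update_of_ne _ _ hj.symm, mul_zero]
  · simp

lemma linearIndependent_frame {L : Model m →L[ℝ] Ambient m} (hL : Function.Injective L) :
    LinearIndependent ℝ (frame L) := by
  have h := (EuclideanSpace.basisFun (Fin m) ℝ).toBasis.linearIndependent.map' L.toLinearMap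
    (LinearMap.ker_eq_bot.2 hL)
  have h' : ⇑L.toLinearMap ∘ ⇑(EuclideanSpace.basisFun (Fin m) ℝ).toBasis = frame L := by
    funext i
    simp [frame]
  rwa [h'] at h

/-- The m frame vectors do not span ℝᵐ⁺¹. A vector y outside their span completes them to a basis,
so ⟨y, N⟩ = det (y, frame) is nonzero. -/
lemma normalVec_ne_zero {L : Model m →L[ℝ] Ambient m} (hL : Function.Injective L) :
    normalVec L ≠ 0 := by
  intro h0
  have hspan : Submodule.span ℝ (Set.range (frame L)) ≠ ⊤ := by
    intro htop
    have h := finrank_range_le_card (R := ℝ) (frame L)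
    rw [Set.finrank, htop, finrank_top] at h
    simp at h
  obtain ⟨y, -, hy⟩ := SetLike.exists_of_lt (lt_top_iff_ne_top.2 hspan)
  have hli : LinearIndependent ℝ (Fin.cons y (frame L) : Fin (m + 1) → Ambient m) :=
    linearIndependent_finCons.2 ⟨linearIndependent_frame hL, hy⟩
  have hdet : volForm m (Fin.cons y (frame L)) = 0 := by
    rw [← inner_normalVec, h0, inner_zero_right]
  have hli' := hli.map' (EuclideanSpace.equiv (Fin (m + 1)) ℝ).toLinearMap
    (LinearMap.ker_eq_bot.2 (EuclideanSpace.equiv (Fin (m + 1)) ℝ).injective)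
  have hu := (Matrix.linearIndependent_rows_iff_isUnit (K := ℝ)
    (A := Matrix.of fun i j => (Fin.cons y (frame L) : Fin (m + 1) → Ambient m) i j)).1 hli'
  rw [Matrix.isUnit_iff_isUnit_det] at hu
  rw [volForm_apply] at hdet
  rw [hdet] at hu
  exact not_isUnit_zero hu

/-- The Gram matrix of the frame of `L`. -/
def gramMatrix (L : Model m →L[ℝ] Ambient m) : Matrix (Fin m) (Fin m) ℝ :=
  Matrix.of fun i j => inner ℝ (frame L i) (frame L j)

/-- The matrix R with rows N and the frame has determinant ‖N‖², while R Rᵀ is block diagonal with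
blocks ‖N‖² and the Gram matrix. Compare determinants and cancel ‖N‖² ≠ 0. -/
lemma det_gramMatrix {L : Model m →L[ℝ] Ambient m} (hL : Function.Injective L) :
    (gramMatrix L).det = ‖normalVec L‖ ^ 2 := by
  set N := normalVec L with hN
  let w : Fin (m + 1) → Ambient m := Fin.cons N (frame L)
  let R : Matrix (Fin (m + 1)) (Fin (m + 1)) ℝ := Matrix.of fun i j => w i j
  have hR : R.det = ‖N‖ ^ 2 := by
    rw [← real_inner_self_eq_norm_sq]
    conv_rhs => rw [hN, ← hN, inner_normalVec]
    rfl
  have hRR : ∀ i j, (R * R.transpose) i j = inner ℝ (w i) (w j) := by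
    intro i j
    simp [R, Matrix.mul_apply, PiLp.inner_apply, mul_comm]
  have hdet : (R * R.transpose).det = ‖N‖ ^ 2 * (gramMatrix L).det := by
    rw [Matrix.det_succ_row_zero, Fin.sum_univ_succ, Finset.sum_eq_zero, add_zero]
    · rw [hRR]
      simp only [w, Fin.cons_zero, Fin.val_zero, pow_zero, one_mul, real_inner_self_eq_norm_sq]
      congr 2
      ext i j
      simp [hRR, w, gramMatrix]
    · intro j _
      rw [hRR]
      have : inner ℝ (w 0) (w j.succ) = (0 : ℝ) := by
        simp only [w, Fin.cons_zero, Fin.cons_succ]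
        rw [real_inner_comm, hN, inner_normalVec_frame]
      rw [this]
      ring
  rw [Matrix.det_mul, Matrix.det_transpose, hR] at hdet
  have hN0 : ‖N‖ ^ 2 ≠ 0 := by
    have := normalVec_ne_zero hL
    positivity
  exact (mul_left_cancel₀ hN0 hdet).symm

/-- A vector orthogonal to the normal vector is a combination of the frame. -/
lemma exists_eq_sum_frame {L : Model m →L[ℝ] Ambient m} (hL : Function.Injective L)
    {y : Ambient m} (hy : inner ℝ y (normalVec L) = (0 : ℝ)) :
    ∃ b : Fin m → ℝ, y = ∑ j, b j • frame L j := by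
  classical
  have hN := normalVec_ne_zero hL
  have hNN : inner ℝ (normalVec L) (normalVec L) ≠ (0 : ℝ) := inner_self_ne_zero.2 hN
  -- Cramer's rule in the basis (N, frame): the coefficient of N is det (y, frame) = ⟨y, N⟩ = 0.
  have h := sum_volForm_update_smul (Fin.cons (normalVec L) (frame L)) y
  rw [Fin.sum_univ_succ, Fin.update_cons_zero, ← inner_normalVec, hy, zero_smul, zero_add,
    ← inner_normalVec] at h
  refine ⟨fun j => (inner ℝ (normalVec L) (normalVec L) : ℝ)⁻¹ *
    volForm m (Function.update (Fin.cons (normalVec L) (frame L)) j.succ y), ?_⟩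
  simp only [mul_smul, ← Finset.smul_sum]
  simp only [Fin.cons_succ] at h
  rw [h, smul_smul, inv_mul_cancel₀ hNN, one_smul]

end LinearAlgebra

/-! ### Derivatives in charts -/

section Charts

variable {m : ℕ} {M : Type*} [TopologicalSpace M] [ChartedSpace (Model m) M]

variable (m) in
/-- The derivative of `f` at `x` in the preferred chart at `x`. -/
def dAt {F : Type*} [NormedAddCommGroup F] [NormedSpace ℝ F] (f : M → F) (x : M) :
    Model m →L[ℝ] F :=
  fderiv ℝ (f ∘ (extChartAt (𝓡 m) x).symm) (extChartAt (𝓡 m) x x)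

variable (m) in
/-- The derivative at `x` of the coordinate expression of `φ` in the preferred charts at `c`
and `d`. -/
def transition (φ : M → M) (c d x : M) : Model m →L[ℝ] Model m :=
  fderiv ℝ (extChartAt (𝓡 m) d ∘ φ ∘ (extChartAt (𝓡 m) c).symm) (extChartAt (𝓡 m) c x)

variable [IsManifold (𝓡 m) ∞ M]

lemma contDiffOn_comp_chart_symm {F : Type*} [NormedAddCommGroup F] [NormedSpace ℝ F] {f : M → F}
    (hf : ContMDiff (𝓡 m) 𝓘(ℝ, F) ∞ f) (c : M) :
    ContDiffOn ℝ ∞ (f ∘ (extChartAt (𝓡 m) c).symm) (extChartAt (𝓡 m) c).target :=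
  (hf.comp_contMDiffOn (contMDiffOn_extChartAt_symm c)).contDiffOn

lemma contDiffOn_localRep {f : M → Ambient m} (hf : ContMDiff (𝓡 m) 𝓘(ℝ, Ambient m) ∞ f) (c : M) :
    ContDiffOn ℝ ∞ (localRep f c) (extChartAt (𝓡 m) c).target :=
  contDiffOn_comp_chart_symm hf c

lemma differentiableAt_comp_chart_symm {F : Type*} [NormedAddCommGroup F] [NormedSpace ℝ F]
    {f : M → F} (hf : ContMDiff (𝓡 m) 𝓘(ℝ, F) ∞ f) (c : M) {u : Model m}
    (hu : u ∈ (extChartAt (𝓡 m) c).target) :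
    DifferentiableAt ℝ (f ∘ (extChartAt (𝓡 m) c).symm) u :=
  ((contDiffOn_comp_chart_symm hf c).contDiffAt
    ((isOpen_extChartAt_target c).mem_nhds hu)).differentiableAt (by simp)

lemma contDiffAt_transition_map {φ : M → M} (hφ : ContMDiff (𝓡 m) (𝓡 m) ∞ φ) {c d x : M}
    (hx : x ∈ (extChartAt (𝓡 m) c).source) (hφx : φ x ∈ (extChartAt (𝓡 m) d).source) :
    ContDiffAt ℝ ∞ (extChartAt (𝓡 m) d ∘ φ ∘ (extChartAt (𝓡 m) c).symm)
      (extChartAt (𝓡 m) c x) := by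
  have h1 : ContMDiffAt 𝓘(ℝ, Model m) (𝓡 m) ∞ (extChartAt (𝓡 m) c).symm
      (extChartAt (𝓡 m) c x) :=
    (contMDiffOn_extChartAt_symm c).contMDiffAt ((isOpen_extChartAt_target c).mem_nhds
      ((extChartAt (𝓡 m) c).map_source hx))
  have hinv : (extChartAt (𝓡 m) c).symm (extChartAt (𝓡 m) c x) = x :=
    (extChartAt (𝓡 m) c).left_inv hx
  have h2 : ContMDiffAt (𝓡 m) 𝓘(ℝ, Model m) ∞ (extChartAt (𝓡 m) d) (φ x) :=
    contMDiffAt_extChartAt' (by simpa using hφx)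
  have h3 : ContMDiffAt 𝓘(ℝ, Model m) (𝓡 m) ∞ (φ ∘ (extChartAt (𝓡 m) c).symm)
      (extChartAt (𝓡 m) c x) := hφ.contMDiffAt.comp _ h1
  have h4 := ContMDiffAt.comp (extChartAt (𝓡 m) c x) (I' := 𝓡 m) (g := extChartAt (𝓡 m) d)
    (f := φ ∘ (extChartAt (𝓡 m) c).symm) (by simp only [Function.comp_apply, hinv]; exact h2) h3
  exact h4.contDiffAt

/-- The chain rule for a change of charts combined with a map `φ : M → M`. -/
lemma fderiv_comp_chart {F : Type*} [NormedAddCommGroup F] [NormedSpace ℝ F]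
    {f : M → F} (hf : ContMDiff (𝓡 m) 𝓘(ℝ, F) ∞ f) {φ : M → M}
    (hφ : ContMDiff (𝓡 m) (𝓡 m) ∞ φ) {c d x : M}
    (hx : x ∈ (extChartAt (𝓡 m) c).source) (hφx : φ x ∈ (extChartAt (𝓡 m) d).source) :
    fderiv ℝ ((f ∘ φ) ∘ (extChartAt (𝓡 m) c).symm) (extChartAt (𝓡 m) c x) =
      fderiv ℝ (f ∘ (extChartAt (𝓡 m) d).symm) (extChartAt (𝓡 m) d (φ x)) ∘L
        transition m φ c d x := by
  have hinv : (extChartAt (𝓡 m) c).symm (extChartAt (𝓡 m) c x) = x :=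
    (extChartAt (𝓡 m) c).left_inv hx
  have hcont : ContinuousAt (φ ∘ (extChartAt (𝓡 m) c).symm) (extChartAt (𝓡 m) c x) :=
    ContinuousAt.comp (by rw [hinv]; exact hφ.continuous.continuousAt)
      (continuousAt_extChartAt_symm' hx)
  have hev : (f ∘ φ) ∘ (extChartAt (𝓡 m) c).symm =ᶠ[nhds (extChartAt (𝓡 m) c x)]
      (f ∘ (extChartAt (𝓡 m) d).symm) ∘
        (extChartAt (𝓡 m) d ∘ φ ∘ (extChartAt (𝓡 m) c).symm) := by
    have : ∀ᶠ u in nhds (extChartAt (𝓡 m) c x),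
        (φ ∘ (extChartAt (𝓡 m) c).symm) u ∈ (extChartAt (𝓡 m) d).source :=
      hcont.eventually_mem ((isOpen_extChartAt_source d).mem_nhds (by simp only [Function.comp_apply, hinv]; exact hφx))
    filter_upwards [this] with u hu
    simp only [Function.comp_apply] at hu ⊢
    rw [(extChartAt (𝓡 m) d).left_inv hu]
  rw [hev.fderiv_eq]
  have hval : (extChartAt (𝓡 m) d ∘ φ ∘ (extChartAt (𝓡 m) c).symm) (extChartAt (𝓡 m) c x) =
      extChartAt (𝓡 m) d (φ x) := by simp only [Function.comp_apply, hinv]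
  rw [fderiv_comp, hval]
  · rfl
  · rw [hval]
    exact differentiableAt_comp_chart_symm hf d ((extChartAt (𝓡 m) d).map_source hφx)
  · exact (contDiffAt_transition_map hφ hx hφx).differentiableAt (by simp)

/-- Transitions of a map and its inverse are inverse to each other. -/
lemma transition_comp_eq_id {φ ψ : M → M} (hφ : ContMDiff (𝓡 m) (𝓡 m) ∞ φ)
    (hψ : ContMDiff (𝓡 m) (𝓡 m) ∞ ψ) (h : Function.LeftInverse ψ φ) {c d x : M}
    (hx : x ∈ (extChartAt (𝓡 m) c).source) (hφx : φ x ∈ (extChartAt (𝓡 m) d).source) :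
    transition m ψ d c (φ x) ∘L transition m φ c d x = ContinuousLinearMap.id ℝ (Model m) := by
  have hinv : (extChartAt (𝓡 m) c).symm (extChartAt (𝓡 m) c x) = x :=
    (extChartAt (𝓡 m) c).left_inv hx
  have hcont : ContinuousAt (φ ∘ (extChartAt (𝓡 m) c).symm) (extChartAt (𝓡 m) c x) :=
    ContinuousAt.comp (by rw [hinv]; exact hφ.continuous.continuousAt)
      (continuousAt_extChartAt_symm' hx)
  have hval : (extChartAt (𝓡 m) d ∘ φ ∘ (extChartAt (𝓡 m) c).symm) (extChartAt (𝓡 m) c x) =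
      extChartAt (𝓡 m) d (φ x) := by simp only [Function.comp_apply, hinv]
  have hev : (extChartAt (𝓡 m) c ∘ ψ ∘ (extChartAt (𝓡 m) d).symm) ∘
        (extChartAt (𝓡 m) d ∘ φ ∘ (extChartAt (𝓡 m) c).symm)
      =ᶠ[nhds (extChartAt (𝓡 m) c x)] id := by
    have h1 : ∀ᶠ u in nhds (extChartAt (𝓡 m) c x),
        (φ ∘ (extChartAt (𝓡 m) c).symm) u ∈ (extChartAt (𝓡 m) d).source :=
      hcont.eventually_mem ((isOpen_extChartAt_source d).mem_nhds (by simp only [Function.comp_apply, hinv]; exact hφx))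
    have h2 : ∀ᶠ u in nhds (extChartAt (𝓡 m) c x), u ∈ (extChartAt (𝓡 m) c).target :=
      (isOpen_extChartAt_target c).mem_nhds ((extChartAt (𝓡 m) c).map_source hx)
    filter_upwards [h1, h2] with u hu hu'
    simp only [Function.comp_apply] at hu ⊢
    rw [(extChartAt (𝓡 m) d).left_inv hu, h, (extChartAt (𝓡 m) c).right_inv hu', id]
  have hψx : ψ (φ x) ∈ (extChartAt (𝓡 m) c).source := by rwa [h x]
  have h1 := hev.fderiv_eq (𝕜 := ℝ)
  rw [fderiv_comp, hval, fderiv_id] at h1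
  · exact h1
  · rw [hval]
    exact (contDiffAt_transition_map hψ hφx hψx).differentiableAt (by simp)
  · exact (contDiffAt_transition_map hφ hx hφx).differentiableAt (by simp)

lemma det_transition_mul {φ ψ : M → M} (hφ : ContMDiff (𝓡 m) (𝓡 m) ∞ φ)
    (hψ : ContMDiff (𝓡 m) (𝓡 m) ∞ ψ) (h : Function.LeftInverse ψ φ) {c d x : M}
    (hx : x ∈ (extChartAt (𝓡 m) c).source) (hφx : φ x ∈ (extChartAt (𝓡 m) d).source) :
    (transition m ψ d c (φ x)).det * (transition m φ c d x).det = 1 := by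
  have := congrArg ContinuousLinearMap.det (transition_comp_eq_id hφ hψ h hx hφx)
  have h1 : (ContinuousLinearMap.id ℝ (Model m)).det = 1 := by simp [ContinuousLinearMap.det]
  rw [h1] at this
  rw [← this]
  exact (LinearMap.det_comp _ _).symm

lemma fderiv_chart_eq_dAt_comp {F : Type*} [NormedAddCommGroup F] [NormedSpace ℝ F]
    {f : M → F} (hf : ContMDiff (𝓡 m) 𝓘(ℝ, F) ∞ f) {c x : M}
    (hx : x ∈ (extChartAt (𝓡 m) c).source) :
    fderiv ℝ (f ∘ (extChartAt (𝓡 m) c).symm) (extChartAt (𝓡 m) c x) =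
      dAt m f x ∘L transition m id c x x :=
  fderiv_comp_chart (φ := id) hf contMDiff_id hx (mem_extChartAt_source x)

lemma mfderiv_eq_dAt {f : M → Ambient m} (hf : ContMDiff (𝓡 m) 𝓘(ℝ, Ambient m) ∞ f) (x : M) :
    mfderiv (𝓡 m) 𝓘(ℝ, Ambient m) f x = dAt m f x := by
  rw [(hf.mdifferentiableAt (by simp)).mfderiv]
  simp only [writtenInExtChartAt, mfld_simps, fderivWithin_univ]
  rfl

/-! ### Immersions and their volume density in charts -/

/-- A smooth immersion of `M` in the ambient space. -/
def IsImm (f : M → Ambient m) : Prop :=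
  ContMDiff (𝓡 m) 𝓘(ℝ, Ambient m) ∞ f ∧
    ∀ x, Function.Injective (mfderiv (𝓡 m) 𝓘(ℝ, Ambient m) f x)

lemma IsImm.injective_dAt {f : M → Ambient m} (hf : IsImm f) (x : M) :
    Function.Injective (dAt m f x) := by
  have := hf.2 x
  rw [mfderiv_eq_dAt hf.1] at this
  exact this

lemma IsImm.injective_fderiv {f : M → Ambient m} (hf : IsImm f) {c : M} {u : Model m}
    (hu : u ∈ (extChartAt (𝓡 m) c).target) :
    Function.Injective (fderiv ℝ (localRep f c) u) := by
  obtain ⟨x, hx, rfl⟩ : ∃ x ∈ (extChartAt (𝓡 m) c).source, extChartAt (𝓡 m) c x = u :=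
    ⟨_, (extChartAt (𝓡 m) c).map_target hu, (extChartAt (𝓡 m) c).right_inv hu⟩
  rw [localRep, fderiv_chart_eq_dAt_comp hf.1 hx, ContinuousLinearMap.coe_comp]
  refine (hf.injective_dAt x).comp ?_
  have := transition_comp_eq_id (φ := (id : M → M)) (ψ := id) contMDiff_id contMDiff_id
    (fun _ => rfl) hx (mem_extChartAt_source (I := 𝓡 m) x)
  exact Function.LeftInverse.injective (g := transition m id x c (id x))
    fun v => DFunLike.congr_fun this v

lemma IsImm.normalVec_ne_zero {f : M → Ambient m} (hf : IsImm f) {c : M} {u : Model m}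
    (hu : u ∈ (extChartAt (𝓡 m) c).target) : normalVec (fderiv ℝ (localRep f c) u) ≠ 0 :=
  ShapeSpace.normalVec_ne_zero (hf.injective_fderiv hu)

lemma IsImm.normalVec_dAt_ne_zero {f : M → Ambient m} (hf : IsImm f) (x : M) :
    normalVec (dAt m f x) ≠ 0 :=
  ShapeSpace.normalVec_ne_zero (hf.injective_dAt x)

/-- In this form the density is visibly smooth and positive, and its behaviour under a change of
charts is that of `normalVec_comp`. -/
lemma IsImm.volDensity_eq {f : M → Ambient m} (hf : IsImm f) {c : M} {u : Model m}
    (hu : u ∈ (extChartAt (𝓡 m) c).target) :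
    volDensity f c u = ‖normalVec (fderiv ℝ (localRep f c) u)‖ := by
  have := det_gramMatrix (hf.injective_fderiv hu)
  have h : gram f c u = gramMatrix (fderiv ℝ (localRep f c) u) := rfl
  rw [volDensity, h, this, Real.sqrt_sq (norm_nonneg _)]

lemma contDiff_normalVec {n : WithTop ℕ∞} : ContDiff ℝ n (normalVec (m := m)) := by
  refine contDiff_euclidean.2 fun k => ?_
  simp only [normalVec_apply]
  refine (volForm m).toContinuousMultilinearMap.contDiff.comp ?_
  refine contDiff_pi.2 fun i => ?_
  refine Fin.cases ?_ (fun i => ?_) i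
  · simpa using contDiff_const
  · simpa [frame] using contDiff_id.clm_apply contDiff_const

lemma contDiff_varForm {n : WithTop ℕ∞} :
    ContDiff ℝ n fun p : Ambient m × (Model m →L[ℝ] Ambient m) × (Model m →L[ℝ] Ambient m) =>
      varForm p.1 p.2.1 p.2.2 := by
  unfold varForm
  refine ContDiff.sum fun i _ => (volForm m).toContinuousMultilinearMap.contDiff.comp ?_
  refine contDiff_pi.2 fun j => ?_
  refine Fin.cases ?_ (fun j => ?_) j
  · simpa [-Fin.cons_update] using contDiff_fst
  · by_cases hj : j = i
    · subst hj
      simpa [-Fin.cons_update, frame] using contDiff_snd.snd.clm_apply contDiff_const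
    · simpa [-Fin.cons_update, frame, hj] using contDiff_snd.fst.clm_apply contDiff_const

/-! ### The orientation and the unit normal field -/

/-- The sign of the orientation at `x`, as a real number. -/
def orSign (o : ManifoldOrientation m M) (x : M) : ℝ := (((o.sgn x : ℤˣ) : ℤ) : ℝ)

lemma orSign_mul_self (o : ManifoldOrientation m M) (x : M) : orSign o x * orSign o x = 1 := by
  unfold orSign
  rcases Int.units_eq_one_or (o.sgn x) with h | h <;> simp [h]

/-- An open neighbourhood of `c` in which the orientation is constant in the chart at `c`. -/
def adapted (o : ManifoldOrientation m M) (c : M) : Set M :=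
  interior {x | x ∈ (extChartAt (𝓡 m) c).source ∧
    0 < orSign o x * orSign o c * (transition m id x c x).det}

lemma isOpen_adapted (o : ManifoldOrientation m M) (c : M) : IsOpen (adapted o c) :=
  isOpen_interior

lemma mem_adapted (o : ManifoldOrientation m M) (c : M) : c ∈ adapted o c := by
  rw [adapted, mem_interior_iff_mem_nhds]
  filter_upwards [o.compatible c, extChartAt_source_mem_nhds (I := 𝓡 m) c] with x h1 h2
  exact ⟨h2, h1⟩

lemma adapted_subset (o : ManifoldOrientation m M) (c : M) :
    adapted o c ⊆ (extChartAt (𝓡 m) c).source :=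
  fun _ hx => (interior_subset hx).1

/-- The orientation condition concerns the transition from the chart at x to the chart at c, whereas
derivatives are converted with the inverse transition. The two determinants are inverse to each
other and so have the same sign. -/
lemma orSign_of_mem_adapted {o : ManifoldOrientation m M} {c x : M} (hx : x ∈ adapted o c) :
    orSign o c * |(transition m id c x x).det|⁻¹ * (transition m id c x x).det = orSign o x ∧
      (transition m id c x x).det ≠ 0 := by
  have hpos := (interior_subset hx).2
  have hdet := det_transition_mul (φ := (id : M → M)) (ψ := id) contMDiff_id contMDiff_id
    (fun _ => rfl) (adapted_subset o c hx) (mem_extChartAt_source (I := 𝓡 m) x)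
  simp only [id] at hdet
  set a := (transition m id x c x).det
  set b := (transition m id c x x).det
  have hb : b ≠ 0 := right_ne_zero_of_mul_eq_one hdet
  refine ⟨?_, hb⟩
  have hc := orSign_mul_self o c
  have hx := orSign_mul_self o x
  have habs : 0 < |b| := abs_pos.2 hb
  have h1 : |b| = orSign o x * orSign o c * b := by
    have hsq : (orSign o x * orSign o c * b) ^ 2 = |b| ^ 2 := by
      rw [sq_abs]
      linear_combination b ^ 2 * orSign o x * orSign o x * hc + b ^ 2 * hx
    have hp : 0 < orSign o x * orSign o c * b := by
      have : orSign o x * orSign o c * b = (orSign o x * orSign o c * a) * b ^ 2 := by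
        linear_combination -(orSign o x * orSign o c * b) * hdet
      rw [this]
      positivity
    exact ((sq_eq_sq₀ hp.le habs.le).1 hsq).symm
  have h2 : orSign o x * |b| = orSign o c * b := by
    rw [h1]; linear_combination orSign o c * b * hx
  field_simp
  linarith

/-- The pairing `sgn · ∑ᵢ det (Y, ∂₁ f, …, ∂ᵢ h, …, ∂ₘ f) / √(det g)`. -/
def pairing (o : ManifoldOrientation m M) (f Y h : M → Ambient m) (x : M) : ℝ :=
  orSign o x * ‖normalVec (dAt m f x)‖⁻¹ * varForm (Y x) (dAt m f x) (dAt m h x)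

lemma unitNormal_eq (o : ManifoldOrientation m M) (f : M → Ambient m) (x : M) :
    unitNormal o f x = (orSign o x * ‖normalVec (dAt m f x)‖⁻¹) • normalVec (dAt m f x) := rfl

/-- The definition uses a chart that varies with x. Near c it may be replaced by the single chart at
c, because the sign of the transition determinant is compensated by the orientation and its absolute
value by the normalization. -/
lemma unitNormal_eq_of_mem_adapted {o : ManifoldOrientation m M} {f : M → Ambient m}
    (hf : ContMDiff (𝓡 m) 𝓘(ℝ, Ambient m) ∞ f) {c x : M} (hx : x ∈ adapted o c) :
    unitNormal o f x =
      (orSign o c * ‖normalVec (fderiv ℝ (localRep f c) (extChartAt (𝓡 m) c x))‖⁻¹) •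
        normalVec (fderiv ℝ (localRep f c) (extChartAt (𝓡 m) c x)) := by
  obtain ⟨h1, h2⟩ := orSign_of_mem_adapted hx
  rw [localRep, fderiv_chart_eq_dAt_comp hf (adapted_subset o c hx), normalVec_comp, unitNormal_eq,
    ← h1, smul_smul, norm_smul, Real.norm_eq_abs, mul_inv]
  congr 1
  ring

lemma pairing_eq_of_mem_adapted {o : ManifoldOrientation m M} {f Y h : M → Ambient m}
    (hf : ContMDiff (𝓡 m) 𝓘(ℝ, Ambient m) ∞ f) (hh : ContMDiff (𝓡 m) 𝓘(ℝ, Ambient m) ∞ h)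
    {c x : M} (hx : x ∈ adapted o c) :
    pairing o f Y h x =
      orSign o c * ‖normalVec (fderiv ℝ (localRep f c) (extChartAt (𝓡 m) c x))‖⁻¹ *
        varForm (Y x) (fderiv ℝ (localRep f c) (extChartAt (𝓡 m) c x))
          (fderiv ℝ (localRep h c) (extChartAt (𝓡 m) c x)) := by
  obtain ⟨h1, h2⟩ := orSign_of_mem_adapted hx
  rw [localRep, localRep, fderiv_chart_eq_dAt_comp hf (adapted_subset o c hx),
    fderiv_chart_eq_dAt_comp hh (adapted_subset o c hx), normalVec_comp, varForm_comp, pairing,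
    ← h1, norm_smul, Real.norm_eq_abs, mul_inv]
  ring

lemma IsImm.norm_unitNormal {f : M → Ambient m} (hf : IsImm f) (o : ManifoldOrientation m M)
    (x : M) : ‖unitNormal o f x‖ = 1 := by
  have h := norm_ne_zero_iff.2 (hf.normalVec_dAt_ne_zero x)
  have h1 : |orSign o x| = 1 := by
    have := orSign_mul_self o x
    rw [← abs_mul_abs_self] at this
    nlinarith [abs_nonneg (orSign o x)]
  rw [unitNormal_eq, norm_smul, norm_mul, norm_inv, norm_norm, Real.norm_eq_abs, h1, one_mul,
    inv_mul_cancel₀ h]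

lemma IsImm.contMDiff_unitNormal {f : M → Ambient m} (hf : IsImm f)
    (o : ManifoldOrientation m M) :
    ContMDiff (𝓡 m) 𝓘(ℝ, Ambient m) ∞ (unitNormal o f) := by
  intro c
  have hev : unitNormal o f =ᶠ[nhds c] (fun u =>
      (orSign o c * ‖normalVec (fderiv ℝ (localRep f c) u)‖⁻¹) •
        normalVec (fderiv ℝ (localRep f c) u)) ∘ extChartAt (𝓡 m) c := by
    filter_upwards [(isOpen_adapted o c).mem_nhds (mem_adapted o c)] with x hx
    exact unitNormal_eq_of_mem_adapted hf.1 hx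
  refine ContMDiffAt.congr_of_eventuallyEq ?_ hev
  have hmem := mem_extChartAt_target (I := 𝓡 m) c
  have hN : ContDiffAt ℝ ∞ (fun u => normalVec (fderiv ℝ (localRep f c) u))
      (extChartAt (𝓡 m) c c) :=
    contDiff_normalVec.contDiffAt.comp _
      (((contDiffOn_localRep hf.1 c).fderiv_of_isOpen (isOpen_extChartAt_target c)
        (m := ∞) (by simp)).contDiffAt ((isOpen_extChartAt_target c).mem_nhds hmem))
  have hne := hf.normalVec_ne_zero hmem
  have h1 := (contDiffAt_const (c := orSign o c)).mul
    ((hN.norm ℝ hne).inv (norm_ne_zero_iff.2 hne))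
  exact (h1.smul hN).contMDiffAt.comp c contMDiffAt_extChartAt

end Charts

/-! ### The mean curvature -/

section MeanCurvature

variable {m : ℕ} {M : Type*} [TopologicalSpace M] [ChartedSpace (Model m) M]
  [IsManifold (𝓡 m) ∞ M]

/-- Pairing with the derivative of the normal field yields the mean curvature. -/
lemma IsImm.pairing_unitNormal {f : M → Ambient m} (hf : IsImm f) (o : ManifoldOrientation m M)
    (k : M → Ambient m) (x : M) :
    pairing o f k (unitNormal o f) x =
      -(meanCurvature o f x * inner ℝ (k x) (unitNormal o f x)) := by
  set u₀ := extChartAt (𝓡 m) x x with hu₀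
  set V : Model m → Ambient m := unitNormal o f ∘ (extChartAt (𝓡 m) x).symm with hV
  have hu₀T : u₀ ∈ (extChartAt (𝓡 m) x).target := mem_extChartAt_target x
  have hT := isOpen_extChartAt_target (I := 𝓡 m) x
  have hVd : DifferentiableAt ℝ V u₀ :=
    differentiableAt_comp_chart_symm (hf.contMDiff_unitNormal o) x hu₀T
  have hV0 : V u₀ = unitNormal o f x := by
    simp only [hV, Function.comp_apply, hu₀, extChartAt_to_inv]
  have hdV : dAt m (unitNormal o f) x = fderiv ℝ V u₀ := rfl
  have hA : ContDiffOn ℝ ∞ (fderiv ℝ (localRep f x)) (extChartAt (𝓡 m) x).target :=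
    (contDiffOn_localRep hf.1 x).fderiv_of_isOpen hT (by simp)
  have hAd : DifferentiableAt ℝ (fderiv ℝ (localRep f x)) u₀ :=
    (hA.contDiffAt (hT.mem_nhds hu₀T)).differentiableAt (by simp)
  have hP : ∀ i, DifferentiableAt ℝ (partialD f x i) u₀ := fun i =>
    hAd.clm_apply (differentiableAt_const _)
  have horth : ∀ i, (fun u => inner ℝ (partialD f x i u) (V u) : Model m → ℝ) =ᶠ[nhds u₀]
      fun _ => 0 := by
    intro i
    have h1 : ∀ᶠ u in nhds u₀, (extChartAt (𝓡 m) x).symm u ∈ adapted o x :=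
      (continuousAt_extChartAt_symm x).eventually_mem
        ((isOpen_adapted o x).mem_nhds (by simpa using mem_adapted o x))
    filter_upwards [h1, hT.mem_nhds hu₀T] with u hu huT
    simp only [hV, Function.comp_apply]
    rw [unitNormal_eq_of_mem_adapted hf.1 hu, (extChartAt (𝓡 m) x).right_inv huT,
      inner_smul_right]
    have := inner_normalVec_frame (fderiv ℝ (localRep f x) u) i
    rw [frame] at this
    rw [partialD, this, mul_zero]
  have hnorm : (fun u => inner ℝ (V u) (V u) : Model m → ℝ) = fun _ => 1 := by
    funext u
    simp only [hV, Function.comp_apply, real_inner_self_eq_norm_sq, hf.norm_unitNormal, one_pow]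
  -- Since ν has constant length, its derivatives are tangent to f and hence combinations of the
  -- frame.
  have hdν : ∀ j, inner ℝ (frame (fderiv ℝ V u₀) j) (V u₀) = (0 : ℝ) := by
    intro j
    have h := fderiv_inner_apply ℝ hVd hVd (EuclideanSpace.single j 1)
    rw [hnorm, fderiv_fun_const, real_inner_comm] at h
    simp only [Pi.zero_apply, zero_apply] at h
    rw [frame]
    linarith
  have hinj := hf.injective_dAt x
  have hN := hf.normalVec_dAt_ne_zero x
  have hε : orSign o x * ‖normalVec (dAt m f x)‖⁻¹ ≠ 0 :=
    mul_ne_zero (left_ne_zero_of_mul_eq_one (orSign_mul_self o x))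
      (inv_ne_zero (norm_ne_zero_iff.2 hN))
  have hb : ∀ j, ∃ b : Fin m → ℝ, frame (fderiv ℝ V u₀) j = ∑ l, b l • frame (dAt m f x) l := by
    intro j
    refine exists_eq_sum_frame hinj ?_
    have := hdν j
    rw [hV0, unitNormal_eq, inner_smul_right] at this
    exact (mul_eq_zero.1 this).resolve_left hε
  choose b hb using hb
  -- Differentiate ⟨∂ᵢf, ν⟩ = 0 in the direction j. This gives s = -g bᵀ, so the trace of g⁻¹ s is
  -- -tr b.
  have hs : secondFundForm o f x = -(gramMatrix (dAt m f x) * (Matrix.of b).transpose) := by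
    ext i j
    have h := fderiv_inner_apply ℝ (hP i) hVd (EuclideanSpace.single j 1)
    rw [(horth i).fderiv_eq, fderiv_fun_const] at h
    simp only [Pi.zero_apply, zero_apply] at h
    have hbj := hb j
    rw [frame] at hbj
    rw [hbj, hV0, inner_sum] at h
    simp only [secondFundForm, Matrix.of_apply, partialD₂, Matrix.neg_apply, Matrix.mul_apply,
      Matrix.transpose_apply]
    rw [eq_neg_iff_add_eq_zero, add_comm, ← hu₀]
    rw [h]
    congr 1
    refine Finset.sum_congr rfl fun l _ => ?_
    rw [inner_smul_right, mul_comm]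
    rfl
  have hdet : IsUnit (gramMatrix (dAt m f x)).det := by
    rw [det_gramMatrix hinj]
    exact (pow_ne_zero 2 (norm_ne_zero_iff.2 hN)).isUnit
  have hH : meanCurvature o f x = -(Matrix.of b).trace := by
    have hg : gram f x u₀ = gramMatrix (dAt m f x) := rfl
    rw [meanCurvature, weingarten, ← hu₀, hg, hs, mul_neg, ← mul_assoc, Matrix.nonsing_inv_mul _ hdet,
      one_mul, Matrix.trace_neg, Matrix.trace_transpose]
  rw [pairing, hdV, varForm_of_frame _ _ _ (Matrix.of b) hb, hH, unitNormal_eq, inner_smul_right,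
    inner_normalVec]
  ring

end MeanCurvature

/-! ### The divergence theorem in a chart -/

section LocalStokes

variable {m : ℕ}

open MeasureTheory

/-- Integration by parts against the constant function 1. -/
lemma integral_fderiv_apply_eq_zero {E : Type*} [NormedAddCommGroup E] [NormedSpace ℝ E]
    [FiniteDimensional ℝ E] [MeasurableSpace E] [BorelSpace E] (μ : Measure E)
    [μ.IsAddHaarMeasure] {W : E → ℝ} (hW : ContDiff ℝ 1 W) (hc : HasCompactSupport W) (v : E) :
    ∫ u, fderiv ℝ W u v ∂μ = 0 := by
  have hint : Integrable (fun u => fderiv ℝ W u v) μ :=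
    ((hW.continuous_fderiv (by simp)).clm_apply continuous_const).integrable_of_hasCompactSupport
      ((hc.fderiv ℝ).comp_left (g := fun L : E →L[ℝ] ℝ => L v) rfl)
  have h := integral_mul_fderiv_eq_neg_fderiv_mul_of_integrable (μ := μ) (𝕜 := ℝ)
    (f := fun _ : E => (1 : ℝ)) (g := W) (v := v) (by simp) (by simpa using hint)
    (by simpa using hW.continuous.integrable_of_hasCompactSupport hc)
    (fun _ _ => differentiableAt_const _)
    (fun u _ => hW.differentiable (by simp) u)
  simpa using h

/-- The divergence theorem for the vector field with components `det (Y, ∂₁ F, …, h, …, ∂ₘ F)`. -/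
lemma integral_varForm_sub_eq_zero {T : Set (Model m)} (hT : IsOpen T)
    {F Y h : Model m → Ambient m} (hF : ContDiffOn ℝ ∞ F T) (hY : ContDiffOn ℝ ∞ Y T)
    (hh : ContDiffOn ℝ ∞ h T) (hc : HasCompactSupport h) (hs : tsupport h ⊆ T) :
    ∫ u in T, (varForm (Y u) (fderiv ℝ F u) (fderiv ℝ h u) -
      varForm (h u) (fderiv ℝ F u) (fderiv ℝ Y u)) = 0 := by
  classical
  set W : Fin m → Model m → ℝ := fun i u =>
    volForm m (Fin.cons (Y u) (Function.update (frame (fderiv ℝ F u)) i (h u))) with hW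
  have hDF : ContDiffOn ℝ ∞ (fderiv ℝ F) T := hF.fderiv_of_isOpen hT (by simp)
  have hzero : ∀ i u, h u = 0 → W i u = 0 := by
    intro i u hu
    simp only [hW, hu]
    have := volForm_update_smul (Y u) (frame (fderiv ℝ F u)) i 0 0
    rwa [zero_smul, zero_mul] at this
  have hsupp : ∀ i, Function.support (W i) ⊆ Function.support h := fun i u hu hu' =>
    hu (hzero i u hu')
  have htsupp : ∀ i, tsupport (W i) ⊆ tsupport h := fun i => closure_mono (hsupp i)
  have hWc : ∀ i, HasCompactSupport (W i) := fun i => hc.mono (hsupp i)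
  -- F and Y are smooth only on T, but the components vanish near every point outside the support of
  -- h, which lies in T.
  have hWd : ∀ i, ContDiff ℝ ∞ (W i) := by
    intro i
    refine contDiff_iff_contDiffAt.2 fun u => ?_
    by_cases hu : u ∈ tsupport (W i)
    swap
    · exact contDiffAt_const.congr_of_eventuallyEq (notMem_tsupport_iff_eventuallyEq.1 hu)
    have huT : T ∈ nhds u := hT.mem_nhds (hs (htsupp i hu))
    refine (volForm m).toContinuousMultilinearMap.contDiff.contDiffAt.comp u ?_
    refine contDiffAt_pi.2 fun j => ?_
    refine Fin.cases ?_ (fun j => ?_) j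
    · simpa [-Fin.cons_update] using hY.contDiffAt huT
    · by_cases hj : j = i
      · subst hj
        simpa [-Fin.cons_update] using hh.contDiffAt huT
      · simpa [-Fin.cons_update, frame, hj] using
          (hDF.contDiffAt huT).clm_apply contDiffAt_const
  have hpt : ∀ u ∈ T, ∑ i, fderiv ℝ (W i) u (EuclideanSpace.single i 1) =
      varForm (Y u) (fderiv ℝ F u) (fderiv ℝ h u) -
        varForm (h u) (fderiv ℝ F u) (fderiv ℝ Y u) := by
    intro u hu
    have huT : T ∈ nhds u := hT.mem_nhds hu
    have hYd := ((hY.contDiffAt huT).differentiableAt (by simp)).hasFDerivAt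
    have hhd := ((hh.contDiffAt huT).differentiableAt (by simp)).hasFDerivAt
    have hFd := ((hDF.contDiffAt huT).differentiableAt (by simp)).hasFDerivAt
    have hsymm : IsSymmSndFDerivAt ℝ F u :=
      (hF.contDiffAt huT).isSymmSndFDerivAt (by
        rw [minSmoothness_of_isRCLikeNormedField]
        exact WithTop.coe_le_coe.2 (le_top : (2 : ℕ∞) ≤ ⊤))
    -- The divergence is computed algebraically; the symmetry of the second derivative of F is what
    -- removes it from the result.
    have key := sum_linearDeriv_volForm (Y u) (h u) (frame (fderiv ℝ F u))
      (frame (fderiv ℝ Y u)) (frame (fderiv ℝ h u))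
      (fun i j => fderiv ℝ (fderiv ℝ F) u (EuclideanSpace.single i 1) (EuclideanSpace.single j 1))
      (fun i j => hsymm _ _)
    rw [varForm, varForm, ← key]
    refine Finset.sum_congr rfl fun i _ => ?_
    set L : Fin (m + 1) → Model m →L[ℝ] Ambient m := Fin.cons (fderiv ℝ Y u)
      (Function.update (fun j => (ContinuousLinearMap.apply ℝ (Ambient m)
        (EuclideanSpace.single j (1 : ℝ))) ∘L fderiv ℝ (fderiv ℝ F) u) i (fderiv ℝ h u)) with hL
    have hp : HasFDerivAt (fun u => (Fin.cons (Y u) (Function.update (frame (fderiv ℝ F u)) i (h u)) :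
        Fin (m + 1) → Ambient m)) (ContinuousLinearMap.pi L) u := by
      refine hasFDerivAt_pi.2 fun j => ?_
      refine Fin.cases ?_ (fun j => ?_) j
      · simpa [-Fin.cons_update, hL] using hYd
      · by_cases hj : j = i
        · subst hj
          simpa [-Fin.cons_update, hL] using hhd
        · simp only [Fin.cons_succ, Function.update_of_ne hj, hL, frame]
          exact ((ContinuousLinearMap.apply ℝ (Ambient m)
            (EuclideanSpace.single j (1 : ℝ))).hasFDerivAt).comp u hFd
    have := ((volForm m).hasFDerivAt _).comp u hp
    have hfd : fderiv ℝ (W i) u = _ := this.fderiv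
    rw [hfd, ContinuousLinearMap.comp_apply]
    congr 1
    funext j
    refine Fin.cases ?_ (fun j => ?_) j
    · simp [-Fin.cons_update, hL, frame]
    · by_cases hj : j = i
      · subst hj
        simp [-Fin.cons_update, hL, frame]
      · simp [-Fin.cons_update, hL, frame, hj]
  rw [setIntegral_congr_fun hT.measurableSet (fun u hu => (hpt u hu).symm)]
  rw [setIntegral_eq_integral_of_forall_compl_eq_zero]
  · rw [integral_finsetSum]
    · exact Finset.sum_eq_zero fun i _ =>
        integral_fderiv_apply_eq_zero volume ((hWd i).of_le (by simp)) (hWc i) _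
    · intro i _
      exact (((hWd i).continuous_fderiv (by simp)).clm_apply
        continuous_const).integrable_of_hasCompactSupport
        (((hWc i).fderiv ℝ).comp_left (g := fun L : Model m →L[ℝ] ℝ => L _) rfl)
  · intro u hu
    refine Finset.sum_eq_zero fun i _ => ?_
    have : u ∉ tsupport (fderiv ℝ (W i)) := fun h' =>
      hu (hs (htsupp i (tsupport_fderiv_subset ℝ h')))
    rw [image_eq_zero_of_notMem_tsupport this]
    rfl

end LocalStokes

/-! ### The volume measure in charts -/

section Measure

open MeasureTheory

variable {m : ℕ} {M : Type*} [TopologicalSpace M] [ChartedSpace (Model m) M]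
  [IsManifold (𝓡 m) ∞ M]

lemma IsImm.continuousOn_volDensity {f : M → Ambient m} (hf : IsImm f) (c : M) :
    ContinuousOn (volDensity f c) (extChartAt (𝓡 m) c).target := by
  have h : ContinuousOn (fun u => ‖normalVec (fderiv ℝ (localRep f c) u)‖)
      (extChartAt (𝓡 m) c).target :=
    ((contDiff_normalVec (n := 0)).continuous.comp_continuousOn
      ((contDiffOn_localRep hf.1 c).continuousOn_fderiv_of_isOpen
        (isOpen_extChartAt_target c) (by simp))).norm
  exact h.congr fun u hu => hf.volDensity_eq hu

lemma IsImm.comp_diffeomorph {f : M → Ambient m} (hf : IsImm f)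
    (φ : Diffeomorph (𝓡 m) (𝓡 m) M M ∞) : IsImm (f ∘ φ) := by
  refine ⟨hf.1.comp φ.contMDiff, fun x => ?_⟩
  rw [mfderiv_comp x (hf.1.mdifferentiableAt (by simp)) (φ.contMDiff.mdifferentiableAt (by simp))]
  exact (hf.2 (φ x)).comp (φ.mfderivToContinuousLinearEquiv (by simp) x).injective

/-- The change of variables formula between two charts, combined with a diffeomorphism. -/
lemma lintegral_chart_comp {f : M → Ambient m} (hf : IsImm f)
    (φ : Diffeomorph (𝓡 m) (𝓡 m) M M ∞) (c d : M) (G : M → ℝ≥0∞) :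
    ∫⁻ v in (extChartAt (𝓡 m) d).target ∩
        (extChartAt (𝓡 m) d).symm ⁻¹' (φ.symm ⁻¹' (extChartAt (𝓡 m) c).source),
      ENNReal.ofReal (volDensity f d v) * G ((extChartAt (𝓡 m) d).symm v) =
    ∫⁻ u in (extChartAt (𝓡 m) c).target ∩
        (extChartAt (𝓡 m) c).symm ⁻¹' (φ ⁻¹' (extChartAt (𝓡 m) d).source),
      ENNReal.ofReal (volDensity (f ∘ φ) c u) * G (φ ((extChartAt (𝓡 m) c).symm u)) := by
  set A := (extChartAt (𝓡 m) c).target ∩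
        (extChartAt (𝓡 m) c).symm ⁻¹' (φ ⁻¹' (extChartAt (𝓡 m) d).source) with hA
  set τ : Model m → Model m := extChartAt (𝓡 m) d ∘ φ ∘ (extChartAt (𝓡 m) c).symm with hτ
  have hAo : IsOpen A :=
    (continuousOn_extChartAt_symm c).isOpen_inter_preimage (isOpen_extChartAt_target c)
      ((isOpen_extChartAt_source d).preimage φ.continuous)
  have himg : τ '' A = (extChartAt (𝓡 m) d).target ∩
        (extChartAt (𝓡 m) d).symm ⁻¹' (φ.symm ⁻¹' (extChartAt (𝓡 m) c).source) := by
    ext v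
    constructor
    · rintro ⟨u, ⟨hu1, hu2⟩, rfl⟩
      refine ⟨(extChartAt (𝓡 m) d).map_source hu2, ?_⟩
      simp only [hτ, Set.mem_preimage, Function.comp_apply]
      rw [(extChartAt (𝓡 m) d).left_inv hu2, φ.symm_apply_apply]
      exact (extChartAt (𝓡 m) c).map_target hu1
    · rintro ⟨hv1, hv2⟩
      refine ⟨extChartAt (𝓡 m) c (φ.symm ((extChartAt (𝓡 m) d).symm v)),
        ⟨(extChartAt (𝓡 m) c).map_source hv2, ?_⟩, ?_⟩
      · simp only [Set.mem_preimage]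
        rw [(extChartAt (𝓡 m) c).left_inv hv2, φ.apply_symm_apply]
        exact (extChartAt (𝓡 m) d).map_target hv1
      · simp only [hτ, Function.comp_apply]
        rw [(extChartAt (𝓡 m) c).left_inv hv2, φ.apply_symm_apply,
          (extChartAt (𝓡 m) d).right_inv hv1]
  have hinj : Set.InjOn τ A := by
    rintro u ⟨hu1, hu2⟩ v ⟨hv1, hv2⟩ h
    have h1 := (extChartAt (𝓡 m) d).injOn hu2 hv2 h
    exact (extChartAt (𝓡 m) c).symm.injOn hu1 hv1 (φ.injective h1)
  have hsrc : ∀ u ∈ A, (extChartAt (𝓡 m) c).symm u ∈ (extChartAt (𝓡 m) c).source :=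
    fun u hu => (extChartAt (𝓡 m) c).map_target hu.1
  have hder : ∀ u ∈ A, HasFDerivWithinAt τ (transition m φ c d ((extChartAt (𝓡 m) c).symm u))
      A u := by
    intro u hu
    have h := (contDiffAt_transition_map φ.contMDiff (hsrc u hu) hu.2).differentiableAt (by simp)
    have h' := h.hasFDerivAt.hasFDerivWithinAt (s := A)
    rw [(extChartAt (𝓡 m) c).right_inv hu.1] at h'
    rw [transition, (extChartAt (𝓡 m) c).right_inv hu.1]
    exact h'
  rw [← himg, lintegral_image_eq_lintegral_abs_det_fderiv_mul volume hAo.measurableSet hder hinj]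
  refine setLIntegral_congr_fun hAo.measurableSet fun u hu => ?_
  have hτu : τ u ∈ (extChartAt (𝓡 m) d).target := (extChartAt (𝓡 m) d).map_source hu.2
  have hval : (extChartAt (𝓡 m) d).symm (τ u) = φ ((extChartAt (𝓡 m) c).symm u) :=
    (extChartAt (𝓡 m) d).left_inv hu.2
  have hd : fderiv ℝ (localRep (f ∘ φ) c) u = fderiv ℝ (localRep f d) (τ u) ∘L
      transition m φ c d ((extChartAt (𝓡 m) c).symm u) := by
    have := fderiv_comp_chart hf.1 φ.contMDiff (hsrc u hu) hu.2
    rw [(extChartAt (𝓡 m) c).right_inv hu.1] at this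
    exact this
  -- The Jacobian |det| of the change of variables is exactly the factor by which ‖N‖ scales under
  -- composition.
  rw [hval, ← mul_assoc, ← ENNReal.ofReal_mul (abs_nonneg _), hf.volDensity_eq hτu,
    (hf.comp_diffeomorph φ).volDensity_eq hu.1, hd, normalVec_comp, norm_smul, Real.norm_eq_abs]

variable [T2Space M] [CompactSpace M]

lemma finite_chartPartition :
    {c : M | (Function.support (chartPartition m M c)).Nonempty}.Finite :=
  (chartPartition m M).locallyFinite.finite_nonempty_of_compact

lemma sum_ofReal_chartPartition_mul (a : ℝ≥0∞) (x : M) :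
    ∑ c ∈ (finite_chartPartition (m := m) (M := M)).toFinset,
      ENNReal.ofReal (chartPartition m M c x) * a = a := by
  rw [← Finset.sum_mul, ← ENNReal.ofReal_sum_of_nonneg
    (fun c _ => (chartPartition m M).nonneg c x)]
  have h := (chartPartition m M).sum_eq_one (Set.mem_univ x)
  rw [finsum_eq_sum_of_support_subset _ (s := (finite_chartPartition (m := m) (M := M)).toFinset)]
    at h
  · rw [h, ENNReal.ofReal_one, one_mul]
  · intro c hc
    simp only [Set.Finite.coe_toFinset, Set.mem_ofPred_eq]
    exact ⟨x, hc⟩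

lemma chartPartition_eq_zero {c x : M} (hx : x ∉ (extChartAt (𝓡 m) c).source) :
    chartPartition m M c x = 0 := by
  have h := Classical.choose_spec
    (SmoothPartitionOfUnity.exists_isSubordinate_chartAt_source (𝓡 m) M) c
  by_contra hne
  exact hx (by rw [extChartAt_source]; exact h (subset_closure hne))

variable [MeasurableSpace M] [BorelSpace M]

lemma aemeasurable_chart_symm (c : M) :
    AEMeasurable (extChartAt (𝓡 m) c).symm
      ((volume : Measure (Model m)).restrict (extChartAt (𝓡 m) c).target) :=
  (continuousOn_extChartAt_symm c).aemeasurable (isOpen_extChartAt_target c).measurableSet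

lemma IsImm.aemeasurable_volDensity {f : M → Ambient m} (hf : IsImm f) (c : M) :
    AEMeasurable (fun u => ENNReal.ofReal (volDensity f c u))
      (volume.restrict (extChartAt (𝓡 m) c).target) :=
  ENNReal.measurable_ofReal.comp_aemeasurable
    ((hf.continuousOn_volDensity c).aemeasurable (isOpen_extChartAt_target c).measurableSet)

lemma aemeasurable_comp_chart_symm {G : M → ℝ≥0∞} (hG : Measurable G) (c : M) :
    AEMeasurable (fun u => G ((extChartAt (𝓡 m) c).symm u))
      ((volume : Measure (Model m)).restrict (extChartAt (𝓡 m) c).target) :=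
  hG.comp_aemeasurable (aemeasurable_chart_symm c)

lemma IsImm.lintegral_volMeasure {f : M → Ambient m} (hf : IsImm f) {G : M → ℝ≥0∞}
    (hG : Measurable G) :
    ∫⁻ x, G x ∂(volMeasure f) =
      ∑ d ∈ (finite_chartPartition (m := m) (M := M)).toFinset,
        ∫⁻ v in (extChartAt (𝓡 m) d).target, ENNReal.ofReal (volDensity f d v) *
          (ENNReal.ofReal (chartPartition m M d ((extChartAt (𝓡 m) d).symm v)) *
            G ((extChartAt (𝓡 m) d).symm v)) := by
  rw [volMeasure, lintegral_sum_measure, tsum_eq_sum]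
  · refine Finset.sum_congr rfl fun d _ => ?_
    have hdens : AEMeasurable (fun u => ENNReal.ofReal
        (chartPartition m M d ((extChartAt (𝓡 m) d).symm u) * volDensity f d u))
        (volume.restrict (extChartAt (𝓡 m) d).target) := by
      refine ENNReal.measurable_ofReal.comp_aemeasurable (ContinuousOn.aemeasurable ?_
        (isOpen_extChartAt_target d).measurableSet)
      exact ((chartPartition m M d).contMDiff.continuous.comp_continuousOn
        (continuousOn_extChartAt_symm d)).mul (hf.continuousOn_volDensity d)
    have hsymm := aemeasurable_chart_symm (m := m) d
    rw [lintegral_map' hG.aemeasurable (hsymm.mono_ac (withDensity_absolutelyContinuous _ _)),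
      lintegral_withDensity_eq_lintegral_mul₀ hdens (aemeasurable_comp_chart_symm hG d)]
    refine lintegral_congr fun u => ?_
    simp only [Pi.mul_apply]
    rw [ENNReal.ofReal_mul ((chartPartition m M).nonneg d _)]
    ring
  · intro d hd
    have h0 : ∀ x, chartPartition m M d x = 0 := by
      intro x
      by_contra hne
      exact hd ((Set.Finite.mem_toFinset _).2 ⟨x, hne⟩)
    simp [h0]

/-- All pieces of the partition of unity are transported to the one chart at c, where the partition
functions sum to 1. With φ = id this is independence of the partition; with general φ it yields
invariance under reparametrization. -/
lemma IsImm.lintegral_comp_chart {f : M → Ambient m} (hf : IsImm f)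
    (φ : Diffeomorph (𝓡 m) (𝓡 m) M M ∞) (c : M) {G : M → ℝ≥0∞} (hG : Measurable G)
    (hG0 : ∀ x, φ.symm x ∉ (extChartAt (𝓡 m) c).source → G x = 0) :
    ∫⁻ x, G x ∂(volMeasure f) = ∫⁻ u in (extChartAt (𝓡 m) c).target,
      ENNReal.ofReal (volDensity (f ∘ φ) c u) * G (φ ((extChartAt (𝓡 m) c).symm u)) := by
  rw [hf.lintegral_volMeasure hG]
  have hTc := isOpen_extChartAt_target (I := 𝓡 m) c
  have hstep : ∀ d, ∫⁻ v in (extChartAt (𝓡 m) d).target, ENNReal.ofReal (volDensity f d v) *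
      (ENNReal.ofReal (chartPartition m M d ((extChartAt (𝓡 m) d).symm v)) *
        G ((extChartAt (𝓡 m) d).symm v)) =
      ∫⁻ u in (extChartAt (𝓡 m) c).target, ENNReal.ofReal (volDensity (f ∘ φ) c u) *
        (ENNReal.ofReal (chartPartition m M d (φ ((extChartAt (𝓡 m) c).symm u))) *
          G (φ ((extChartAt (𝓡 m) c).symm u))) := by
    intro d
    have key := lintegral_chart_comp hf φ c d
      (fun x => ENNReal.ofReal (chartPartition m M d x) * G x)
    have hTd := isOpen_extChartAt_target (I := 𝓡 m) d
    have hB : IsOpen ((extChartAt (𝓡 m) d).target ∩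
        (extChartAt (𝓡 m) d).symm ⁻¹' (φ.symm ⁻¹' (extChartAt (𝓡 m) c).source)) :=
      (continuousOn_extChartAt_symm d).isOpen_inter_preimage hTd
        ((isOpen_extChartAt_source c).preimage φ.symm.continuous)
    have hA : IsOpen ((extChartAt (𝓡 m) c).target ∩
        (extChartAt (𝓡 m) c).symm ⁻¹' (φ ⁻¹' (extChartAt (𝓡 m) d).source)) :=
      (continuousOn_extChartAt_symm c).isOpen_inter_preimage hTc
        ((isOpen_extChartAt_source d).preimage φ.continuous)
    rw [← lintegral_indicator hB.measurableSet, ← lintegral_indicator hA.measurableSet] at key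
    rw [← lintegral_indicator hTd.measurableSet, ← lintegral_indicator hTc.measurableSet]
    -- Passing from the overlap to the full chart targets adds nothing: on one side G vanishes
    -- there, on the other the partition function does.
    convert key using 2
    · funext v
      by_cases hv : v ∈ (extChartAt (𝓡 m) d).target
      · by_cases hv' : φ.symm ((extChartAt (𝓡 m) d).symm v) ∈ (extChartAt (𝓡 m) c).source
        · rw [Set.indicator_of_mem hv, Set.indicator_of_mem (by exact ⟨hv, hv'⟩)]
        · rw [Set.indicator_of_mem hv, Set.indicator_of_notMem (fun h => hv' h.2), hG0 _ hv',
            mul_zero, mul_zero]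
      · rw [Set.indicator_of_notMem hv, Set.indicator_of_notMem (fun h => hv h.1)]
    · funext u
      by_cases hu : u ∈ (extChartAt (𝓡 m) c).target
      · by_cases hu' : φ ((extChartAt (𝓡 m) c).symm u) ∈ (extChartAt (𝓡 m) d).source
        · rw [Set.indicator_of_mem hu, Set.indicator_of_mem (by exact ⟨hu, hu'⟩)]
        · rw [Set.indicator_of_mem hu, Set.indicator_of_notMem (fun h => hu' h.2),
            chartPartition_eq_zero hu', ENNReal.ofReal_zero, zero_mul, mul_zero]
      · rw [Set.indicator_of_notMem hu, Set.indicator_of_notMem (fun h => hu h.1)]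
  rw [Finset.sum_congr rfl fun d _ => hstep d, ← lintegral_finsetSum']
  · refine lintegral_congr fun u => ?_
    rw [← Finset.mul_sum, sum_ofReal_chartPartition_mul]
  · intro d _
    have hsymm := φ.continuous.measurable.comp_aemeasurable (aemeasurable_chart_symm (m := m) c)
    refine AEMeasurable.mul (ENNReal.measurable_ofReal.comp_aemeasurable
      (((hf.comp_diffeomorph φ).continuousOn_volDensity c).aemeasurable hTc.measurableSet))
      (AEMeasurable.mul ?_ (hG.comp_aemeasurable hsymm))
    exact (ENNReal.measurable_ofReal.comp
      (chartPartition m M d).contMDiff.continuous.measurable).comp_aemeasurable hsymm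

/-- In the domain of a chart, the volume measure has the density `√(det g)`. -/
lemma IsImm.restrict_volMeasure {f : M → Ambient m} (hf : IsImm f) (c : M) :
    (volMeasure f).restrict (extChartAt (𝓡 m) c).source =
      Measure.map (extChartAt (𝓡 m) c).symm
        ((volume.restrict (extChartAt (𝓡 m) c).target).withDensity fun u =>
          ENNReal.ofReal (volDensity f c u)) := by
  have hs := (isOpen_extChartAt_source (I := 𝓡 m) c).measurableSet
  have hT := (isOpen_extChartAt_target (I := 𝓡 m) c).measurableSet
  refine Measure.ext_of_lintegral _ fun G hG => ?_
  have hsymm := aemeasurable_chart_symm (m := m) c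
  rw [lintegral_map' hG.aemeasurable (hsymm.mono_ac (withDensity_absolutelyContinuous _ _)),
    lintegral_withDensity_eq_lintegral_mul₀ (hf.aemeasurable_volDensity c)
      (aemeasurable_comp_chart_symm hG c),
    ← lintegral_indicator hs,
    hf.lintegral_comp_chart (Diffeomorph.refl (𝓡 m) M ∞) c (hG.indicator hs)
      (fun x hx => Set.indicator_of_notMem hx _)]
  refine setLIntegral_congr_fun hT fun u hu => ?_
  simp only [Diffeomorph.coe_refl, Function.comp_id, id, Pi.mul_apply]
  rw [Set.indicator_of_mem ((extChartAt (𝓡 m) c).map_target hu)]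

/-- The volume measure is compatible with diffeomorphisms. -/
lemma IsImm.volMeasure_comp_diffeomorph {f : M → Ambient m} (hf : IsImm f)
    (φ : Diffeomorph (𝓡 m) (𝓡 m) M M ∞) :
    volMeasure f = Measure.map φ (volMeasure (f ∘ φ)) := by
  refine Measure.ext_of_lintegral _ fun G hG => ?_
  rw [lintegral_map hG φ.continuous.measurable]
  -- Both sides have the same expression in the chart at c: the left one through φ, the right one
  -- for f ∘ φ through the identity. A general G is cut up by the partition of unity transported by
  -- φ.
  have hloc : ∀ (c : M) (G : M → ℝ≥0∞), Measurable G →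
      (∀ x, φ.symm x ∉ (extChartAt (𝓡 m) c).source → G x = 0) →
      ∫⁻ x, G x ∂(volMeasure f) = ∫⁻ x, G (φ x) ∂(volMeasure (f ∘ φ)) := by
    intro c G hG hG0
    have h := (hf.comp_diffeomorph φ).lintegral_comp_chart (Diffeomorph.refl (𝓡 m) M ∞) c
        (hG.comp φ.continuous.measurable) (fun x hx => hG0 _ (by
          rw [φ.symm_apply_apply]; exact hx))
    rw [hf.lintegral_comp_chart φ c hG hG0]
    exact h.symm
  have hG1 : G = fun x => ∑ c ∈ (finite_chartPartition (m := m) (M := M)).toFinset,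
      ENNReal.ofReal (chartPartition m M c (φ.symm x)) * G x := by
    funext x
    rw [sum_ofReal_chartPartition_mul]
  have hmeas : ∀ c, Measurable fun x =>
      ENNReal.ofReal (chartPartition m M c (φ.symm x)) * G x := fun c =>
    (ENNReal.measurable_ofReal.comp ((chartPartition m M c).contMDiff.continuous.comp
      φ.symm.continuous).measurable).mul hG
  have hmeas' : ∀ c, Measurable fun x =>
      ENNReal.ofReal (chartPartition m M c (φ.symm (φ x))) * G (φ x) := fun c =>
    (hmeas c).comp φ.continuous.measurable
  rw [hG1, lintegral_finsetSum _ fun c _ => hmeas c]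
  simp only
  rw [lintegral_finsetSum _ fun c _ => hmeas' c]
  refine Finset.sum_congr rfl fun c _ => hloc c _ (hmeas c) fun x hx => ?_
  rw [chartPartition_eq_zero hx, ENNReal.ofReal_zero, zero_mul]

lemma IsImm.setIntegral_source {f : M → Ambient m} (hf : IsImm f) (c : M) {ξ : M → ℝ}
    (hξ : Measurable ξ) :
    ∫ x in (extChartAt (𝓡 m) c).source, ξ x ∂(volMeasure f) =
      ∫ u in (extChartAt (𝓡 m) c).target,
        volDensity f c u * ξ ((extChartAt (𝓡 m) c).symm u) := by
  have hT := (isOpen_extChartAt_target (I := 𝓡 m) c).measurableSet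
  have hsymm := aemeasurable_chart_symm (m := m) c
  rw [hf.restrict_volMeasure c,
    integral_map (hsymm.mono_ac (withDensity_absolutelyContinuous _ _)) hξ.aestronglyMeasurable,
    integral_withDensity_eq_integral_toReal_smul₀ (hf.aemeasurable_volDensity c) (by simp)]
  refine integral_congr_ae (Filter.Eventually.of_forall fun u => ?_)
  simp only [smul_eq_mul]
  have h0 : 0 ≤ volDensity f c u := Real.sqrt_nonneg _
  rw [ENNReal.toReal_ofReal h0]

/-- By compactness of M it suffices to bound the measure near each point, where the density is
bounded on a compact coordinate neighbourhood. -/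
lemma IsImm.isFiniteMeasure {f : M → Ambient m} (hf : IsImm f) :
    IsFiniteMeasure (volMeasure f) := by
  refine ⟨isCompact_univ.measure_lt_top_of_nhdsWithin fun x _ => ?_⟩
  rw [nhdsWithin_univ]
  obtain ⟨K, hKn, hKT, hK⟩ := local_compact_nhds
    ((isOpen_extChartAt_target (I := 𝓡 m) x).mem_nhds (mem_extChartAt_target x))
  set U := (extChartAt (𝓡 m) x).source ∩ extChartAt (𝓡 m) x ⁻¹' interior K with hU
  have hUo : IsOpen U := isOpen_extChartAt_preimage' x isOpen_interior
  refine ⟨U, hUo.mem_nhds ⟨mem_extChartAt_source x, mem_interior_iff_mem_nhds.2 hKn⟩, ?_⟩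
  have hT := (isOpen_extChartAt_target (I := 𝓡 m) x).measurableSet
  have hUs : volMeasure f U = (volMeasure f).restrict (extChartAt (𝓡 m) x).source U := by
    rw [Measure.restrict_apply hUo.measurableSet,
      Set.inter_eq_left.2 (fun y hy => hy.1 : U ⊆ (extChartAt (𝓡 m) x).source)]
  have hsymm := aemeasurable_chart_symm (m := m) x
  rw [hUs, hf.restrict_volMeasure, Measure.map_apply_of_aemeasurable
    (hsymm.mono_ac (withDensity_absolutelyContinuous _ _)) hUo.measurableSet]
  obtain ⟨C, hC⟩ := hK.exists_bound_of_continuousOn ((hf.continuousOn_volDensity x).mono hKT)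
  rw [withDensity_apply' _ _, Measure.restrict_restrict' hT]
  calc ∫⁻ u in (extChartAt (𝓡 m) x).symm ⁻¹' U ∩ (extChartAt (𝓡 m) x).target,
        ENNReal.ofReal (volDensity f x u)
      ≤ ∫⁻ u in K, ENNReal.ofReal (volDensity f x u) := by
        refine lintegral_mono_set ?_
        rintro u ⟨hu1, hu2⟩
        have := hu1.2
        rw [Set.mem_preimage, (extChartAt (𝓡 m) x).right_inv hu2] at this
        exact interior_subset this
    _ ≤ ∫⁻ u in K, ENNReal.ofReal C :=
        setLIntegral_mono' hK.measurableSet fun u hu =>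
          ENNReal.ofReal_le_ofReal ((le_abs_self _).trans (hC u hu))
    _ < ⊤ := by
        rw [setLIntegral_const]
        exact ENNReal.mul_lt_top ENNReal.ofReal_lt_top hK.measure_lt_top

/-- The density ‖N‖ has no zeros in a chart. This is the source of strict positivity for volumes and
fluxes. -/
lemma IsImm.isOpenPosMeasure {f : M → Ambient m} (hf : IsImm f) :
    (volMeasure f).IsOpenPosMeasure := by
  refine ⟨fun U hU ⟨x, hx⟩ h0 => ?_⟩
  have hT := isOpen_extChartAt_target (I := 𝓡 m) x
  have hsymm := aemeasurable_chart_symm (m := m) x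
  have h1 : (volMeasure f).restrict (extChartAt (𝓡 m) x).source U = 0 :=
    nonpos_iff_eq_zero.1 ((Measure.restrict_apply_le _ _).trans h0.le)
  rw [hf.restrict_volMeasure, Measure.map_apply_of_aemeasurable
    (hsymm.mono_ac (withDensity_absolutelyContinuous _ _)) hU.measurableSet,
    withDensity_apply' _ _, Measure.restrict_restrict' hT.measurableSet, Set.inter_comm] at h1
  have hW : IsOpen ((extChartAt (𝓡 m) x).target ∩ (extChartAt (𝓡 m) x).symm ⁻¹' U) :=
    (continuousOn_extChartAt_symm x).isOpen_inter_preimage hT hU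
  have hne : ((extChartAt (𝓡 m) x).target ∩ (extChartAt (𝓡 m) x).symm ⁻¹' U).Nonempty :=
    ⟨extChartAt (𝓡 m) x x, mem_extChartAt_target x, by simpa using hx⟩
  rw [setLIntegral_eq_zero_iff' hW.measurableSet ((hf.aemeasurable_volDensity x).mono_measure
    (Measure.restrict_mono Set.inter_subset_left le_rfl))] at h1
  have h2 : volume ((extChartAt (𝓡 m) x).target ∩ (extChartAt (𝓡 m) x).symm ⁻¹' U) = 0 := by
    refine measure_eq_zero_iff_ae_notMem.2 ?_
    filter_upwards [h1] with u hcon hu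
    have := hcon hu
    rw [hf.volDensity_eq hu.1, ENNReal.ofReal_eq_zero] at this
    exact hf.normalVec_ne_zero hu.1 (norm_le_zero_iff.1 this)
  exact (hW.measure_pos volume hne).ne' h2

end Measure

/-! ### The divergence theorem on `M` -/

section Stokes

open MeasureTheory

variable {m : ℕ} {M : Type*} [TopologicalSpace M] [ChartedSpace (Model m) M]
  [IsManifold (𝓡 m) ∞ M]

lemma continuous_normalVec : Continuous (normalVec (m := m)) :=
  (contDiff_normalVec (n := 0)).continuous

lemma continuous_varForm :
    Continuous fun p : Ambient m × (Model m →L[ℝ] Ambient m) × (Model m →L[ℝ] Ambient m) =>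
      varForm p.1 p.2.1 p.2.2 :=
  (contDiff_varForm (n := 0)).continuous

lemma varForm_zero_right (y : Ambient m) (L : Model m →L[ℝ] Ambient m) : varForm y L 0 = 0 :=
  map_zero (AddMonoidHom.mk' (varForm y L) (varForm_add_right y L))

lemma varForm_zero_left (L K : Model m →L[ℝ] Ambient m) : varForm 0 L K = 0 :=
  map_zero (AddMonoidHom.mk' (fun y => varForm y L K) fun a b => varForm_add_left a b L K)

lemma IsImm.continuous_pairing {f Y h : M → Ambient m} (hf : IsImm f)
    (o : ManifoldOrientation m M) (hY : Continuous Y)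
    (hh : ContMDiff (𝓡 m) 𝓘(ℝ, Ambient m) ∞ h) : Continuous (pairing o f Y h) := by
  refine continuous_iff_continuousAt.2 fun c => ?_
  have hev : pairing o f Y h =ᶠ[nhds c] fun x =>
      orSign o c * ‖normalVec (fderiv ℝ (localRep f c) (extChartAt (𝓡 m) c x))‖⁻¹ *
        varForm (Y x) (fderiv ℝ (localRep f c) (extChartAt (𝓡 m) c x))
          (fderiv ℝ (localRep h c) (extChartAt (𝓡 m) c x)) := by
    filter_upwards [(isOpen_adapted o c).mem_nhds (mem_adapted o c)] with x hx
    exact pairing_eq_of_mem_adapted hf.1 hh hx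
  refine ContinuousAt.congr ?_ hev.symm
  have hmem := mem_extChartAt_target (I := 𝓡 m) c
  have hT := isOpen_extChartAt_target (I := 𝓡 m) c
  have hD : ∀ {g : M → Ambient m}, ContMDiff (𝓡 m) 𝓘(ℝ, Ambient m) ∞ g →
      ContinuousAt (fun x => fderiv ℝ (localRep g c) (extChartAt (𝓡 m) c x)) c := fun hg =>
    ContinuousAt.comp (g := fderiv ℝ (localRep _ c))
      (((contDiffOn_localRep hg c).continuousOn_fderiv_of_isOpen hT (by simp)).continuousAt
        (hT.mem_nhds hmem)) (continuousAt_extChartAt c)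
  set A : M → Model m →L[ℝ] Ambient m :=
    fun x => fderiv ℝ (localRep f c) (extChartAt (𝓡 m) c x) with hA
  set B : M → Model m →L[ℝ] Ambient m :=
    fun x => fderiv ℝ (localRep h c) (extChartAt (𝓡 m) c x) with hB
  have hAc : ContinuousAt A c := hD hf.1
  have hBc : ContinuousAt B c := hD hh
  have hN : ContinuousAt (fun x => normalVec (A x)) c :=
    continuous_normalVec.continuousAt.comp hAc
  have hN0 : ‖normalVec (A c)‖ ≠ 0 := norm_ne_zero_iff.2 (hf.normalVec_ne_zero hmem)
  have hV : ContinuousAt (fun x => varForm (Y x) (A x) (B x)) c :=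
    continuous_varForm.continuousAt.comp (f := fun x => (Y x, A x, B x))
      (hY.continuousAt.prodMk (hAc.prodMk hBc))
  exact (continuousAt_const.mul (hN.norm.inv₀ hN0)).mul hV

/-- A function supported in the domain of a chart, read in the chart and extended by zero. -/
def chartExt {F : Type*} [Zero F] (c : M) (h : M → F) : Model m → F :=
  (extChartAt (𝓡 m) c).target.indicator (h ∘ (extChartAt (𝓡 m) c).symm)

variable [T2Space M] [CompactSpace M]

lemma tsupport_chartExt {F : Type*} [Zero F] {c : M} {h : M → F}
    (hs : tsupport h ⊆ (extChartAt (𝓡 m) c).source) :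
    HasCompactSupport (chartExt (m := m) c h) ∧
      tsupport (chartExt (m := m) c h) ⊆ extChartAt (𝓡 m) c '' tsupport h := by
  have hK : IsCompact (extChartAt (𝓡 m) c '' tsupport h) :=
    (isClosed_tsupport h).isCompact.image_of_continuousOn ((continuousOn_extChartAt c).mono hs)
  have hsub : Function.support (chartExt (m := m) c h) ⊆ extChartAt (𝓡 m) c '' tsupport h := by
    intro u hu
    have huT : u ∈ (extChartAt (𝓡 m) c).target := by
      by_contra hcon
      exact hu (Set.indicator_of_notMem hcon _)
    refine ⟨(extChartAt (𝓡 m) c).symm u, subset_tsupport _ ?_, (extChartAt (𝓡 m) c).right_inv huT⟩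
    intro h0
    exact hu (by rw [chartExt, Set.indicator_of_mem huT]; exact h0)
  exact ⟨HasCompactSupport.of_support_subset_isCompact hK hsub, closure_minimal hsub hK.isClosed⟩

lemma chartExt_eqOn {F : Type*} [Zero F] (c : M) (h : M → F) :
    Set.EqOn (chartExt (m := m) c h) (h ∘ (extChartAt (𝓡 m) c).symm)
      (extChartAt (𝓡 m) c).target :=
  fun _ hu => Set.indicator_of_mem hu _

/-- The partition is subordinate to the adapted sets, not just to chart domains, because there ν and
`pairing` have chart formulas with a constant sign. -/
lemma exists_adapted_partition (o : ManifoldOrientation m M) :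
    ∃ (s : Finset M) (ρ : M → M → ℝ), (∀ c, ContMDiff (𝓡 m) 𝓘(ℝ, ℝ) ∞ (ρ c)) ∧
      (∀ c, tsupport (ρ c) ⊆ adapted o c) ∧ ∀ x, ∑ c ∈ s, ρ c x = 1 := by
  obtain ⟨ρ, hρ⟩ := SmoothPartitionOfUnity.exists_isSubordinate (𝓡 m) (isClosed_univ (X := M))
    (adapted o) (isOpen_adapted o) fun x _ => Set.mem_iUnion.2 ⟨x, mem_adapted o x⟩
  have hfin := ρ.locallyFinite.finite_nonempty_of_compact
  refine ⟨hfin.toFinset, fun c => ρ c, fun c => (ρ c).contMDiff, hρ, fun x => ?_⟩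
  have h := ρ.sum_eq_one (Set.mem_univ x)
  rwa [finsum_eq_sum_of_support_subset _ (s := hfin.toFinset)] at h
  intro c hc
  rw [Set.Finite.coe_toFinset]
  exact ⟨x, hc⟩

variable [MeasurableSpace M] [BorelSpace M]

lemma IsImm.integrable_of_continuous {f : M → Ambient m} (hf : IsImm f) {ξ : M → ℝ}
    (hξ : Continuous ξ) : Integrable ξ (volMeasure f) := by
  have := hf.isFiniteMeasure
  exact (BoundedContinuousFunction.mkOfCompact ⟨ξ, hξ⟩).integrable (volMeasure f)

lemma dAt_eq_zero {F : Type*} [NormedAddCommGroup F] [NormedSpace ℝ F] {h : M → F} {x : M}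
    (hx : x ∉ tsupport h) : dAt m h x = 0 := by
  have h0 : h ∘ (extChartAt (𝓡 m) x).symm =ᶠ[nhds (extChartAt (𝓡 m) x x)] fun _ => 0 := by
    have hev : h =ᶠ[nhds ((extChartAt (𝓡 m) x).symm (extChartAt (𝓡 m) x x))] 0 := by
      rw [extChartAt_to_inv]
      exact notMem_tsupport_iff_eventuallyEq.1 hx
    exact (continuousAt_extChartAt_symm x).eventually hev
  rw [dAt, h0.fderiv_eq, fderiv_fun_const]
  rfl

/-- In the chart at c the density ‖N‖ cancels the factor ‖N‖⁻¹ of the pairing and the sign is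
constant, which leaves the integral of a coordinate divergence. -/
lemma IsImm.integral_pairing_sub_of_tsupport {f Y h : M → Ambient m} (hf : IsImm f)
    (o : ManifoldOrientation m M) (hY : ContMDiff (𝓡 m) 𝓘(ℝ, Ambient m) ∞ Y)
    (hh : ContMDiff (𝓡 m) 𝓘(ℝ, Ambient m) ∞ h) {c : M} (hs : tsupport h ⊆ adapted o c) :
    ∫ x, (pairing o f Y h x - pairing o f h Y x) ∂(volMeasure f) = 0 := by
  have hT := isOpen_extChartAt_target (I := 𝓡 m) c
  have hs' : tsupport h ⊆ (extChartAt (𝓡 m) c).source := hs.trans (adapted_subset o c)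
  have hzero : ∀ x, x ∉ tsupport h → pairing o f Y h x - pairing o f h Y x = 0 := by
    intro x hx
    rw [pairing, pairing, dAt_eq_zero hx, image_eq_zero_of_notMem_tsupport hx, varForm_zero_right,
      varForm_zero_left]
    ring
  have hmeas : Measurable fun x => pairing o f Y h x - pairing o f h Y x :=
    ((hf.continuous_pairing o hY.continuous hh).sub
      (hf.continuous_pairing o hh.continuous hY)).measurable
  rw [← setIntegral_eq_integral_of_forall_compl_eq_zero
    (s := (extChartAt (𝓡 m) c).source) (fun x hx => hzero x fun h' => hx (hs' h')),
    hf.setIntegral_source c hmeas]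
  obtain ⟨hcs, hts⟩ := tsupport_chartExt hs'
  have hhc : ContDiffOn ℝ ∞ (chartExt c h) (extChartAt (𝓡 m) c).target :=
    (contDiffOn_localRep hh c).congr (chartExt_eqOn c h)
  have key := integral_varForm_sub_eq_zero hT (contDiffOn_localRep hf.1 c)
    (contDiffOn_localRep hY c) hhc hcs (hts.trans (by
      rintro _ ⟨x, hx, rfl⟩
      exact (extChartAt (𝓡 m) c).map_source (hs' hx)))
  -- Where the chart leaves the adapted set, h vanishes to first order and both sides are zero.
  have hmain : ∀ u ∈ (extChartAt (𝓡 m) c).target,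
      volDensity f c u * (pairing o f Y h ((extChartAt (𝓡 m) c).symm u) -
        pairing o f h Y ((extChartAt (𝓡 m) c).symm u)) =
      orSign o c * (varForm (localRep Y c u) (fderiv ℝ (localRep f c) u)
        (fderiv ℝ (chartExt c h) u) - varForm (chartExt c h u) (fderiv ℝ (localRep f c) u)
        (fderiv ℝ (localRep Y c) u)) := by
    intro u hu
    have hfd : fderiv ℝ (chartExt c h) u = fderiv ℝ (localRep h c) u :=
      ((chartExt_eqOn c h).eventuallyEq_of_mem (hT.mem_nhds hu)).fderiv_eq
    have hval : chartExt c h u = h ((extChartAt (𝓡 m) c).symm u) := chartExt_eqOn c h hu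
    by_cases hmem : (extChartAt (𝓡 m) c).symm u ∈ adapted o c
    · have hN := norm_ne_zero_iff.2 (hf.normalVec_ne_zero hu)
      rw [pairing_eq_of_mem_adapted hf.1 hh hmem, pairing_eq_of_mem_adapted hf.1 hY hmem,
        (extChartAt (𝓡 m) c).right_inv hu, hfd, hval, hf.volDensity_eq hu,
        show localRep Y c u = Y ((extChartAt (𝓡 m) c).symm u) from rfl]
      field_simp
    · have hnot : (extChartAt (𝓡 m) c).symm u ∉ tsupport h := fun h' => hmem (hs h')
      have hnot' : u ∉ tsupport (chartExt (m := m) c h) := by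
        intro h'
        obtain ⟨x, hx, rfl⟩ := hts h'
        rw [(extChartAt (𝓡 m) c).left_inv (hs' hx)] at hnot
        exact hnot hx
      have h3 : fderiv ℝ (chartExt (m := m) c h) u = 0 :=
        image_eq_zero_of_notMem_tsupport fun h' => hnot' (tsupport_fderiv_subset ℝ h')
      rw [hzero _ hnot, h3, image_eq_zero_of_notMem_tsupport hnot', varForm_zero_right,
        varForm_zero_left]
      ring
  rw [setIntegral_congr_fun hT.measurableSet hmain, integral_const_mul, key, mul_zero]

/-- The divergence theorem: the pairing is symmetric after integration. -/
theorem IsImm.integral_pairing_comm {f Y h : M → Ambient m} (hf : IsImm f)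
    (o : ManifoldOrientation m M) (hY : ContMDiff (𝓡 m) 𝓘(ℝ, Ambient m) ∞ Y)
    (hh : ContMDiff (𝓡 m) 𝓘(ℝ, Ambient m) ∞ h) :
    ∫ x, pairing o f Y h x ∂(volMeasure f) = ∫ x, pairing o f h Y x ∂(volMeasure f) := by
  obtain ⟨s, ρ, hρ, hsupp, hsum⟩ := exists_adapted_partition o
  have hi1 := hf.integrable_of_continuous (hf.continuous_pairing o hY.continuous hh)
  have hi2 := hf.integrable_of_continuous (hf.continuous_pairing o hh.continuous hY)
  rw [← sub_eq_zero, ← integral_sub hi1 hi2]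
  -- Only h has to be localized, since both pairings are additive in h.
  set k : M → M → Ambient m := fun c x => ρ c x • h x with hk
  have hks : ∀ c, ContMDiff (𝓡 m) 𝓘(ℝ, Ambient m) ∞ (k c) := fun c => (hρ c).smul hh
  have hkt : ∀ c, tsupport (k c) ⊆ adapted o c := fun c =>
    (closure_mono (Function.support_smul_subset_left (ρ c) h)).trans (hsupp c)
  have hsumk : h = fun x => ∑ c ∈ s, k c x := by
    funext x
    simp only [hk]
    rw [← Finset.sum_smul, hsum, one_smul]
  have hd : ∀ x, dAt m h x = ∑ c ∈ s, dAt m (k c) x := by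
    intro x
    have : h ∘ (extChartAt (𝓡 m) x).symm =
        fun u => ∑ c ∈ s, (k c ∘ (extChartAt (𝓡 m) x).symm) u := by
      funext u
      exact congrFun hsumk _
    rw [dAt, this, fderiv_fun_sum fun c _ =>
      differentiableAt_comp_chart_symm (hks c) x (mem_extChartAt_target x)]
    rfl
  have hright : ∀ (y : Ambient m) (L : Model m →L[ℝ] Ambient m)
      (K : M → Model m →L[ℝ] Ambient m),
      varForm y L (∑ c ∈ s, K c) = ∑ c ∈ s, varForm y L (K c) := fun y L K =>
    map_sum (AddMonoidHom.mk' (varForm y L) (varForm_add_right y L)) K s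
  have hleft : ∀ (y : M → Ambient m) (L K : Model m →L[ℝ] Ambient m),
      varForm (∑ c ∈ s, y c) L K = ∑ c ∈ s, varForm (y c) L K := fun y L K =>
    map_sum (AddMonoidHom.mk' (fun y => varForm y L K) fun a b => varForm_add_left a b L K) y s
  have hpt : ∀ x, pairing o f Y h x - pairing o f h Y x =
      ∑ c ∈ s, (pairing o f Y (k c) x - pairing o f (k c) Y x) := by
    intro x
    rw [Finset.sum_sub_distrib]
    congr 1
    · simp only [pairing]
      rw [hd, hright, Finset.mul_sum]
    · simp only [pairing]
      rw [congrFun hsumk x, hleft, Finset.mul_sum]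
  simp only [hpt]
  rw [integral_finsetSum]
  · exact Finset.sum_eq_zero fun c _ =>
      hf.integral_pairing_sub_of_tsupport o hY (hks c) (hkt c)
  · intro c _
    exact (hf.integrable_of_continuous (hf.continuous_pairing o hY.continuous (hks c))).sub
      (hf.integrable_of_continuous (hf.continuous_pairing o (hks c).continuous hY))

end Stokes

/-! ### Differentiation under the integral sign -/

section Parametric

open MeasureTheory

/-- The compactly supported weight makes it harmless that p is controlled only over T: off the
support of w, the product is locally zero. -/
lemma continuousOn_setIntegral_mul {E : Type*} [NormedAddCommGroup E]
    [NormedSpace ℝ E] [FiniteDimensional ℝ E] [MeasurableSpace E] [BorelSpace E] (μ : Measure E)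
    [IsFiniteMeasureOnCompacts μ] {T : Set E} (hT : IsOpen T) {w : E → ℝ} (hw : Continuous w)
    (hwc : HasCompactSupport w) (hwT : tsupport w ⊆ T) {p : ℝ → E → ℝ} {S : Set ℝ}
    (hp : ContinuousOn (fun q : ℝ × E => p q.1 q.2) (S ×ˢ T)) :
    ContinuousOn (fun t => ∫ u in T, w u * p t u ∂μ) S := by
  have h1 : ∀ t, ∫ u in T, w u * p t u ∂μ = ∫ u, w u * p t u ∂μ := fun t =>
    setIntegral_eq_integral_of_forall_compl_eq_zero fun u hu => by
      rw [image_eq_zero_of_notMem_tsupport fun h => hu (hwT h), zero_mul]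
  simp only [h1]
  refine continuousOn_integral_of_compact_support (k := tsupport w) hwc ?_ fun t u _ hu => by
    rw [image_eq_zero_of_notMem_tsupport hu, zero_mul]
  rintro ⟨t, u⟩ ⟨ht, -⟩
  by_cases hu : u ∈ T
  · have h2 : ContinuousWithinAt (fun q : ℝ × E => w q.2 * p q.1 q.2) (S ×ˢ T) (t, u) :=
      (hw.comp continuous_snd).continuousWithinAt.mul (hp (t, u) ⟨ht, hu⟩)
    refine h2.mono_of_mem_nhdsWithin ?_
    have h3 : (Prod.snd ⁻¹' T : Set (ℝ × E)) ∈ nhds (t, u) :=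
      (hT.preimage continuous_snd).mem_nhds hu
    filter_upwards [mem_nhdsWithin_of_mem_nhds h3, self_mem_nhdsWithin] with q hq1 hq2
    exact ⟨hq2.1, hq1⟩
  · have h3 : ∀ᶠ q : ℝ × E in nhds (t, u), w q.2 * p q.1 q.2 = 0 := by
      have h4 : (Prod.snd ⁻¹' (tsupport w)ᶜ : Set (ℝ × E)) ∈ nhds (t, u) :=
        ((isClosed_tsupport w).isOpen_compl.preimage continuous_snd).mem_nhds
          fun h => hu (hwT h)
      filter_upwards [h4] with q hq
      rw [image_eq_zero_of_notMem_tsupport hq, zero_mul]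
    have h5 : ContinuousAt (fun q : ℝ × E => w q.2 * p q.1 q.2) (t, u) :=
      (continuousAt_const (y := (0 : ℝ))).congr
        (h3.mono fun q hq => hq.symm)
    exact h5.continuousWithinAt

lemma hasDerivAt_setIntegral_mul {E : Type*} [NormedAddCommGroup E]
    [NormedSpace ℝ E] [FiniteDimensional ℝ E] [MeasurableSpace E] [BorelSpace E] (μ : Measure E)
    [IsFiniteMeasureOnCompacts μ] {T : Set E} (hT : IsOpen T) {w : E → ℝ} (hw : Continuous w)
    (hwc : HasCompactSupport w) (hwT : tsupport w ⊆ T) {p p' : ℝ → E → ℝ} {S : Set ℝ}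
    (hS : IsOpen S) (hp : ContDiffOn ℝ 1 (fun q : ℝ × E => p q.1 q.2) (S ×ˢ T))
    (hp' : ∀ t ∈ S, ∀ u ∈ T, HasDerivAt (fun s => p s u) (p' t u) t) {t : ℝ} (ht : t ∈ S) :
    HasDerivAt (fun t => ∫ u in T, w u * p t u ∂μ) (∫ u in T, w u * p' t u ∂μ) t := by
  have hK : ∀ g : E → ℝ, ∫ u in T, w u * g u ∂μ = ∫ u in tsupport w, w u * g u ∂μ := fun g =>
    (setIntegral_eq_of_subset_of_forall_sdiff_eq_zero hT.measurableSet hwT fun u hu => by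
      rw [image_eq_zero_of_notMem_tsupport hu.2, zero_mul])
  simp only [hK]
  have hKm : MeasurableSet (tsupport w) := (isClosed_tsupport w).measurableSet
  obtain ⟨ε, hε, hball⟩ := Metric.nhds_basis_closedBall.mem_iff.1 (hS.mem_nhds ht)
  have hST : IsOpen (S ×ˢ T) := hS.prod hT
  have hcont' : ContinuousOn (fun q : ℝ × E => p' q.1 q.2) (S ×ˢ T) := by
    have h1 : ContinuousOn (fun q => fderiv ℝ (fun q : ℝ × E => p q.1 q.2) q (1, 0)) (S ×ˢ T) :=
      (hp.continuousOn_fderiv_of_isOpen hST (by simp)).clm_apply continuousOn_const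
    refine h1.congr ?_
    rintro ⟨s, u⟩ ⟨hs, hu⟩
    have h2 := ((hp.contDiffAt (hST.mem_nhds ⟨hs, hu⟩)).differentiableAt
      (by simp)).hasFDerivAt
    have h3 : HasDerivAt (fun s : ℝ => (s, u)) ((1 : ℝ), (0 : E)) s :=
      (hasDerivAt_id s).prodMk (hasDerivAt_const s u)
    exact (hp' s hs u hu).unique (HasFDerivAt.comp_hasDerivAt (f := fun s : ℝ => (s, u)) s h2 h3)
  have hsl : ∀ {g : ℝ → E → ℝ}, ContinuousOn (fun q : ℝ × E => g q.1 q.2) (S ×ˢ T) → ∀ s ∈ S,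
      ContinuousOn (fun u => w u * g s u) (tsupport w) := fun hg s hs =>
    hw.continuousOn.mul (hg.comp (f := fun u : E => (s, u)) (by fun_prop)
      fun u hu => ⟨hs, hwT hu⟩)
  -- The dominating constant: w p' is bounded on a compact time interval times the support of w.
  obtain ⟨C, hC⟩ := ((isCompact_closedBall t ε).prod hwc).exists_bound_of_continuousOn
    (f := fun q : ℝ × E => w q.2 * p' q.1 q.2)
    ((hw.comp continuous_snd).continuousOn.mul
      (hcont'.mono (Set.prod_mono hball hwT)))
  have hfin : IsFiniteMeasure (μ.restrict (tsupport w)) :=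
    ⟨by rw [Measure.restrict_apply_univ]; exact hwc.measure_lt_top⟩
  refine (hasDerivAt_integral_of_dominated_loc_of_deriv_le (bound := fun _ => C)
    (F' := fun s u => w u * p' s u) (Metric.closedBall_mem_nhds t hε) ?_ ?_ ?_ ?_ ?_ ?_).2
  · filter_upwards [hS.mem_nhds ht] with s hs
    exact (hsl hp.continuousOn s hs).aestronglyMeasurable hKm
  · exact (hsl hp.continuousOn t ht).integrableOn_compact hwc
  · exact (hsl hcont' t ht).aestronglyMeasurable hKm
  · refine (ae_restrict_iff' hKm).2 (Filter.Eventually.of_forall fun u hu s hs => ?_)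
    exact hC (s, u) ⟨hs, hu⟩
  · exact integrable_const C
  · refine (ae_restrict_iff' hKm).2 (Filter.Eventually.of_forall fun u hu s hs => ?_)
    exact (hp' s (hball hs) u (hwT hu)).const_mul (w u)

end Parametric

/-! ### Integrals along a family of immersions -/

section Family

open MeasureTheory

variable {m : ℕ} {M : Type*} [TopologicalSpace M] [ChartedSpace (Model m) M]
  [IsManifold (𝓡 m) ∞ M] [T2Space M] [CompactSpace M] [MeasurableSpace M] [BorelSpace M]

lemma IsImm.integral_eq_sum {f : M → Ambient m} (hf : IsImm f) {s : Finset M} {ρ : M → M → ℝ}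
    (hρ : ∀ c, Continuous (ρ c)) (hsupp : ∀ c, tsupport (ρ c) ⊆ (extChartAt (𝓡 m) c).source)
    (hsum : ∀ x, ∑ c ∈ s, ρ c x = 1) {ξ : M → ℝ} (hξ : Continuous ξ) :
    ∫ x, ξ x ∂(volMeasure f) = ∑ c ∈ s, ∫ u in (extChartAt (𝓡 m) c).target,
      chartExt (m := m) c (ρ c) u *
        (volDensity f c u * ξ ((extChartAt (𝓡 m) c).symm u)) := by
  have h1 : ∀ x, ξ x = ∑ c ∈ s, ρ c x * ξ x := fun x => by rw [← Finset.sum_mul, hsum, one_mul]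
  have hc : ∀ c, Continuous fun x => ρ c x * ξ x := fun c => (hρ c).mul hξ
  rw [integral_congr_ae (Filter.Eventually.of_forall h1),
    integral_finsetSum _ fun c _ => hf.integrable_of_continuous (hc c)]
  refine Finset.sum_congr rfl fun c _ => ?_
  rw [← setIntegral_eq_integral_of_forall_compl_eq_zero (s := (extChartAt (𝓡 m) c).source)
    (fun x hx => by rw [image_eq_zero_of_notMem_tsupport fun h => hx (hsupp c h), zero_mul]),
    hf.setIntegral_source c (hc c).measurable]
  refine setIntegral_congr_fun (isOpen_extChartAt_target c).measurableSet fun u hu => ?_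
  simp only [chartExt_eqOn c (ρ c) hu, Function.comp_apply]
  ring

lemma continuous_chartExt {c : M} {h : M → ℝ} (hh : Continuous h)
    (hs : tsupport h ⊆ (extChartAt (𝓡 m) c).source) : Continuous (chartExt (m := m) c h) := by
  obtain ⟨-, hts⟩ := tsupport_chartExt hs
  refine continuous_of_tsupport fun u hu => ?_
  obtain ⟨x, hx, rfl⟩ := hts hu
  have hmem := (extChartAt (𝓡 m) c).map_source (hs hx)
  have hT := (isOpen_extChartAt_target (I := 𝓡 m) c).mem_nhds hmem
  refine ContinuousAt.congr ?_ ((chartExt_eqOn c h).eventuallyEq_of_mem hT).symm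
  exact hh.continuousAt.comp ((continuousOn_extChartAt_symm c).continuousAt hT)

/-- Differentiation of an integral with respect to the volume of a family of immersions, when the
integrand times the density is given in each chart by a smooth function of time and space. -/
lemma continuousOn_and_hasDerivAt_integral (o : ManifoldOrientation m M) {f : ℝ → M → Ambient m}
    (hf : ∀ t ∈ Set.Icc (0 : ℝ) 1, IsImm (f t)) {ξ η : ℝ → M → ℝ}
    (hξ : ∀ t ∈ Set.Icc (0 : ℝ) 1, Continuous (ξ t))
    (hη : ∀ t ∈ Set.Ioo (0 : ℝ) 1, Continuous (η t)) (p p' : M → ℝ → Model m → ℝ)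
    (hpξ : ∀ c, ∀ t ∈ Set.Icc (0 : ℝ) 1, ∀ x ∈ adapted o c,
      volDensity (f t) c (extChartAt (𝓡 m) c x) * ξ t x = p c t (extChartAt (𝓡 m) c x))
    (hpη : ∀ c, ∀ t ∈ Set.Ioo (0 : ℝ) 1, ∀ x ∈ adapted o c,
      volDensity (f t) c (extChartAt (𝓡 m) c x) * η t x = p' c t (extChartAt (𝓡 m) c x))
    (hpc : ∀ c, ContinuousOn (fun q : ℝ × Model m => p c q.1 q.2)
      (Set.Icc 0 1 ×ˢ (extChartAt (𝓡 m) c).target))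
    (hpd : ∀ c, ContDiffOn ℝ 1 (fun q : ℝ × Model m => p c q.1 q.2)
      (Set.Ioo 0 1 ×ˢ (extChartAt (𝓡 m) c).target))
    (hp' : ∀ c, ∀ t ∈ Set.Ioo (0 : ℝ) 1, ∀ u ∈ (extChartAt (𝓡 m) c).target,
      HasDerivAt (fun s => p c s u) (p' c t u) t) :
    ContinuousOn (fun t => ∫ x, ξ t x ∂(volMeasure (f t))) (Set.Icc 0 1) ∧
      ∀ t ∈ Set.Ioo (0 : ℝ) 1, HasDerivAt (fun t => ∫ x, ξ t x ∂(volMeasure (f t)))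
        (∫ x, η t x ∂(volMeasure (f t))) t := by
  obtain ⟨s, ρ, hρ, hsupp, hsum⟩ := exists_adapted_partition o
  have hsupp' : ∀ c, tsupport (ρ c) ⊆ (extChartAt (𝓡 m) c).source := fun c =>
    (hsupp c).trans (adapted_subset o c)
  have hρc : ∀ c, Continuous (ρ c) := fun c => (hρ c).continuous
  have hT : ∀ c : M, IsOpen (extChartAt (𝓡 m) c).target := fun c => isOpen_extChartAt_target c
  have hwt : ∀ c, tsupport (chartExt (m := m) c (ρ c)) ⊆ (extChartAt (𝓡 m) c).target := by
    intro c u hu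
    obtain ⟨x, hx, rfl⟩ := (tsupport_chartExt (hsupp' c)).2 hu
    exact (extChartAt (𝓡 m) c).map_source (hsupp' c hx)
  -- Time enters only through r, since the weights and chart domains are fixed. The formula for r is
  -- needed only on the adapted sets, outside which the weight vanishes.
  have key : ∀ {t : ℝ} {ζ : M → ℝ} {r : M → Model m → ℝ}, t ∈ Set.Icc (0 : ℝ) 1 → Continuous ζ →
      (∀ c, ∀ x ∈ adapted o c,
        volDensity (f t) c (extChartAt (𝓡 m) c x) * ζ x = r c (extChartAt (𝓡 m) c x)) →
      ∫ x, ζ x ∂(volMeasure (f t)) = ∑ c ∈ s, ∫ u in (extChartAt (𝓡 m) c).target,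
        chartExt (m := m) c (ρ c) u * r c u := by
    intro t ζ r ht hζ hr
    rw [(hf t ht).integral_eq_sum hρc hsupp' hsum hζ]
    refine Finset.sum_congr rfl fun c _ => ?_
    refine setIntegral_congr_fun (hT c).measurableSet fun u hu => ?_
    by_cases hmem : (extChartAt (𝓡 m) c).symm u ∈ adapted o c
    · have := hr c _ hmem
      rw [(extChartAt (𝓡 m) c).right_inv hu] at this
      simp only [this]
    · have h0 : chartExt (m := m) c (ρ c) u = 0 := by
        rw [chartExt_eqOn c (ρ c) hu]
        exact image_eq_zero_of_notMem_tsupport (f := ρ c) fun h => hmem (hsupp c h)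
      simp only [h0, zero_mul]
  have hIoo : Set.Ioo (0 : ℝ) 1 ⊆ Set.Icc 0 1 := Set.Ioo_subset_Icc_self
  constructor
  · have h1 : ContinuousOn (fun t => ∑ c ∈ s, ∫ u in (extChartAt (𝓡 m) c).target,
        chartExt (m := m) c (ρ c) u * p c t u) (Set.Icc 0 1) :=
      continuousOn_finsetSum _ fun c _ =>
        continuousOn_setIntegral_mul volume (hT c) (continuous_chartExt (hρc c) (hsupp' c))
          (tsupport_chartExt (hsupp' c)).1 (hwt c) (hpc c)
    exact h1.congr fun t ht => key ht (hξ t ht) fun c => hpξ c t ht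
  · intro t ht
    have h1 : HasDerivAt (fun t => ∑ c ∈ s, ∫ u in (extChartAt (𝓡 m) c).target,
        chartExt (m := m) c (ρ c) u * p c t u) (∑ c ∈ s, ∫ u in (extChartAt (𝓡 m) c).target,
        chartExt (m := m) c (ρ c) u * p' c t u) t :=
      HasDerivAt.fun_sum fun c _ =>
        hasDerivAt_setIntegral_mul volume (hT c) (continuous_chartExt (hρc c) (hsupp' c))
          (tsupport_chartExt (hsupp' c)).1 (hwt c) isOpen_Ioo (hpd c) (hp' c) ht
    rw [← key (hIoo ht) (hη t ht) fun c => hpη c t ht] at h1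
    refine h1.congr_of_eventuallyEq ?_
    filter_upwards [isOpen_Ioo.mem_nhds ht] with r hr
    exact key (hIoo hr) (hξ r (hIoo hr)) fun c => hpξ c r (hIoo hr)

end Family

/-! ### Paths of immersions in charts -/

section Paths

open MeasureTheory

variable {m : ℕ} {M : Type*} [TopologicalSpace M] [ChartedSpace (Model m) M]
  [IsManifold (𝓡 m) ∞ M]

namespace ImmPath

lemma isImm (γ : ImmPath m M) {t : ℝ} (ht : t ∈ Set.Icc (0 : ℝ) 1) : IsImm (γ.toFun t) :=
  γ.immersion t ht

/-- A path in the chart around `c`, as a function of time and space. -/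
def rep (γ : ImmPath m M) (c : M) (q : ℝ × Model m) : Ambient m := localRep (γ.toFun q.1) c q.2

lemma contDiffOn_rep (γ : ImmPath m M) (c : M) :
    ContDiffOn ℝ ∞ (γ.rep c) (Set.Icc 0 1 ×ˢ (extChartAt (𝓡 m) c).target) := by
  have h1 : ContMDiffOn 𝓘(ℝ, ℝ × Model m) 𝓘(ℝ, ℝ) ∞ (fun q : ℝ × Model m => q.1)
      (Set.Icc 0 1 ×ˢ (extChartAt (𝓡 m) c).target) := contDiff_fst.contMDiff.contMDiffOn
  have h2 : ContMDiffOn 𝓘(ℝ, ℝ × Model m) (𝓡 m) ∞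
      (fun q : ℝ × Model m => (extChartAt (𝓡 m) c).symm q.2)
      (Set.Icc 0 1 ×ˢ (extChartAt (𝓡 m) c).target) :=
    (contMDiffOn_extChartAt_symm (I := 𝓡 m) (n := ∞) c).comp
      (contDiff_snd.contMDiff.contMDiffOn) fun q hq => hq.2
  have h3 := γ.smooth.comp (h1.prodMk h2) fun q hq => ⟨hq.1, Set.mem_univ _⟩
  exact h3.contDiffOn

lemma contDiffOn_rep_Ioo (γ : ImmPath m M) (c : M) :
    ContDiffOn ℝ ∞ (γ.rep c) (Set.Ioo 0 1 ×ˢ (extChartAt (𝓡 m) c).target) :=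
  (γ.contDiffOn_rep c).mono (Set.prod_mono Set.Ioo_subset_Icc_self subset_rfl)

lemma isOpen_Ioo_prod (c : M) :
    IsOpen (Set.Ioo (0 : ℝ) 1 ×ˢ (extChartAt (𝓡 m) c).target) :=
  isOpen_Ioo.prod (isOpen_extChartAt_target c)

lemma hasFDerivAt_slice (t : ℝ) (u : Model m) :
    HasFDerivAt (fun v : Model m => (t, v)) (ContinuousLinearMap.inr ℝ ℝ (Model m)) u :=
  (hasFDerivAt_const t u).prodMk (hasFDerivAt_id u)

/-- At the end times the path is smooth only from one side, hence `fderivWithin`; the spatial slice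
is open, so its derivative is a genuine one. This gives continuity of df up to t = 0 and t = 1. -/
lemma fderiv_localRep (γ : ImmPath m M) (c : M) {t : ℝ} (ht : t ∈ Set.Icc (0 : ℝ) 1)
    {u : Model m} (hu : u ∈ (extChartAt (𝓡 m) c).target) :
    fderiv ℝ (localRep (γ.toFun t) c) u =
      fderivWithin ℝ (γ.rep c) (Set.Icc 0 1 ×ˢ (extChartAt (𝓡 m) c).target) (t, u) ∘L
        ContinuousLinearMap.inr ℝ ℝ (Model m) := by
  have h1 := ((γ.contDiffOn_rep c).differentiableOn (by simp) (t, u) ⟨ht, hu⟩).hasFDerivWithinAt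
  have h2 := h1.comp (f := fun v : Model m => (t, v)) (s := (extChartAt (𝓡 m) c).target) u
    (hasFDerivAt_slice t u).hasFDerivWithinAt fun v hv => ⟨ht, hv⟩
  exact (h2.hasFDerivAt ((isOpen_extChartAt_target c).mem_nhds hu)).fderiv

lemma continuousOn_fderiv_localRep (γ : ImmPath m M) (c : M) :
    ContinuousOn (fun q : ℝ × Model m => fderiv ℝ (localRep (γ.toFun q.1) c) q.2)
      (Set.Icc 0 1 ×ˢ (extChartAt (𝓡 m) c).target) := by
  have h1 := (γ.contDiffOn_rep c).continuousOn_fderivWithin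
    ((uniqueDiffOn_Icc zero_lt_one).prod (isOpen_extChartAt_target c).uniqueDiffOn) (by simp)
  exact (h1.clm_comp continuousOn_const).congr fun q hq => γ.fderiv_localRep c hq.1 hq.2

lemma fderiv_localRep_Ioo (γ : ImmPath m M) (c : M) {q : ℝ × Model m}
    (hq : q ∈ Set.Ioo (0 : ℝ) 1 ×ˢ (extChartAt (𝓡 m) c).target) :
    fderiv ℝ (localRep (γ.toFun q.1) c) q.2 =
      fderiv ℝ (γ.rep c) q ∘L ContinuousLinearMap.inr ℝ ℝ (Model m) := by
  have h1 := (((γ.contDiffOn_rep_Ioo c).contDiffAt ((isOpen_Ioo_prod c).mem_nhds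
    hq)).differentiableAt (by simp)).hasFDerivAt
  exact (h1.comp (f := fun v : Model m => (q.1, v)) q.2 (hasFDerivAt_slice q.1 q.2)).fderiv

lemma contDiffOn_fderiv_localRep (γ : ImmPath m M) (c : M) :
    ContDiffOn ℝ ∞ (fun q : ℝ × Model m => fderiv ℝ (localRep (γ.toFun q.1) c) q.2)
      (Set.Ioo 0 1 ×ˢ (extChartAt (𝓡 m) c).target) := by
  have h1 : ContDiffOn ℝ ∞ (fderiv ℝ (γ.rep c))
      (Set.Ioo 0 1 ×ˢ (extChartAt (𝓡 m) c).target) :=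
    (γ.contDiffOn_rep_Ioo c).fderiv_of_isOpen (isOpen_Ioo_prod c) (by simp)
  exact (h1.clm_comp contDiffOn_const).congr fun q hq => γ.fderiv_localRep_Ioo c hq

lemma hasDerivAt_rep (γ : ImmPath m M) (c : M) {t : ℝ} (ht : t ∈ Set.Ioo (0 : ℝ) 1)
    {u : Model m} (hu : u ∈ (extChartAt (𝓡 m) c).target) :
    HasDerivAt (fun s => γ.rep c (s, u)) (fderiv ℝ (γ.rep c) (t, u) (1, 0)) t := by
  have hmem := (isOpen_Ioo_prod c).mem_nhds
    (show (t, u) ∈ Set.Ioo (0 : ℝ) 1 ×ˢ (extChartAt (𝓡 m) c).target from ⟨ht, hu⟩)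
  have h1 := (((γ.contDiffOn_rep_Ioo c).contDiffAt hmem).differentiableAt (by simp)).hasFDerivAt
  exact HasFDerivAt.comp_hasDerivAt (f := fun s : ℝ => (s, u)) t h1
    ((hasDerivAt_id t).prodMk (hasDerivAt_const t u))

/-- At interior times the one-sided derivative in `velocity` is the ordinary one. The two end times
matter neither for lengths nor for the fundamental theorem of calculus. -/
lemma velocity_chart (γ : ImmPath m M) (c : M) {t : ℝ} (ht : t ∈ Set.Ioo (0 : ℝ) 1)
    {u : Model m} (hu : u ∈ (extChartAt (𝓡 m) c).target) :
    localRep (γ.velocity t) c u = fderiv ℝ (γ.rep c) (t, u) (1, 0) := by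
  have h : HasDerivAt (fun s => γ.toFun s ((extChartAt (𝓡 m) c).symm u))
      (fderiv ℝ (γ.rep c) (t, u) (1, 0)) t := γ.hasDerivAt_rep c ht hu
  simp only [localRep, Function.comp_apply, velocity]
  rw [derivWithin_of_mem_nhds (Icc_mem_nhds ht.1 ht.2), h.deriv]

lemma contDiffOn_velocity_chart (γ : ImmPath m M) (c : M) {t : ℝ} (ht : t ∈ Set.Ioo (0 : ℝ) 1) :
    ContDiffOn ℝ ∞ (localRep (γ.velocity t) c) (extChartAt (𝓡 m) c).target := by
  have h1 : ContDiffOn ℝ ∞ (fderiv ℝ (γ.rep c))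
      (Set.Ioo 0 1 ×ˢ (extChartAt (𝓡 m) c).target) :=
    (γ.contDiffOn_rep_Ioo c).fderiv_of_isOpen (isOpen_Ioo_prod c) (by simp)
  have h2 : ContDiffOn ℝ ∞ (fun u => fderiv ℝ (γ.rep c) (t, u) (1, 0))
      (extChartAt (𝓡 m) c).target :=
    (h1.comp (f := fun u : Model m => (t, u)) (contDiff_const.prodMk contDiff_id).contDiffOn
      fun u hu => ⟨ht, hu⟩).clm_apply contDiffOn_const
  exact h2.congr fun u hu => γ.velocity_chart c ht hu

lemma contMDiff_velocity (γ : ImmPath m M) {t : ℝ} (ht : t ∈ Set.Ioo (0 : ℝ) 1) :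
    ContMDiff (𝓡 m) 𝓘(ℝ, Ambient m) ∞ (γ.velocity t) := by
  intro c
  have hev : γ.velocity t =ᶠ[nhds c] localRep (γ.velocity t) c ∘ extChartAt (𝓡 m) c := by
    filter_upwards [extChartAt_source_mem_nhds (I := 𝓡 m) c] with x hx
    simp only [localRep, Function.comp_apply]
    rw [(extChartAt (𝓡 m) c).left_inv hx]
  refine ContMDiffAt.congr_of_eventuallyEq ?_ hev
  exact (((γ.contDiffOn_velocity_chart c ht).contDiffAt ((isOpen_extChartAt_target c).mem_nhds
    (mem_extChartAt_target c))).contMDiffAt).comp c contMDiffAt_extChartAt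

/-- Time and space derivatives commute, by symmetry of the second derivative of the path as a joint
function of both. -/
lemma hasDerivAt_fderiv_localRep (γ : ImmPath m M) (c : M) {t : ℝ} (ht : t ∈ Set.Ioo (0 : ℝ) 1)
    {u : Model m} (hu : u ∈ (extChartAt (𝓡 m) c).target) :
    HasDerivAt (fun s => fderiv ℝ (localRep (γ.toFun s) c) u)
      (fderiv ℝ (localRep (γ.velocity t) c) u) t := by
  have hmem := (isOpen_Ioo_prod c).mem_nhds
    (show (t, u) ∈ Set.Ioo (0 : ℝ) 1 ×ˢ (extChartAt (𝓡 m) c).target from ⟨ht, hu⟩)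
  have hC := (γ.contDiffOn_rep_Ioo c).contDiffAt hmem
  have hsymm : IsSymmSndFDerivAt ℝ (γ.rep c) (t, u) := hC.isSymmSndFDerivAt (by
    rw [minSmoothness_of_isRCLikeNormedField]
    exact WithTop.coe_le_coe.2 (le_top : (2 : ℕ∞) ≤ ⊤))
  have h1 : ContDiffOn ℝ ∞ (fderiv ℝ (γ.rep c))
      (Set.Ioo 0 1 ×ˢ (extChartAt (𝓡 m) c).target) :=
    (γ.contDiffOn_rep_Ioo c).fderiv_of_isOpen (isOpen_Ioo_prod c) (by simp)
  have hD := ((h1.contDiffAt hmem).differentiableAt (by simp)).hasFDerivAt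
  set D := fderiv ℝ (fderiv ℝ (γ.rep c)) (t, u) with hDdef
  have h2 : HasDerivAt (fun s => fderiv ℝ (γ.rep c) (s, u)) (D (1, 0)) t :=
    HasFDerivAt.comp_hasDerivAt (f := fun s : ℝ => (s, u)) t hD
      ((hasDerivAt_id t).prodMk (hasDerivAt_const t u))
  have h3 : HasDerivAt (fun s => fderiv ℝ (γ.rep c) (s, u) ∘L
      ContinuousLinearMap.inr ℝ ℝ (Model m)) (D (1, 0) ∘L ContinuousLinearMap.inr ℝ ℝ (Model m)) t :=
    by simpa using h2.clm_comp (hasDerivAt_const t (ContinuousLinearMap.inr ℝ ℝ (Model m)))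
  have h4 : HasFDerivAt (fun v => fderiv ℝ (γ.rep c) (t, v) (1, 0))
      ((ContinuousLinearMap.apply ℝ (Ambient m) ((1 : ℝ), (0 : Model m))) ∘L
        (D ∘L ContinuousLinearMap.inr ℝ ℝ (Model m))) u :=
    ((ContinuousLinearMap.apply ℝ (Ambient m) ((1 : ℝ), (0 : Model m))).hasFDerivAt).comp u
      (hD.comp (f := fun v : Model m => (t, v)) u (hasFDerivAt_slice t u))
  have h5 : fderiv ℝ (localRep (γ.velocity t) c) u =
      D (1, 0) ∘L ContinuousLinearMap.inr ℝ ℝ (Model m) := by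
    have hev : localRep (γ.velocity t) c =ᶠ[nhds u]
        fun v => fderiv ℝ (γ.rep c) (t, v) (1, 0) := by
      filter_upwards [(isOpen_extChartAt_target c).mem_nhds hu] with v hv
      exact γ.velocity_chart c ht hv
    rw [hev.fderiv_eq, h4.fderiv]
    ext1 e
    exact hsymm _ _
  rw [h5]
  refine h3.congr_of_eventuallyEq ?_
  filter_upwards [isOpen_Ioo.mem_nhds ht] with s hs
  exact γ.fderiv_localRep_Ioo c (q := (s, u)) ⟨hs, hu⟩

end ImmPath

/-! ### The first variation of the volume and of the flux -/

variable [T2Space M] [CompactSpace M] [MeasurableSpace M] [BorelSpace M]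

/-- The first variation of the volume. -/
theorem ImmPath.totalVol_variation (γ : ImmPath m M) (o : ManifoldOrientation m M) :
    ContinuousOn (fun t => totalVol (γ.toFun t)) (Set.Icc 0 1) ∧
      ∀ t ∈ Set.Ioo (0 : ℝ) 1, HasDerivAt (fun t => totalVol (γ.toFun t))
        (-∫ x, meanCurvature o (γ.toFun t) x *
          inner ℝ (γ.velocity t x) (unitNormal o (γ.toFun t) x) ∂(volMeasure (γ.toFun t))) t := by
  have hIoo : Set.Ioo (0 : ℝ) 1 ⊆ Set.Icc 0 1 := Set.Ioo_subset_Icc_self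
  have key := continuousOn_and_hasDerivAt_integral o (f := γ.toFun) (fun t ht => γ.isImm ht)
    (ξ := fun _ _ => 1)
    (η := fun t => pairing o (γ.toFun t) (unitNormal o (γ.toFun t)) (γ.velocity t))
    (fun t _ => continuous_const)
    (fun t ht => (γ.isImm (hIoo ht)).continuous_pairing o
      ((γ.isImm (hIoo ht)).contMDiff_unitNormal o).continuous (γ.contMDiff_velocity ht))
    (fun c t u => ‖normalVec (fderiv ℝ (localRep (γ.toFun t) c) u)‖)
    (fun c t u => ‖normalVec (fderiv ℝ (localRep (γ.toFun t) c) u)‖⁻¹ *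
      varForm (normalVec (fderiv ℝ (localRep (γ.toFun t) c) u))
        (fderiv ℝ (localRep (γ.toFun t) c) u) (fderiv ℝ (localRep (γ.velocity t) c) u))
    ?_ ?_ ?_ ?_ ?_
  · simp only [integral_const, smul_eq_mul, mul_one] at key
    refine ⟨key.1, fun t ht => ?_⟩
    have hf := γ.isImm (hIoo ht)
    refine (key.2 t ht).congr_deriv ?_
    -- The swap moves the derivative from the velocity to ν, where it is the Weingarten map.
    rw [hf.integral_pairing_comm o (hf.contMDiff_unitNormal o) (γ.contMDiff_velocity ht),
      ← integral_neg]
    exact integral_congr_ae (Filter.Eventually.of_forall fun x => hf.pairing_unitNormal o _ x)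
  · intro c t ht x hx
    rw [(γ.isImm ht).volDensity_eq ((extChartAt (𝓡 m) c).map_source (adapted_subset o c hx)),
      mul_one]
  · intro c t ht x hx
    have hf := γ.isImm (hIoo ht)
    have hu := (extChartAt (𝓡 m) c).map_source (adapted_subset o c hx)
    have hN := norm_ne_zero_iff.2 (hf.normalVec_ne_zero hu)
    rw [hf.volDensity_eq hu, pairing_eq_of_mem_adapted hf.1 (γ.contMDiff_velocity ht) hx,
      unitNormal_eq_of_mem_adapted hf.1 hx, varForm_smul_left]
    have ho := orSign_mul_self o c
    field_simp
    linear_combination (varForm (normalVec (fderiv ℝ (localRep (γ.toFun t) c) _)) _ _) * ho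
  · intro c
    exact (continuous_normalVec.comp_continuousOn (γ.continuousOn_fderiv_localRep c)).norm
  · intro c
    refine ContDiffOn.norm ℝ ((contDiff_normalVec.comp_contDiffOn
      (γ.contDiffOn_fderiv_localRep c)).of_le (by simp)) fun q hq => ?_
    exact (γ.isImm (hIoo hq.1)).normalVec_ne_zero hq.2
  · intro c t ht u hu
    have hN := (γ.isImm (hIoo ht)).normalVec_ne_zero hu
    obtain ⟨N', hN', hN'y⟩ := hasDerivAt_normalVec (γ.hasDerivAt_fderiv_localRep c ht hu)
    -- Writing ‖N‖ as √(‖N‖²) gives the derivative ⟨N, N'⟩ / ‖N‖.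
    have h1 : HasDerivAt (fun s => Real.sqrt
        (‖normalVec (fderiv ℝ (localRep (γ.toFun s) c) u)‖ ^ 2)) _ t :=
      hN'.norm_sq.sqrt (pow_ne_zero 2 (norm_ne_zero_iff.2 hN))
    simp only [Real.sqrt_sq (norm_nonneg _)] at h1
    refine h1.congr_deriv ?_
    rw [hN'y]
    have := norm_ne_zero_iff.2 hN
    field_simp

/-- The flux through `f` of the vector field `ψ e`, where `e` is a constant vector. -/
def flux (o : ManifoldOrientation m M) (ψ : Ambient m → ℝ) (e : Ambient m) (f : M → Ambient m) :
    ℝ :=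
  ∫ x, ψ (f x) * inner ℝ e (unitNormal o f x) ∂(volMeasure f)

/-- The algebraic identity that turns the variation of the flux into the divergence. -/
lemma IsImm.pairing_smul_const {f k : M → Ambient m} (hf : IsImm f) (o : ManifoldOrientation m M)
    {ψ : Ambient m → ℝ} (hψ : ContDiff ℝ ∞ ψ) (e : Ambient m) (x : M) :
    fderiv ℝ ψ (f x) (k x) * inner ℝ e (unitNormal o f x) +
        pairing o f k (fun y => ψ (f y) • e) x =
      fderiv ℝ ψ (f x) e * inner ℝ (k x) (unitNormal o f x) := by
  have hfd := differentiableAt_comp_chart_symm hf.1 x (mem_extChartAt_target x)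
  have hψd : HasFDerivAt ψ (fderiv ℝ ψ (f x)) ((f ∘ (extChartAt (𝓡 m) x).symm)
      (extChartAt (𝓡 m) x x)) := by
    rw [Function.comp_apply, extChartAt_to_inv]
    exact (hψ.differentiable (by simp) _).hasFDerivAt
  have hd : HasFDerivAt ((fun y => ψ (f y) • e) ∘ (extChartAt (𝓡 m) x).symm)
      ((fderiv ℝ ψ (f x) ∘L dAt m f x).smulRight e) (extChartAt (𝓡 m) x x) :=
    (hψd.comp _ hfd.hasFDerivAt).smul_const e
  have hda : dAt m (fun y => ψ (f y) • e) x = (fderiv ℝ ψ (f x) ∘L dAt m f x).smulRight e :=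
    hd.fderiv
  have hfr : ∀ i, frame (dAt m (fun y => ψ (f y) • e) x) i =
      fderiv ℝ ψ (f x) (frame (dAt m f x) i) • e := fun i => by rw [hda]; rfl
  have h := volForm_rankOne (fderiv ℝ ψ (f x)) e (k x) (frame (dAt m f x))
  rw [pairing, varForm, unitNormal_eq, inner_smul_right, inner_smul_right, inner_normalVec,
    inner_normalVec]
  simp only [hfr, volForm_update_smul]
  linear_combination (orSign o x * ‖normalVec (dAt m f x)‖⁻¹) * h

/-- The derivative is the integral of the divergence of ψ e against the normal velocity, for
arbitrary paths. Thus no reduction to horizontal paths is needed. -/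
lemma ImmPath.flux_variation (γ : ImmPath m M) (o : ManifoldOrientation m M)
    {ψ : Ambient m → ℝ} (hψ : ContDiff ℝ ∞ ψ) (e : Ambient m) :
    ContinuousOn (fun t => flux o ψ e (γ.toFun t)) (Set.Icc 0 1) ∧
      ∀ t ∈ Set.Ioo (0 : ℝ) 1, HasDerivAt (fun t => flux o ψ e (γ.toFun t))
        (∫ x, fderiv ℝ ψ (γ.toFun t x) e *
          inner ℝ (γ.velocity t x) (unitNormal o (γ.toFun t) x) ∂(volMeasure (γ.toFun t))) t := by
  have hIoo : Set.Ioo (0 : ℝ) 1 ⊆ Set.Icc 0 1 := Set.Ioo_subset_Icc_self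
  have hY : ∀ {t : ℝ}, t ∈ Set.Icc (0 : ℝ) 1 →
      ContMDiff (𝓡 m) 𝓘(ℝ, Ambient m) ∞ fun y => ψ (γ.toFun t y) • e := fun ht =>
    (hψ.contMDiff.comp (γ.isImm ht).1).smul contMDiff_const
  have hc1 : ∀ {t : ℝ}, t ∈ Set.Ioo (0 : ℝ) 1 → Continuous fun x =>
      fderiv ℝ ψ (γ.toFun t x) (γ.velocity t x) * inner ℝ e (unitNormal o (γ.toFun t) x) :=
    fun ht => (((hψ.continuous_fderiv (by simp)).comp (γ.isImm (hIoo ht)).1.continuous).clm_apply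
      (γ.contMDiff_velocity ht).continuous).mul
        (continuous_const.inner ((γ.isImm (hIoo ht)).contMDiff_unitNormal o).continuous)
  have hc2 : ∀ {t : ℝ}, t ∈ Set.Ioo (0 : ℝ) 1 → Continuous
      (pairing o (γ.toFun t) (fun y => ψ (γ.toFun t y) • e) (γ.velocity t)) := fun ht =>
    (γ.isImm (hIoo ht)).continuous_pairing o (hY (hIoo ht)).continuous (γ.contMDiff_velocity ht)
  have hc3 : ∀ {t : ℝ}, t ∈ Set.Ioo (0 : ℝ) 1 → Continuous
      (pairing o (γ.toFun t) (γ.velocity t) (fun y => ψ (γ.toFun t y) • e)) := fun ht =>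
    (γ.isImm (hIoo ht)).continuous_pairing o (γ.contMDiff_velocity ht).continuous (hY (hIoo ht))
  have key := continuousOn_and_hasDerivAt_integral o (f := γ.toFun) (fun t ht => γ.isImm ht)
    (ξ := fun t x => ψ (γ.toFun t x) * inner ℝ e (unitNormal o (γ.toFun t) x))
    (η := fun t x => fderiv ℝ ψ (γ.toFun t x) (γ.velocity t x) *
      inner ℝ e (unitNormal o (γ.toFun t) x) +
        pairing o (γ.toFun t) (fun y => ψ (γ.toFun t y) • e) (γ.velocity t) x)
    (fun t ht => (hψ.continuous.comp (γ.isImm ht).1.continuous).mul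
      (continuous_const.inner ((γ.isImm ht).contMDiff_unitNormal o).continuous))
    (fun t ht => (hc1 ht).add (hc2 ht))
    (fun c t u => orSign o c * (ψ (γ.rep c (t, u)) *
      volForm m (Fin.cons e (frame (fderiv ℝ (localRep (γ.toFun t) c) u)))))
    (fun c t u => orSign o c * (fderiv ℝ ψ (γ.rep c (t, u)) (fderiv ℝ (γ.rep c) (t, u) (1, 0)) *
      volForm m (Fin.cons e (frame (fderiv ℝ (localRep (γ.toFun t) c) u))) +
      ψ (γ.rep c (t, u)) * varForm e (fderiv ℝ (localRep (γ.toFun t) c) u)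
        (fderiv ℝ (localRep (γ.velocity t) c) u)))
    ?_ ?_ ?_ ?_ ?_
  · refine ⟨key.1, fun t ht => (key.2 t ht).congr_deriv ?_⟩
    have hf := γ.isImm (hIoo ht)
    -- After the swap the velocity is no longer differentiated, and `IsImm.pairing_smul_const`
    -- applies pointwise.
    rw [integral_add (hf.integrable_of_continuous (hc1 ht)) (hf.integrable_of_continuous (hc2 ht)),
      hf.integral_pairing_comm o (hY (hIoo ht)) (γ.contMDiff_velocity ht),
      ← integral_add (hf.integrable_of_continuous (hc1 ht)) (hf.integrable_of_continuous (hc3 ht))]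
    exact integral_congr_ae (Filter.Eventually.of_forall fun x => hf.pairing_smul_const o hψ e x)
  · intro c t ht x hx
    have hf := γ.isImm ht
    have hu := (extChartAt (𝓡 m) c).map_source (adapted_subset o c hx)
    have hN := norm_ne_zero_iff.2 (hf.normalVec_ne_zero hu)
    have hr : γ.rep c (t, extChartAt (𝓡 m) c x) = γ.toFun t x := by
      simp only [ImmPath.rep, localRep, Function.comp_apply]
      rw [(extChartAt (𝓡 m) c).left_inv (adapted_subset o c hx)]
    rw [hf.volDensity_eq hu, unitNormal_eq_of_mem_adapted hf.1 hx, inner_smul_right,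
      inner_normalVec, hr]
    field_simp
  · intro c t ht x hx
    have hf := γ.isImm (hIoo ht)
    have hu := (extChartAt (𝓡 m) c).map_source (adapted_subset o c hx)
    have hN := norm_ne_zero_iff.2 (hf.normalVec_ne_zero hu)
    have hr : γ.rep c (t, extChartAt (𝓡 m) c x) = γ.toFun t x := by
      simp only [ImmPath.rep, localRep, Function.comp_apply]
      rw [(extChartAt (𝓡 m) c).left_inv (adapted_subset o c hx)]
    have hv : fderiv ℝ (γ.rep c) (t, extChartAt (𝓡 m) c x) (1, 0) = γ.velocity t x := by
      rw [← γ.velocity_chart c ht hu]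
      simp only [localRep, Function.comp_apply]
      rw [(extChartAt (𝓡 m) c).left_inv (adapted_subset o c hx)]
    rw [hf.volDensity_eq hu, unitNormal_eq_of_mem_adapted hf.1 hx, inner_smul_right,
      inner_normalVec, hr, hv, pairing_eq_of_mem_adapted hf.1 (γ.contMDiff_velocity ht) hx,
      varForm_smul_left]
    field_simp
  · intro c
    refine continuousOn_const.mul ((hψ.continuous.comp_continuousOn
      (γ.contDiffOn_rep c).continuousOn).mul ?_)
    simp only [← inner_normalVec]
    exact continuousOn_const.inner
      (continuous_normalVec.comp_continuousOn (γ.continuousOn_fderiv_localRep c))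
  · intro c
    refine contDiffOn_const.mul (((hψ.of_le (by simp)).comp_contDiffOn
      ((γ.contDiffOn_rep_Ioo c).of_le (by simp))).mul ?_)
    simp only [← inner_normalVec]
    exact contDiffOn_const.inner ℝ ((contDiff_normalVec.comp_contDiffOn
      (γ.contDiffOn_fderiv_localRep c)).of_le (by simp))
  · intro c t ht u hu
    have h1 : HasDerivAt (fun s => ψ (γ.rep c (s, u))) (fderiv ℝ ψ (γ.rep c (t, u))
        (fderiv ℝ (γ.rep c) (t, u) (1, 0))) t :=
      HasFDerivAt.comp_hasDerivAt (f := fun s => γ.rep c (s, u)) t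
        (hψ.differentiable (by simp) _).hasFDerivAt (γ.hasDerivAt_rep c ht hu)
    have h2 := hasDerivAt_volForm_frame (hasDerivAt_const t e)
      (γ.hasDerivAt_fderiv_localRep c ht hu)
    have h0 : volForm m (Fin.cons 0 (frame (fderiv ℝ (localRep (γ.toFun t) c) u))) = 0 := by
      rw [← inner_normalVec, inner_zero_left]
    rw [h0, zero_add] at h2
    exact (h1.mul h2).const_mul _

end Paths

/-! ### Estimates along paths -/

section Estimates

open MeasureTheory

/-- The Cauchy-Schwarz inequality for integrals. -/
lemma abs_integral_mul_le_sqrt {α : Type*} [MeasurableSpace α] {μ : Measure α} {f g : α → ℝ}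
    (hf : Integrable (fun x => f x ^ 2) μ) (hg : Integrable (fun x => g x ^ 2) μ)
    (hfg : Integrable (fun x => f x * g x) μ) :
    |∫ x, f x * g x ∂μ| ≤ Real.sqrt (∫ x, f x ^ 2 ∂μ) * Real.sqrt (∫ x, g x ^ 2 ∂μ) := by
  -- The quadratic polynomial s ↦ ∫ (s f - g)² is nonnegative, so its discriminant is not positive.
  have h : ∀ s : ℝ, 0 ≤ (∫ x, f x ^ 2 ∂μ) * (s * s) + (-2 * ∫ x, f x * g x ∂μ) * s +
      ∫ x, g x ^ 2 ∂μ := by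
    intro s
    have h1 : ∫ x, (s * f x - g x) ^ 2 ∂μ = (∫ x, f x ^ 2 ∂μ) * (s * s) +
        (-2 * ∫ x, f x * g x ∂μ) * s + ∫ x, g x ^ 2 ∂μ := by
      have h2 : ∀ x, (s * f x - g x) ^ 2 =
          s * s * f x ^ 2 + (-2 * s) * (f x * g x) + g x ^ 2 := fun x => by ring
      simp only [h2]
      have hi : Integrable (fun x => s * s * f x ^ 2 + (-2 * s) * (f x * g x)) μ :=
        (hf.const_mul (s * s)).add (hfg.const_mul (-2 * s))
      rw [integral_add hi hg, integral_add (hf.const_mul _) (hfg.const_mul _), integral_const_mul,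
        integral_const_mul]
      ring
    rw [← h1]
    exact integral_nonneg fun x => sq_nonneg _
  have hd := discrim_le_zero h
  rw [discrim] at hd
  rw [← Real.sqrt_mul (integral_nonneg fun x => sq_nonneg _)]
  exact Real.abs_le_sqrt (by linarith)

/-- A function whose derivative is controlled by `κ L` changes at most by `κ ∫ L`. -/
lemma ofReal_abs_sub_le_lintegral {g g' L : ℝ → ℝ} {κ : ℝ} (hκ : 0 ≤ κ)
    (hg : ContinuousOn g (Set.Icc 0 1)) (hd : ∀ s ∈ Set.Ioo (0 : ℝ) 1, HasDerivAt g (g' s) s)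
    (hb : ∀ s ∈ Set.Ioo (0 : ℝ) 1, |g' s| ≤ κ * L s) {t : ℝ} (ht : t ∈ Set.Icc (0 : ℝ) 1) :
    ENNReal.ofReal |g t - g 0| ≤
      ENNReal.ofReal κ * ∫⁻ s in Set.Icc (0 : ℝ) 1, ENNReal.ofReal (L s) := by
  have hJ : ∫⁻ s in Set.Ioo (0 : ℝ) 1, ‖deriv g s‖ₑ ≤
      ENNReal.ofReal κ * ∫⁻ s in Set.Icc (0 : ℝ) 1, ENNReal.ofReal (L s) := by
    rw [← lintegral_const_mul' _ _ ENNReal.ofReal_ne_top]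
    refine le_trans (setLIntegral_mono' measurableSet_Ioo fun s hs => ?_)
      (lintegral_mono_set Set.Ioo_subset_Icc_self)
    rw [(hd s hs).deriv, ← ENNReal.ofReal_mul hκ, Real.enorm_eq_ofReal_abs]
    exact ENNReal.ofReal_le_ofReal (hb s hs)
  refine le_trans ?_ hJ
  -- If the derivative is not integrable the bound is trivial; otherwise the fundamental theorem of
  -- calculus applies. No regularity of L is needed.
  by_cases htop : ∫⁻ s in Set.Ioo (0 : ℝ) 1, ‖deriv g s‖ₑ = ⊤
  · rw [htop]; exact le_top
  have hint : IntegrableOn (deriv g) (Set.Ioo 0 1) :=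
    ⟨(measurable_deriv g).aestronglyMeasurable, lt_top_iff_ne_top.2 htop⟩
  have hint' : IntegrableOn (deriv g) (Set.Ioc 0 t) :=
    ((integrableOn_Ioc_iff_integrableOn_Ioo).2 hint).mono_set (Set.Ioc_subset_Ioc_right ht.2)
  have hFTC : ∫ s in (0 : ℝ)..t, deriv g s = g t - g 0 :=
    intervalIntegral.integral_eq_sub_of_hasDerivAt_of_le ht.1
      (hg.mono (Set.Icc_subset_Icc_right ht.2))
      (fun s hs => (hd s ⟨hs.1, hs.2.trans_le ht.2⟩).differentiableAt.hasDerivAt)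
      ((intervalIntegrable_iff_integrableOn_Ioc_of_le ht.1).2 hint')
  rw [← hFTC, intervalIntegral.integral_of_le ht.1, ← Real.enorm_eq_ofReal_abs]
  refine (enorm_integral_le_lintegral_enorm _).trans ?_
  rw [← restrict_Ioo_eq_restrict_Ioc]
  exact lintegral_mono_set (Set.Ioo_subset_Ioo_right ht.2)

/-- The length bound for a coercive weight, in terms of functions of time only: `V` is the volume,
`F` the flux, `G` the metric, and `A`, `B` are the unweighted and the curvature-weighted energy. -/
lemma le_lintegral_sqrt_of_volume_bound {V V' F F' G A B : ℝ → ℝ} {K C₁ C₂ δ : ℝ} (hK : 0 ≤ K)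
    (hC₁ : 0 < C₁) (hC₂ : 0 < C₂) (hVpos : ∀ t ∈ Set.Icc (0 : ℝ) 1, 0 < V t)
    (hV : ContinuousOn V (Set.Icc 0 1)) (hV' : ∀ t ∈ Set.Ioo (0 : ℝ) 1, HasDerivAt V (V' t) t)
    (hF : ContinuousOn F (Set.Icc 0 1)) (hF' : ∀ t ∈ Set.Ioo (0 : ℝ) 1, HasDerivAt F (F' t) t)
    (hVb : ∀ t ∈ Set.Ioo (0 : ℝ) 1, |V' t| ≤ Real.sqrt (V t) * Real.sqrt (B t))
    (hFb : ∀ t ∈ Set.Ioo (0 : ℝ) 1, |F' t| ≤ K * Real.sqrt (V t) * Real.sqrt (A t))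
    (hA : ∀ t ∈ Set.Ioo (0 : ℝ) 1, C₁ * A t ≤ G t) (hB : ∀ t ∈ Set.Ioo (0 : ℝ) 1, C₂ * B t ≤ G t)
    (hδ : δ ≤ |F 1 - F 0|) :
    min 1 (ENNReal.ofReal δ / ENNReal.ofReal
      (K * (Real.sqrt (V 0) + 1 / (2 * Real.sqrt C₂)) / Real.sqrt C₁ + 1)) ≤
      ∫⁻ t in Set.Icc (0 : ℝ) 1, ENNReal.ofReal (Real.sqrt (G t)) := by
  have hIoo : Set.Ioo (0 : ℝ) 1 ⊆ Set.Icc 0 1 := Set.Ioo_subset_Icc_self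
  have hsC₁ := Real.sqrt_pos.2 hC₁
  have hsC₂ := Real.sqrt_pos.2 hC₂
  have hsqrt : ∀ {C a b : ℝ}, 0 < C → C * a ≤ b → Real.sqrt a ≤ Real.sqrt b / Real.sqrt C := by
    intro C a b hC hab
    rw [← Real.sqrt_div' _ hC.le]
    exact Real.sqrt_le_sqrt ((le_div_iff₀' hC).2 hab)
  -- Suppose the length is below both terms of the minimum: being less than 1 caps the volume, and
  -- with the volume capped the second term contradicts the change of flux.
  by_contra hlt
  push Not at hlt
  have hlt1 := hlt.trans_le (min_le_left _ _)
  have hlt2 := hlt.trans_le (min_le_right _ _)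
  -- Work with √V: in (√V)' = V' / (2√V), the factor √V of the bound for V' cancels.
  have hVR : ∀ t ∈ Set.Icc (0 : ℝ) 1,
      Real.sqrt (V t) ≤ Real.sqrt (V 0) + 1 / (2 * Real.sqrt C₂) := by
    intro t ht
    have hb : ∀ s ∈ Set.Ioo (0 : ℝ) 1,
        |V' s / (2 * Real.sqrt (V s))| ≤ 1 / (2 * Real.sqrt C₂) * Real.sqrt (G s) := by
      intro s hs
      have hsV := Real.sqrt_pos.2 (hVpos s (hIoo hs))
      have h2 := mul_le_mul_of_nonneg_left (hsqrt hC₂ (hB s hs)) hsV.le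
      rw [abs_div, abs_of_pos (by positivity : 0 < 2 * Real.sqrt (V s)), div_le_iff₀ (by positivity)]
      refine ((hVb s hs).trans h2).trans (le_of_eq ?_)
      field_simp
    have h := ofReal_abs_sub_le_lintegral (g := fun t => Real.sqrt (V t))
      (L := fun t => Real.sqrt (G t)) (κ := 1 / (2 * Real.sqrt C₂)) (by positivity) hV.sqrt
      (fun s hs => (hV' s hs).sqrt (hVpos s (hIoo hs)).ne') hb ht
    have h' := h.trans (mul_le_mul_right hlt1.le _)
    rw [mul_one, ENNReal.ofReal_le_ofReal_iff (by positivity)] at h'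
    linarith [le_abs_self (Real.sqrt (V t) - Real.sqrt (V 0))]
  set κ : ℝ := K * (Real.sqrt (V 0) + 1 / (2 * Real.sqrt C₂)) / Real.sqrt C₁ with hκ
  have hκ0 : 0 ≤ κ := by positivity
  -- The summand 1 keeps the Lipschitz constant, a denominator in the claim, positive even for K =
  -- 0.
  have hb : ∀ s ∈ Set.Ioo (0 : ℝ) 1, |F' s| ≤ (κ + 1) * Real.sqrt (G s) := by
    intro s hs
    have h2 := hsqrt hC₁ (hA s hs)
    have h3 := mul_le_mul (mul_le_mul_of_nonneg_left (hVR s (hIoo hs)) hK) h2 (Real.sqrt_nonneg _)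
      (by positivity)
    have h4 : K * (Real.sqrt (V 0) + 1 / (2 * Real.sqrt C₂)) * (Real.sqrt (G s) / Real.sqrt C₁) =
        κ * Real.sqrt (G s) := by rw [hκ]; ring
    linarith [hFb s hs, Real.sqrt_nonneg (G s)]
  have h := ofReal_abs_sub_le_lintegral (g := F) (L := fun t => Real.sqrt (G t)) (κ := κ + 1)
    (by positivity) hF hF' hb (Set.right_mem_Icc.2 zero_le_one)
  exact absurd (ENNReal.div_le_of_le_mul' ((ENNReal.ofReal_le_ofReal hδ).trans h))
    (not_le.2 hlt2)

/-- The length bound for a weight that is at least the volume, in terms of functions of time. -/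
lemma le_lintegral_sqrt_of_le {V F F' G A : ℝ → ℝ} {K C δ : ℝ} (hK : 0 ≤ K)
    (hC : 0 < C) (hV : ∀ t ∈ Set.Ioo (0 : ℝ) 1, 0 < V t)
    (hF : ContinuousOn F (Set.Icc 0 1)) (hF' : ∀ t ∈ Set.Ioo (0 : ℝ) 1, HasDerivAt F (F' t) t)
    (hFb : ∀ t ∈ Set.Ioo (0 : ℝ) 1, |F' t| ≤ K * Real.sqrt (V t) * Real.sqrt (A t))
    (hA : ∀ t ∈ Set.Ioo (0 : ℝ) 1, C * V t * A t ≤ G t) (hδ : δ ≤ |F 1 - F 0|) :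
    ENNReal.ofReal δ / ENNReal.ofReal (K / Real.sqrt C + 1) ≤
      ∫⁻ t in Set.Icc (0 : ℝ) 1, ENNReal.ofReal (Real.sqrt (G t)) := by
  have hsC := Real.sqrt_pos.2 hC
  have hb : ∀ s ∈ Set.Ioo (0 : ℝ) 1, |F' s| ≤ (K / Real.sqrt C + 1) * Real.sqrt (G s) := by
    intro s hs
    have h2 := Real.sqrt_le_sqrt (hA s hs)
    have hVs := (hV s hs).le
    rw [Real.sqrt_mul (by positivity), Real.sqrt_mul hC.le] at h2
    have h3 := mul_le_mul_of_nonneg_left h2 (by positivity : 0 ≤ K / Real.sqrt C)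
    have h4 : K / Real.sqrt C * (Real.sqrt C * Real.sqrt (V s) * Real.sqrt (A s)) =
        K * Real.sqrt (V s) * Real.sqrt (A s) := by field_simp
    linarith [hFb s hs, Real.sqrt_nonneg (G s)]
  have h := ofReal_abs_sub_le_lintegral (g := F) (L := fun t => Real.sqrt (G t))
    (κ := K / Real.sqrt C + 1) (by positivity) hF hF' hb (Set.right_mem_Icc.2 zero_le_one)
  exact ENNReal.div_le_of_le_mul' ((ENNReal.ofReal_le_ofReal hδ).trans h)

/-! ### Lower bounds for the metric and for lengths of paths -/

variable {m : ℕ} {M : Type*} [TopologicalSpace M] [ChartedSpace (Model m) M]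
  [IsManifold (𝓡 m) ∞ M]

/-- The chart in the definition varies with the point, so continuity is read off from Tr L =
-pairing(ν, ν) instead. -/
lemma IsImm.continuous_meanCurvature {f : M → Ambient m} (hf : IsImm f)
    (o : ManifoldOrientation m M) : Continuous (meanCurvature o f) := by
  have h : meanCurvature o f = fun x => -pairing o f (unitNormal o f) (unitNormal o f) x := by
    funext x
    rw [hf.pairing_unitNormal, real_inner_self_eq_norm_sq, hf.norm_unitNormal]
    ring
  rw [h]
  exact (hf.continuous_pairing o (hf.contMDiff_unitNormal o).continuous
    (hf.contMDiff_unitNormal o)).neg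

variable [T2Space M] [CompactSpace M] [MeasurableSpace M] [BorelSpace M]

lemma IsImm.totalVol_pos [Nonempty M] {f : M → Ambient m} (hf : IsImm f) : 0 < totalVol f := by
  have := hf.isFiniteMeasure
  have := hf.isOpenPosMeasure
  exact ENNReal.toReal_pos (isOpen_univ.measure_pos _ Set.univ_nonempty).ne' (measure_ne_top _ _)

lemma IsImm.almostLocal_normalPart {f : M → Ambient m} (hf : IsImm f)
    (o : ManifoldOrientation m M) (Φ : ℝ → ℝ → ℝ) (h : M → Ambient m) :
    almostLocal o Φ f (normalPart o f h) (normalPart o f h) =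
      ∫ x, Φ (totalVol f) (meanCurvature o f x) * (inner ℝ (h x) (unitNormal o f x)) ^ 2
        ∂(volMeasure f) := by
  refine integral_congr_ae (Filter.Eventually.of_forall fun x => ?_)
  simp only [normalPart]
  rw [inner_smul_left, inner_smul_right, real_inner_self_eq_norm_sq, hf.norm_unitNormal]
  simp only [conj_trivial]
  ring

/-- The lower bound for the metric that follows from a pointwise bound for `Φ`. -/
lemma IsImm.integral_le_almostLocal [Nonempty M] {f h : M → Ambient m} (hf : IsImm f)
    (o : ManifoldOrientation m M) (hh : Continuous h) {Φ : ℝ → ℝ → ℝ}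
    (hΦ : ContDiffOn ℝ ∞ (fun p : ℝ × ℝ => Φ p.1 p.2) (Set.Ioi 0 ×ˢ Set.univ)) {b : M → ℝ} (hb : Continuous b)
    (hbΦ : ∀ x, b x ≤ Φ (totalVol f) (meanCurvature o f x)) :
    ∫ x, b x * (inner ℝ (h x) (unitNormal o f x)) ^ 2 ∂(volMeasure f) ≤
      almostLocal o Φ f (normalPart o f h) (normalPart o f h) := by
  have hν := (hf.contMDiff_unitNormal o).continuous
  have ha : Continuous fun x => (inner ℝ (h x) (unitNormal o f x) : ℝ) := hh.inner hν
  -- Φ is regular only for positive volume, hence the appeal to `IsImm.totalVol_pos`.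
  have hcΦ : Continuous fun x => Φ (totalVol f) (meanCurvature o f x) := by
    refine ContinuousOn.comp_continuous (f := fun x => (totalVol f, meanCurvature o f x))
      hΦ.continuousOn (continuous_const.prodMk (hf.continuous_meanCurvature o)) fun x => ?_
    exact ⟨hf.totalVol_pos, Set.mem_univ _⟩
  rw [hf.almostLocal_normalPart]
  refine integral_mono (hf.integrable_of_continuous (hb.mul (ha.pow 2)))
    (hf.integrable_of_continuous (hcΦ.mul (ha.pow 2))) fun x => ?_
  exact mul_le_mul_of_nonneg_right (hbΦ x) (sq_nonneg _)

/-- Cauchy-Schwarz against the constant 1, whose L² norm is √Vol. With b = Tr L it bounds the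
variation of the volume. -/
lemma IsImm.abs_integral_mul_inner_le {f h : M → Ambient m} (hf : IsImm f)
    (o : ManifoldOrientation m M) (hh : Continuous h) {b : M → ℝ} (hb : Continuous b) :
    |∫ x, b x * inner ℝ (h x) (unitNormal o f x) ∂(volMeasure f)| ≤ Real.sqrt (totalVol f) *
      Real.sqrt (∫ x, (b x * inner ℝ (h x) (unitNormal o f x)) ^ 2 ∂(volMeasure f)) := by
  have hν := (hf.contMDiff_unitNormal o).continuous
  have ha : Continuous fun x => b x * (inner ℝ (h x) (unitNormal o f x) : ℝ) :=
    hb.mul (hh.inner hν)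
  have key := abs_integral_mul_le_sqrt (μ := volMeasure f) (f := fun _ => (1 : ℝ))
    (g := fun x => b x * inner ℝ (h x) (unitNormal o f x))
    (hf.integrable_of_continuous continuous_const) (hf.integrable_of_continuous (ha.pow 2))
    (hf.integrable_of_continuous (continuous_const.mul ha))
  simpa [totalVol] using key

lemma IsImm.abs_integral_mul_inner_le_of_abs_le {f h : M → Ambient m} (hf : IsImm f)
    (o : ManifoldOrientation m M) (hh : Continuous h) {b : M → ℝ} (hb : Continuous b) {K : ℝ}
    (hK : ∀ x, |b x| ≤ K) (hK0 : 0 ≤ K) :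
    |∫ x, b x * inner ℝ (h x) (unitNormal o f x) ∂(volMeasure f)| ≤
      K * Real.sqrt (totalVol f) *
        Real.sqrt (∫ x, (inner ℝ (h x) (unitNormal o f x)) ^ 2 ∂(volMeasure f)) := by
  have hν := (hf.contMDiff_unitNormal o).continuous
  have ha : Continuous fun x => (inner ℝ (h x) (unitNormal o f x) : ℝ) := hh.inner hν
  refine (hf.abs_integral_mul_inner_le o hh hb).trans ?_
  have h1 : ∫ x, (b x * inner ℝ (h x) (unitNormal o f x)) ^ 2 ∂(volMeasure f) ≤
      K ^ 2 * ∫ x, (inner ℝ (h x) (unitNormal o f x)) ^ 2 ∂(volMeasure f) := by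
    rw [← integral_const_mul]
    refine integral_mono (hf.integrable_of_continuous ((hb.mul ha).pow 2))
      ((hf.integrable_of_continuous (ha.pow 2)).const_mul _) fun x => ?_
    simp only [mul_pow]
    refine mul_le_mul_of_nonneg_right ?_ (sq_nonneg _)
    exact sq_le_sq' (abs_le.1 (hK x)).1 (abs_le.1 (hK x)).2
  have h2 := Real.sqrt_le_sqrt h1
  rw [Real.sqrt_mul (sq_nonneg K), Real.sqrt_sq hK0] at h2
  calc _ ≤ Real.sqrt (totalVol f) * (K * Real.sqrt (∫ x, (inner ℝ (h x) (unitNormal o f x)) ^ 2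
        ∂(volMeasure f))) := mul_le_mul_of_nonneg_left h2 (Real.sqrt_nonneg _)
    _ = _ := by ring

/-- A path along which the flux of a vector field with bounded divergence changes by a given amount
has a length that is bounded from below. -/
theorem exists_le_shapeLength [Nonempty M] (o : ManifoldOrientation m M) (Φ : ℝ → ℝ → ℝ)
    (hΦ : ContDiffOn ℝ ∞ (fun p : ℝ × ℝ => Φ p.1 p.2) (Set.Ioi 0 ×ˢ Set.univ))
    (hbound :
      (∃ C₁ > 0, ∃ C₂ > 0, ∀ (f : Imm m M) (x : M),
        C₁ + C₂ * meanCurvature o f.1 x ^ 2 ≤ Φ (totalVol f.1) (meanCurvature o f.1 x)) ∨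
      (∃ C > 0, ∀ (f : Imm m M) (x : M),
        C * totalVol f.1 ≤ Φ (totalVol f.1) (meanCurvature o f.1 x)))
    {ψ : Ambient m → ℝ} (hψ : ContDiff ℝ ∞ ψ) {e : Ambient m} {K : ℝ}
    (hK : ∀ y, |fderiv ℝ ψ y e| ≤ K) (V δ : ℝ) (hδ : 0 < δ) :
    ∃ ε : ℝ≥0∞, 0 < ε ∧ ∀ γ : ImmPath m M, totalVol (γ.toFun 0) = V →
      δ ≤ |flux o ψ e (γ.toFun 1) - flux o ψ e (γ.toFun 0)| → ε ≤ shapeLength o Φ γ := by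
  have hIoo : Set.Ioo (0 : ℝ) 1 ⊆ Set.Icc 0 1 := Set.Ioo_subset_Icc_self
  have hK0 : 0 ≤ K := (abs_nonneg _).trans (hK 0)
  have hflux : ∀ γ : ImmPath m M, ∀ t ∈ Set.Ioo (0 : ℝ) 1,
      |∫ x, fderiv ℝ ψ (γ.toFun t x) e *
          inner ℝ (γ.velocity t x) (unitNormal o (γ.toFun t) x) ∂(volMeasure (γ.toFun t))| ≤
        K * Real.sqrt (totalVol (γ.toFun t)) * Real.sqrt (∫ x,
          (inner ℝ (γ.velocity t x) (unitNormal o (γ.toFun t) x)) ^ 2 ∂(volMeasure (γ.toFun t))) :=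
    fun γ t ht => (γ.isImm (hIoo ht)).abs_integral_mul_inner_le_of_abs_le o
      (γ.contMDiff_velocity ht).continuous (((hψ.continuous_fderiv (by simp)).comp
        (γ.isImm (hIoo ht)).1.continuous).clm_apply continuous_const) (fun x => hK _) hK0
  rcases hbound with ⟨C₁, hC₁, C₂, hC₂, hb⟩ | ⟨C, hC, hb⟩
  -- The constant of `le_lintegral_sqrt_of_volume_bound` with V(0) = V; it involves no other
  -- information about the path.
  · refine ⟨min 1 (ENNReal.ofReal δ / ENNReal.ofReal
      (K * (Real.sqrt V + 1 / (2 * Real.sqrt C₂)) / Real.sqrt C₁ + 1)), lt_min one_pos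
      (ENNReal.div_pos (ENNReal.ofReal_pos.2 hδ).ne' ENNReal.ofReal_ne_top), fun γ hV hγ => ?_⟩
    have hvar := γ.totalVol_variation o
    have hF := γ.flux_variation o hψ e
    subst hV
    refine le_lintegral_sqrt_of_volume_bound (V := fun t => totalVol (γ.toFun t))
      (F := fun t => flux o ψ e (γ.toFun t))
      (A := fun t => ∫ x, (inner ℝ (γ.velocity t x) (unitNormal o (γ.toFun t) x)) ^ 2
        ∂(volMeasure (γ.toFun t)))
      (B := fun t => ∫ x, (meanCurvature o (γ.toFun t) x *
        inner ℝ (γ.velocity t x) (unitNormal o (γ.toFun t) x)) ^ 2 ∂(volMeasure (γ.toFun t)))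
      hK0 hC₁ hC₂ (fun t ht => (γ.isImm ht).totalVol_pos) hvar.1 hvar.2 hF.1 hF.2 (fun t ht => ?_)
      (hflux γ) (fun t ht => ?_) (fun t ht => ?_) hγ
    · rw [abs_neg]
      exact (γ.isImm (hIoo ht)).abs_integral_mul_inner_le o (γ.contMDiff_velocity ht).continuous
        ((γ.isImm (hIoo ht)).continuous_meanCurvature o)
    · rw [← integral_const_mul]
      refine (γ.isImm (hIoo ht)).integral_le_almostLocal o (γ.contMDiff_velocity ht).continuous hΦ
        (b := fun _ => C₁) continuous_const fun x => ?_
      have h1 := hb ⟨γ.toFun t, γ.isImm (hIoo ht)⟩ x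
      have h2 : 0 ≤ C₂ * meanCurvature o (γ.toFun t) x ^ 2 := by positivity
      exact le_trans (by linarith) h1
    · have h := (γ.isImm (hIoo ht)).integral_le_almostLocal o
        (γ.contMDiff_velocity ht).continuous hΦ
        (b := fun x => C₂ * meanCurvature o (γ.toFun t) x ^ 2)
        (continuous_const.mul (((γ.isImm (hIoo ht)).continuous_meanCurvature o).pow 2)) fun x =>
          le_trans (by linarith) (hb ⟨γ.toFun t, γ.isImm (hIoo ht)⟩ x)
      refine le_trans (le_of_eq ?_) h
      rw [← integral_const_mul]
      refine integral_congr_ae (Filter.Eventually.of_forall fun x => ?_)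
      simp only [mul_pow, mul_assoc]
  · refine ⟨ENNReal.ofReal δ / ENNReal.ofReal (K / Real.sqrt C + 1),
      ENNReal.div_pos (ENNReal.ofReal_pos.2 hδ).ne' ENNReal.ofReal_ne_top, fun γ hV hγ => ?_⟩
    have hF := γ.flux_variation o hψ e
    refine le_lintegral_sqrt_of_le (V := fun t => totalVol (γ.toFun t))
      (F := fun t => flux o ψ e (γ.toFun t))
      (A := fun t => ∫ x, (inner ℝ (γ.velocity t x) (unitNormal o (γ.toFun t) x)) ^ 2
        ∂(volMeasure (γ.toFun t)))
      hK0 hC (fun t ht => (γ.isImm (hIoo ht)).totalVol_pos) hF.1 hF.2 (hflux γ)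
      (fun t ht => ?_) hγ
    rw [← integral_const_mul]
    exact (γ.isImm (hIoo ht)).integral_le_almostLocal o (γ.contMDiff_velocity ht).continuous hΦ
      (b := fun _ => C * totalVol (γ.toFun t)) continuous_const fun x =>
        hb ⟨γ.toFun t, γ.isImm (hIoo ht)⟩ x

end Estimates

/-! ### Reparametrization -/

section Reparametrization

open MeasureTheory

variable {m : ℕ} {M : Type*} [TopologicalSpace M] [ChartedSpace (Model m) M]
  [IsManifold (𝓡 m) ∞ M]

/-- The tangent spaces of f ∘ φ at x and of f at φ x coincide, and `normalVec` only picks up the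
determinant of the transition. -/
lemma unitNormal_comp {f : M → Ambient m} (hf : IsImm f) (o : ManifoldOrientation m M)
    (φ : Diffeomorph (𝓡 m) (𝓡 m) M M ∞) (x : M) :
    ∃ s : ℝ, unitNormal o (f ∘ φ) x = s • unitNormal o f (φ x) := by
  have h1 : dAt m (f ∘ φ) x = dAt m f (φ x) ∘L transition m φ x (φ x) x :=
    fderiv_comp_chart hf.1 φ.contMDiff (mem_extChartAt_source x) (mem_extChartAt_source (φ x))
  have h2 := (orSign_mul_self o (φ x))
  have h3 : orSign o (φ x) ≠ 0 := fun h => by simp [h] at h2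
  have h4 := norm_ne_zero_iff.2 (hf.normalVec_dAt_ne_zero (φ x))
  refine ⟨orSign o x * ‖normalVec (dAt m (f ∘ φ) x)‖⁻¹ * (transition m φ x (φ x) x).det *
    (orSign o (φ x) * ‖normalVec (dAt m f (φ x))‖⁻¹)⁻¹, ?_⟩
  rw [unitNormal_eq, unitNormal_eq, smul_smul, mul_assoc, inv_mul_cancel₀
    (mul_ne_zero h3 (inv_ne_zero h4)), mul_one, mul_smul (_ * _) (ContinuousLinearMap.det _),
    ← normalVec_comp, ← h1]

/-- A diffeomorphism of a connected manifold preserves the unit normal field up to one sign. -/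
lemma IsImm.unitNormal_comp_eq [ConnectedSpace M] {f : M → Ambient m} (hf : IsImm f)
    (o : ManifoldOrientation m M) (φ : Diffeomorph (𝓡 m) (𝓡 m) M M ∞) :
    ∃ σ : ℝ, |σ| = 1 ∧ ∀ x, unitNormal o (f ∘ φ) x = σ • unitNormal o f (φ x) := by
  choose s hs using unitNormal_comp hf o φ
  have hg := hf.comp_diffeomorph φ
  have habs : ∀ x, |s x| = 1 := by
    intro x
    have h := hg.norm_unitNormal o x
    rwa [hs, norm_smul, hf.norm_unitNormal, mul_one, Real.norm_eq_abs] at h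
  -- The factor is the inner product of two continuous normal fields. Its square is 1, so it is
  -- constant on the connected M.
  have hcont : Continuous s := by
    have h : s = fun x => inner ℝ (unitNormal o f (φ x)) (unitNormal o (f ∘ φ) x) := by
      funext x
      rw [hs, inner_smul_right, real_inner_self_eq_norm_sq, hf.norm_unitNormal]
      ring
    rw [h]
    exact ((hf.contMDiff_unitNormal o).continuous.comp φ.continuous).inner
      (hg.contMDiff_unitNormal o).continuous
  obtain ⟨x₀⟩ : Nonempty M := inferInstance
  have hsq : ∀ x, s x ^ 2 = 1 := fun x => by rw [← sq_abs, habs, one_pow]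
  have h : ∀ x, s x = s x₀ := by
    rcases isPreconnected_univ.eq_one_or_eq_neg_one_of_sq_eq hcont.continuousOn
      (fun x _ => hsq x) with h | h
    · exact fun x => (h (Set.mem_univ x)).trans (h (Set.mem_univ x₀)).symm
    · exact fun x => (h (Set.mem_univ x)).trans (h (Set.mem_univ x₀)).symm
  exact ⟨s x₀, habs x₀, fun x => by rw [hs, h]⟩

variable [T2Space M] [CompactSpace M] [MeasurableSpace M] [BorelSpace M]

lemma IsImm.totalVol_comp {f : M → Ambient m} (hf : IsImm f)
    (φ : Diffeomorph (𝓡 m) (𝓡 m) M M ∞) : totalVol (f ∘ φ) = totalVol f := by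
  rw [totalVol, totalVol, hf.volMeasure_comp_diffeomorph φ, Measure.real, Measure.real,
    Measure.map_apply φ.continuous.measurable MeasurableSet.univ, Set.preimage_univ]

/-- The absolute value is needed because a diffeomorphism that reverses the orientation reverses the
flux. It makes |flux| a function on shape space. -/
lemma IsImm.abs_flux_comp [ConnectedSpace M] {f : M → Ambient m} (hf : IsImm f)
    (o : ManifoldOrientation m M) (φ : Diffeomorph (𝓡 m) (𝓡 m) M M ∞) (ψ : Ambient m → ℝ)
    (e : Ambient m) : |flux o ψ e (f ∘ φ)| = |flux o ψ e f| := by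
  obtain ⟨σ, hσ, h⟩ := hf.unitNormal_comp_eq o φ
  have h1 : flux o ψ e (f ∘ φ) = σ * flux o ψ e f := by
    have hmap : ∫ x, ψ (f x) * inner ℝ e (unitNormal o f x) ∂(Measure.map φ (volMeasure (f ∘ φ))) =
        ∫ x, ψ (f (φ x)) * inner ℝ e (unitNormal o f (φ x)) ∂(volMeasure (f ∘ φ)) :=
      φ.toHomeomorph.measurableEmbedding.integral_map _
    rw [flux, flux, hf.volMeasure_comp_diffeomorph φ, hmap, ← integral_const_mul]
    refine integral_congr_ae (Filter.Eventually.of_forall fun x => ?_)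
    change ψ (f (φ x)) * inner ℝ e (unitNormal o (f ∘ φ) x) =
      σ * (ψ (f (φ x)) * inner ℝ e (unitNormal o f (φ x)))
    rw [h, inner_smul_right]
    ring
  rw [h1, abs_mul, hσ, one_mul]

end Reparametrization

/-! ### Embeddings with the same image -/

section Embeddings

variable {m : ℕ} {M : Type*} [TopologicalSpace M] [ChartedSpace (Model m) M]
  [IsManifold (𝓡 m) ∞ M]

/-- A continuous map whose composition with an immersion is smooth is smooth. -/
lemma IsImm.contMDiff_of_comp {f : M → Ambient m} (hf : IsImm f) {φ : M → M} (hφ : Continuous φ)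
    (h : ContMDiff (𝓡 m) 𝓘(ℝ, Ambient m) ∞ (f ∘ φ)) : ContMDiff (𝓡 m) (𝓡 m) ∞ φ := by
  intro x
  refine contMDiffAt_iff_target.2 ⟨hφ.continuousAt, ?_⟩
  set c := φ x with hc
  -- With P a linear left inverse of df at c, the map P ∘ f has derivative the identity in the
  -- chart. Its smooth local inverse recovers φ from P ∘ (f ∘ φ); continuity of φ keeps the values
  -- in the domain of the inverse.
  obtain ⟨P₀, hP₀⟩ := (dAt m f c : Model m →ₗ[ℝ] Ambient m).exists_leftInverse_of_injective
    (LinearMap.ker_eq_bot.2 (hf.injective_dAt c))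
  set P : Ambient m →L[ℝ] Model m := LinearMap.toContinuousLinearMap P₀
  have hC : ContDiffAt ℝ ∞ (P ∘ localRep f c) (extChartAt (𝓡 m) c c) :=
    P.contDiff.contDiffAt.comp _ ((contDiffOn_localRep hf.1 c).contDiffAt
      ((isOpen_extChartAt_target c).mem_nhds (mem_extChartAt_target c)))
  have hD : HasFDerivAt (P ∘ localRep f c)
      ((ContinuousLinearEquiv.refl ℝ (Model m) : Model m ≃L[ℝ] Model m) : Model m →L[ℝ] Model m)
      (extChartAt (𝓡 m) c c) := by
    have h1 := P.hasFDerivAt.comp (extChartAt (𝓡 m) c c)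
      (differentiableAt_comp_chart_symm hf.1 c (mem_extChartAt_target c)).hasFDerivAt
    refine h1.congr_fderiv ?_
    ext1 v
    exact LinearMap.congr_fun hP₀ v
  have hG := hC.to_localInverse hD (by simp)
  have hinv := (hC.hasStrictFDerivAt' hD (by simp)).eventually_left_inverse
  have hcont : Filter.Tendsto (extChartAt (𝓡 m) c ∘ φ) (nhds x) (nhds (extChartAt (𝓡 m) c c)) :=
    ContinuousAt.comp (g := extChartAt (𝓡 m) c) (continuousAt_extChartAt c) hφ.continuousAt
  have hev : extChartAt (𝓡 m) c ∘ φ =ᶠ[nhds x]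
      (hC.localInverse hD (by simp)) ∘ fun y => P ((f ∘ φ) y) := by
    filter_upwards [hcont.eventually hinv,
      hφ.continuousAt.eventually (extChartAt_source_mem_nhds (I := 𝓡 m) c)] with y hy hy'
    refine hy.symm.trans ?_
    simp only [Function.comp_apply, localRep]
    rw [(extChartAt (𝓡 m) c).left_inv hy']
    rfl
  refine ContMDiffAt.congr_of_eventuallyEq ?_ hev
  refine ContMDiffAt.comp x (I' := 𝓘(ℝ, Model m)) ?_
    (P.contDiff.contMDiff.contMDiffAt.comp x (h x))
  have hpt : P ((f ∘ φ) x) = (P ∘ localRep f c) (extChartAt (𝓡 m) c c) := by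
    simp only [Function.comp_apply, localRep]
    rw [(extChartAt (𝓡 m) c).left_inv (mem_extChartAt_source c)]
  rw [hpt]
  exact hG.contMDiffAt

/-- Two embeddings with the same image differ by a diffeomorphism. -/
lemma IsImm.exists_diffeomorph {f g : M → Ambient m} (hf : IsImm f) (hg : IsImm g)
    (hfe : Topology.IsEmbedding f) (hge : Topology.IsEmbedding g)
    (h : Set.range g = Set.range f) :
    ∃ φ : Diffeomorph (𝓡 m) (𝓡 m) M M ∞, g = f ∘ φ := by
  -- The homeomorphism f⁻¹ ∘ g; both directions are smooth by `IsImm.contMDiff_of_comp`.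
  set Φ : M ≃ₜ M := hge.toHomeomorph.trans ((Homeomorph.setCongr h).trans hfe.toHomeomorph.symm)
  have h1 : f ∘ Φ = g := by
    funext x
    exact congrArg Subtype.val
      (hfe.toHomeomorph.apply_symm_apply (Homeomorph.setCongr h (hge.toHomeomorph x)))
  have h2 : g ∘ Φ.symm = f := by
    rw [← h1]
    funext x
    simp
  refine ⟨⟨Φ.toEquiv, ?_, ?_⟩, h1.symm⟩
  · exact hf.contMDiff_of_comp Φ.continuous (h1.symm ▸ hg.1)
  · exact hg.contMDiff_of_comp Φ.symm.continuous (h2.symm ▸ hf.1)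

open MeasureTheory in
/-- An embedded hypersurface is detected near one of its points by the flux of a vector field that
vanishes on a given closed set. -/
lemma IsImm.exists_flux_pos [T2Space M] [CompactSpace M] [MeasurableSpace M] [BorelSpace M]
    {f : M → Ambient m} (hf : IsImm f) (hfe : Topology.IsEmbedding f)
    (o : ManifoldOrientation m M) {Z : Set (Ambient m)} (hZ : IsClosed Z) {p : M} (hp : f p ∉ Z) :
    ∃ (ψ : Ambient m → ℝ) (e : Ambient m) (K : ℝ), ContDiff ℝ ∞ ψ ∧
      (∀ y, |fderiv ℝ ψ y e| ≤ K) ∧ (∀ z ∈ Z, ψ z = 0) ∧ 0 < flux o ψ e f := by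
  have hν := (hf.contMDiff_unitNormal o).continuous
  set e := unitNormal o f p with he
  set a : M → ℝ := fun x => inner ℝ e (unitNormal o f x) with ha
  have hac : Continuous a := continuous_const.inner hν
  have hap : a p = 1 := by
    simp only [ha, ← he]
    rw [real_inner_self_eq_norm_sq, he, hf.norm_unitNormal, one_pow]
  have hU : {x | 0 < a x} ∈ nhds p :=
    (isOpen_lt continuous_const hac).mem_nhds (by simp [hap])
  -- Here the embedding matters: no distant part of M enters a small ball around f p, so ⟨e, ν⟩ > 0
  -- wherever the bump is felt and the flux cannot cancel.
  rw [hfe.nhds_eq_comap] at hU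
  obtain ⟨W, hW, hWU⟩ := hU
  obtain ⟨r, hr, hrW⟩ := Metric.mem_nhds_iff.1
    (Filter.inter_mem hW (hZ.isOpen_compl.mem_nhds hp))
  let ψ : ContDiffBump (f p) := ⟨r / 2, r, by positivity, by linarith⟩
  have hout : ∀ y, y ∉ Metric.ball (f p) r → ψ y = 0 := fun y hy =>
    ψ.zero_of_le_dist (not_lt.1 hy)
  have hψ : ContDiff ℝ ∞ ψ := ψ.contDiff
  obtain ⟨K, hK⟩ := (hψ.continuous_fderiv (by simp)).bounded_above_of_compact_support
    (ψ.hasCompactSupport.fderiv ℝ)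
  refine ⟨ψ, e, K * ‖e‖, hψ, fun y => ?_, fun z hz => ?_, ?_⟩
  · exact ((fderiv ℝ ψ y).le_opNorm e).trans (mul_le_mul_of_nonneg_right (hK y) (norm_nonneg _))
  · exact hout z fun hz' => (hrW hz').2 hz
  · have := hf.isFiniteMeasure
    have := hf.isOpenPosMeasure
    refine Continuous.integral_pos_of_hasCompactSupport_nonneg_nonzero (x := p)
      (f := fun x => ψ (f x) * a x) ((ψ.continuous.comp hf.1.continuous).mul hac)
      (HasCompactSupport.of_compactSpace _) (fun x => ?_) ?_
    · by_cases hx : f x ∈ Metric.ball (f p) r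
      · exact mul_nonneg ψ.nonneg (hWU (hrW hx).1).le
      · simp [hout _ hx]
    · simp only [hap, mul_one]
      exact (ψ.pos_of_mem_ball (Metric.mem_ball_self hr)).ne'

end Embeddings

end ShapeSpace

end

/-! ### The main theorem -/

open ShapeSpace in
theorem mainTheorem4 {m : ℕ} {M : Type*} [TopologicalSpace M] [ChartedSpace (Model m) M]
    [IsManifold (𝓡 m) ∞ M] [T2Space M] [CompactSpace M] [ConnectedSpace M]
    [MeasurableSpace M] [BorelSpace M] (o : ManifoldOrientation m M)
    (Φ : ℝ → ℝ → ℝ)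
    (hΦ : ContDiffOn ℝ ∞ (fun p : ℝ × ℝ => Φ p.1 p.2) (Set.Ioi 0 ×ˢ Set.univ))
    (hbound :
      (∃ C₁ > 0, ∃ C₂ > 0, ∀ (f : Imm m M) (x : M),
        C₁ + C₂ * meanCurvature o f.1 x ^ 2 ≤ Φ (totalVol f.1) (meanCurvature o f.1 x)) ∨
      (∃ C > 0, ∀ (f : Imm m M) (x : M),
        C * totalVol f.1 ≤ Φ (totalVol f.1) (meanCurvature o f.1 x))) :
    ∀ F₀ ∈ embShapes m M, ∀ F₁ ∈ embShapes m M, F₀ ≠ F₁ → 0 < geodesicDist o Φ F₀ F₁ := by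
  rintro _ ⟨f, hfe, rfl⟩ _ ⟨g, hge, rfl⟩ hne
  have hf : IsImm f.1 := f.2
  have hg : IsImm g.1 := g.2
  obtain ⟨ψ, e, K, hψ, hK, hδ⟩ : ∃ (ψ : Ambient m → ℝ) (e : Ambient m) (K : ℝ), ContDiff ℝ ∞ ψ ∧
      (∀ y, |fderiv ℝ ψ y e| ≤ K) ∧ |flux o ψ e f.1| ≠ |flux o ψ e g.1| := by
    have hflux : ∀ {ψ : Ambient m → ℝ} (e : Ambient m) {k : M → Ambient m},
        (∀ z ∈ Set.range k, ψ z = 0) → flux o ψ e k = 0 := by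
      intro ψ e k h
      have h0 : ∀ x, ψ (k x) = 0 := fun x => h _ ⟨x, rfl⟩
      simp [flux, h0]
    -- The images differ, since otherwise the shapes would be equal, so one of them has a point off
    -- the other; which one decides the embedding that carries the positive flux.
    by_cases hfg : Set.range f.1 ⊆ Set.range g.1
    · have hgf : ¬ Set.range g.1 ⊆ Set.range f.1 := fun h =>
        hne (Quotient.sound (hf.exists_diffeomorph hg hfe hge (h.antisymm hfg)))
      obtain ⟨_, ⟨p, rfl⟩, hp⟩ := Set.not_subset.1 hgf
      obtain ⟨ψ, e, K, hψ, hK, h0, h1⟩ :=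
        hg.exists_flux_pos hge o (isCompact_range hf.1.continuous).isClosed hp
      exact ⟨ψ, e, K, hψ, hK, by rw [hflux e h0, abs_zero]; exact (abs_pos.2 h1.ne').ne⟩
    · obtain ⟨_, ⟨p, rfl⟩, hp⟩ := Set.not_subset.1 hfg
      obtain ⟨ψ, e, K, hψ, hK, h0, h1⟩ :=
        hf.exists_flux_pos hfe o (isCompact_range hg.1.continuous).isClosed hp
      exact ⟨ψ, e, K, hψ, hK, by rw [hflux e h0, abs_zero]; exact (abs_pos.2 h1.ne').ne'⟩
  -- The bound is fixed before the path: its endpoints are reparametrizations of f and g, so the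
  -- initial volume and the two values of |flux| are already known. The reverse triangle inequality
  -- passes from |flux| to flux.
  obtain ⟨ε, hε, hle⟩ := exists_le_shapeLength o Φ hΦ hbound hψ hK (totalVol f.1)
    |(|flux o ψ e g.1| - |flux o ψ e f.1|)| (abs_pos.2 (sub_ne_zero.2 hδ.symm))
  refine hε.trans_le (le_iInf fun γ => le_iInf fun h0 => le_iInf fun h1 => ?_)
  obtain ⟨φ₀, h0⟩ : ∃ φ : Diffeomorph (𝓡 m) (𝓡 m) M M ∞, γ.toFun 0 = f.1 ∘ φ :=
    Quotient.exact h0.symm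
  obtain ⟨φ₁, h1⟩ : ∃ φ : Diffeomorph (𝓡 m) (𝓡 m) M M ∞, γ.toFun 1 = g.1 ∘ φ :=
    Quotient.exact h1.symm
  refine hle γ (by rw [h0, hf.totalVol_comp]) ?_
  rw [← hf.abs_flux_comp o φ₀, ← hg.abs_flux_comp o φ₁, ← h0, ← h1]
  exact abs_abs_sub_abs_le_abs_sub _ _
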